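/- Let $X$ be a smooth $n$-dimensional manifold with a smooth Riemannian metric $g$, let $f:X\to\mathbb R$ be a Morse function (smooth, all critical points non-degenerate), $V=\nabla f$, and let $p$ be a critical point of $f$. Let $\lambda_1,\dots,\lambda_n$ be the Morse eigenvalues of $p$, i.e. the eigenvalues, with multiplicity, of $g^{-1}\mathrm{Hess} f(p)$ on $T_pX$, ordered so that $\lambda_1,\dots,\lambda_k<0<\lambda_{k+1},\dots,\lambda_n$ (so $k$ is the Morse index of $p$). Assume the $\mathbb N$-linearity condition: $a_1\lambda_1+\dots+a_n\lambda_n\neq\lambda_i$ for all $i$ and all $a\in\mathbb N^n$ with $a_1+\dots+a_n\ge 2$. Put $V_0(\mathbf x)=\sum_i\lambda_ix_i\,\partial/\partial x_i$. Let $W^s$ (resp. $W^u$) be the stable (resp. unstable) manifold of $p$: the set of the points $x\in X$ such that the integral curve of $-\nabla f$ through $x$ at time $0$ exists for all $t\ge0$ (resp. $t\le 0$) and converges to $p$ as $t\to+\infty$ (resp. $t\to-\infty$). A function is called flat at a point if it is smooth near that point and all its derivatives, of order $0,1,2,\dots$, vanish there. (1) For every open neighbourhood $U$ of $p$ there is a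 smooth local chart (a smooth diffeomorphism $\Phi:\hat U\to\Phi(\hat U)$ with smooth inverse, $\hat U\subset\mathbb R^n$ an open neighbourhood of $\mathbf 0$ and $\Phi(\hat U)\subset U$ open) with $\Phi(\mathbf 0)=p$ such that $$\Phi\big((\mathbb R^k\times\{\mathbf 0\})\cap\hat U\big)=W^u\cap\Phi(\hat U),\qquad \Phi\big((\{\mathbf 0\}\times\mathbb R^{n-k})\cap\hat U\big)=W^s\cap\Phi(\hat U),$$ and $|\Phi^*V-V_0|(\mathbf x)=O(|\mathbf x|^\infty)$ on $\hat U$: $\Phi^*V-V_0$ is flat at $\mathbf 0$, and for every $N\in\mathbb N$ there is a constant $C$ with $|\Phi^*V-V_0|(\mathbf x)\le C|\mathbf x|^N$ for all $\mathbf x\in\hat U$. (2) In every smooth local chart $\phi$ with $\phi(\mathbf 0)=p$ for which $\phi^*V-V_0$ is flat at $\mathbf 0$, the manifolds $W^u$ and $W^s$ are graphs of flat functions near $\mathbf 0$: there are open neighbourhoods $A\subset\mathbb R^k$ and $B\subset\mathbb R^{n-k}$ of the origins, with $A\times B$ in the domain of $\phi$, and smooth maps $Y:A\to B$, $Z:B\to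 A$, flat at the origins, such that for all $(a,b)\in A\times B$: $\phi(a,b)\in W^u$ if and only if $b=Y(a)$, and $\phi(a,b)\in W^s$ if and only if $a=Z(b)$. -/

import Mathlib

open Set Filter Topology Bundle Manifold
open scoped ContDiff

namespace MorseGradient

/-- The model space `ℝⁿ`, with its Euclidean norm. -/
abbrev Rn (n : ℕ) : Type := EuclideanSpace ℝ (Fin n)

/-- The tangent space at `x` of a manifold modelled on `ℝⁿ`. -/
abbrev TSp (n : ℕ) {X : Type*} [TopologicalSpace X] [ChartedSpace (Rn n) X] (x : X) : Type :=
  TangentSpace 𝓘(ℝ, Rn n) x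

/-- The `ℕ`-linearity condition: `a₁ λ₁ + ⋯ + aₙ λₙ - λᵢ = 0` has no solution with
`a ∈ ℕⁿ`, `a₁ + ⋯ + aₙ ≥ 2` and `i ∈ {1, …, n}`. -/
def NLinearity {n : ℕ} (lam : Fin n → ℝ) : Prop :=
  ∀ (a : Fin n → ℕ) (i : Fin n), 2 ≤ ∑ j, a j → (∑ j, (a j : ℝ) * lam j) - lam i ≠ 0

section Riemannian

variable (n : ℕ) {X : Type*} [TopologicalSpace X] [ChartedSpace (Rn n) X]

/-- The second derivative of `f` at `p`, as a bilinear form on the tangent space at `p`, read in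
the preferred chart at `p` (the chart through which Mathlib identifies that tangent space with
`ℝⁿ`). At a critical point it does not depend on the chart and equals the Hessian `∇df (p)`; it is
used at critical points only. -/
noncomputable def hess (f : X → ℝ) (p : X) : TSp n p →L[ℝ] TSp n p →L[ℝ] ℝ :=
  fderiv ℝ (fderiv ℝ (f ∘ (extChartAt 𝓘(ℝ, Rn n) p).symm)) (extChartAt 𝓘(ℝ, Rn n) p p)

variable [RiemannianBundle (fun x : X => TangentSpace 𝓘(ℝ, Rn n) x)]

/-- The vector of the tangent space at `x` that represents a covector through the Riemannian
metric ("raising the index"): `⟪sharp x ℓ, v⟫ = ℓ v`. -/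
noncomputable def sharp (x : X) (l : TSp n x →L[ℝ] ℝ) : TSp n x :=
  haveI : FiniteDimensional ℝ (TSp n x) := inferInstanceAs (FiniteDimensional ℝ (Rn n))
  haveI : CompleteSpace (TSp n x) := FiniteDimensional.complete ℝ (TSp n x)
  (InnerProductSpace.toDual ℝ (TSp n x)).symm l

theorem inner_sharp (x : X) (l : TSp n x →L[ℝ] ℝ) (v : TSp n x) : inner ℝ (sharp n x l) v = l v := by
  have : FiniteDimensional ℝ (TSp n x) := inferInstanceAs (FiniteDimensional ℝ (Rn n))
  have : CompleteSpace (TSp n x) := FiniteDimensional.complete ℝ (TSp n x)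
  exact InnerProductSpace.toDual_symm_apply

/-- The Riemannian gradient: `⟪∇f (x), v⟫ = df (x) v`. -/
noncomputable def grad (f : X → ℝ) (x : X) : TSp n x :=
  sharp n x (mfderiv 𝓘(ℝ, Rn n) 𝓘(ℝ, ℝ) f x)

/-- `p` is a critical point of `f`. -/
def IsCritical (f : X → ℝ) (p : X) : Prop := grad n f p = 0

/-- A Morse function: smooth, with non-degenerate critical points only. -/
def IsMorse (f : X → ℝ) : Prop :=
  ContMDiff 𝓘(ℝ, Rn n) 𝓘(ℝ, ℝ) ∞ f ∧
    ∀ p : X, IsCritical n f p → ∀ u : TSp n p, (∀ v : TSp n p, hess n f p u v = 0) → u = 0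

/-- The operator `g⁻¹ Hess f` on the tangent space at `p`: `⟪hessOp n f p u, v⟫ = hess n f p u v`.
At a critical point this is the covariant derivative of `∇f`. -/
noncomputable def hessOp (f : X → ℝ) (p : X) : TSp n p →ₗ[ℝ] TSp n p where
  toFun u := sharp n p (hess n f p u)
  map_add' u v := by simp [sharp]
  map_smul' c u := by simp [sharp]

/-- `lam` lists the Morse eigenvalues of `p`, i.e. the eigenvalues of `g⁻¹ Hess f (p)`, with
multiplicity. -/
def IsMorseEigenvalues (f : X → ℝ) (p : X) (lam : Fin n → ℝ) : Prop :=
  haveI : FiniteDimensional ℝ (TSp n p) := inferInstanceAs (FiniteDimensional ℝ (Rn n))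
  (hessOp n f p).charpoly = ∏ i, (Polynomial.X - Polynomial.C (lam i))

/-- The stable manifold of `p` for the Morse flow, that is the flow of `-∇f`. -/
def stableManifold (f : X → ℝ) (p : X) : Set X :=
  {x | ∃ γ : ℝ → X, γ 0 = x ∧
    IsMIntegralCurveOn (I := 𝓘(ℝ, Rn n)) γ (fun y => -grad n f y) (Ici 0) ∧
    Tendsto γ atTop (𝓝 p)}

/-- The unstable manifold of `p` for the Morse flow, that is the flow of `-∇f`. -/
def unstableManifold (f : X → ℝ) (p : X) : Set X :=
  {x | ∃ γ : ℝ → X, γ 0 = x ∧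
    IsMIntegralCurveOn (I := 𝓘(ℝ, Rn n)) γ (fun y => -grad n f y) (Iic 0) ∧
    Tendsto γ atBot (𝓝 p)}

end Riemannian

/-- The vector field `∇f` in the coordinates of a chart `φ`, i.e. `Φ^* ∇f` for the
parametrization `Φ = φ.symm`. -/
noncomputable def gradInChart {n : ℕ} {X : Type*} [TopologicalSpace X] [ChartedSpace (Rn n) X]
    [RiemannianBundle (fun x : X => TangentSpace 𝓘(ℝ, Rn n) x)]
    (f : X → ℝ) (φ : OpenPartialHomeomorph X (Rn n)) (x : Rn n) : Rn n :=
  VectorField.mpullback 𝓘(ℝ, Rn n) 𝓘(ℝ, Rn n) φ.symm (grad n f) x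

/-- The standard form `V₀ (x) = ∑ λᵢ xᵢ ∂/∂xᵢ`. -/
def standardForm {n : ℕ} (lam : Fin n → ℝ) (x : Rn n) : Rn n :=
  WithLp.toLp 2 (fun i => lam i * x i)

/-- `G` is smooth near `x` and all its derivatives vanish at `x`, the value included. -/
def IsFlatAt {E F : Type*} [NormedAddCommGroup E] [NormedSpace ℝ E]
    [NormedAddCommGroup F] [NormedSpace ℝ F] (G : E → F) (x : E) : Prop :=
  ContDiffAt ℝ ∞ G x ∧ ∀ m : ℕ, iteratedFDeriv ℝ m G x = 0

/-- A smooth chart of `X` around `p`, centred at `p`. -/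
def IsCentredChart {n : ℕ} {X : Type*} [TopologicalSpace X] [ChartedSpace (Rn n) X]
    (φ : OpenPartialHomeomorph X (Rn n)) (p : X) : Prop :=
  φ ∈ IsManifold.maximalAtlas 𝓘(ℝ, Rn n) ∞ X ∧ p ∈ φ.source ∧ φ p = 0

/-- The coordinate plane `ℝᵏ × {0}` in `ℝⁿ`. -/
def firstPlane (n k : ℕ) : Set (Rn n) := {x | ∀ i : Fin n, k ≤ (i : ℕ) → x i = 0}

/-- The coordinate plane `{0} × ℝⁿ⁻ᵏ` in `ℝⁿ`. -/
def lastPlane (n k : ℕ) : Set (Rn n) := {x | ∀ i : Fin n, (i : ℕ) < k → x i = 0}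

/-- The point `(a, b)` of `ℝᵏ × ℝⁿ⁻ᵏ = ℝⁿ`, for `k ≤ n`. -/
def joinCoords {n k : ℕ} (a : Rn k) (b : Rn (n - k)) : Rn n :=
  WithLp.toLp 2 (fun i => if h : (i : ℕ) < k then a ⟨i, h⟩ else b ⟨i - k, by omega⟩)

end MorseGradient

open MorseGradient

/-! Linearization. An affine change of coordinates carrying an eigenbasis of `hessOp` to the
standard basis makes `V₀` the linear part of the gradient field `V` at `p`
(`exists_isCentredChart_fderiv_gradInChart`). It remains to find coordinates `H` with leading term
`x i` and `dH(V) = λᵢ H` up to a flat error. A monomial of degree at least 2 with exponents `a` is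
an eigenvector of `S ↦ dS(V₀) - λᵢ S` with eigenvalue `∑ aⱼ λⱼ - λᵢ`. `ℕ`-linearity says that these
eigenvalues are not zero, so the error can be removed degree by degree (`exists_form_improving`).
Borel's lemma (`exists_contDiff_isBigO_sub_sum`) realizes the resulting formal series by smooth
functions, and the inverse function theorem makes them a chart (`exists_flat_chart`).

Invariant manifolds. In a chart where `V - V₀` is flat, the forward orbits of `-V` that stay near
the origin are found by Perron's method. They are the small bounded solutions of `x + K (N x) = D
ξ`, where `D ξ` is the bounded solution of the linear equation with stable initial part `ξ`, `K`
solves the inhomogeneous linear equation, and `N` is superposition with `V - V₀`. The inverse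
function theorem in a space of bounded continuous functions solves this smoothly in `ξ`. The
unstable component of the initial value only involves `K (N x)`, so it is a flat function of `ξ`
(`exists_local_stable_graph`).

From local to global. `stableManifold` is defined by convergence alone, so an orbit starting near
`p` might a priori leave and come back. The gradient structure forbids this: near `p` the function
`f + κ ‖x‖ ^ 2` decreases along orbits, while `f ≥ f p` along an orbit that tends to `p`, so the
orbit stays trapped. The same functions show that trapped orbits converge
(`exists_mem_stableManifold_iff`, `tendsto_zero_of_lyapunov`). Replacing `f` by `-f` gives the
unstable manifold.

The graph statement (2) follows at once. For (1), subtracting both flat graph functions from the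
coordinates straightens both manifolds and changes the field by a flat error only
(`exists_straight_chart`). -/

namespace MorseGradient

/-! ### Flatness as vanishing derivatives, and as decay faster than every power. -/

section Flat

open Asymptotics

/-- `G` vanishes to infinite order at the origin. -/
def IsFlatBigO {E F : Type*} [NormedAddCommGroup E] [NormedAddCommGroup F] (G : E → F) : Prop :=
  ∀ N : ℕ, G =O[𝓝 0] fun x => ‖x‖ ^ N

theorem isBigO_norm_pow_of_le {E : Type*} [NormedAddCommGroup E] {m N : ℕ} (h : m ≤ N) :
    (fun x : E => ‖x‖ ^ N) =O[𝓝 0] fun x => ‖x‖ ^ m := by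
  refine IsBigO.of_bound 1 ?_
  filter_upwards [Metric.ball_mem_nhds (0 : E) one_pos] with x hx
  rw [Metric.mem_ball, dist_zero_right] at hx
  rw [Real.norm_of_nonneg (by positivity), Real.norm_of_nonneg (by positivity), one_mul]
  exact pow_le_pow_of_le_one (norm_nonneg _) hx.le h

theorem exists_bound_of_isBigO_norm_pow {E F : Type*} [NormedAddCommGroup E]
    [NormedAddCommGroup F] {G : E → F} {N : ℕ} (h : G =O[𝓝 0] fun x => ‖x‖ ^ N) :
    ∃ C ≥ 0, ∃ r > 0, ∀ x, ‖x‖ < r → ‖G x‖ ≤ C * ‖x‖ ^ N := by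
  obtain ⟨C, hC0, hC⟩ := h.exists_nonneg
  obtain ⟨r, hr, hball⟩ := Metric.eventually_nhds_iff_ball.1 hC.bound
  refine ⟨C, hC0, r, hr, fun x hx => ?_⟩
  have := hball x (by simpa using hx)
  rwa [Real.norm_of_nonneg (by positivity)] at this

theorem isBigO_norm_pow_of_bound {E F : Type*} [NormedAddCommGroup E]
    [NormedAddCommGroup F] {G : E → F} {N : ℕ} {C r : ℝ} (hr : 0 < r)
    (h : ∀ x, ‖x‖ < r → ‖G x‖ ≤ C * ‖x‖ ^ N) : G =O[𝓝 0] fun x => ‖x‖ ^ N := by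
  refine IsBigO.of_bound C (Metric.eventually_nhds_iff_ball.2 ⟨r, hr, fun x hx => ?_⟩)
  rw [Real.norm_of_nonneg (by positivity)]
  exact h x (by simpa using hx)

variable {E : Type} [NormedAddCommGroup E] [NormedSpace ℝ E]
  {F : Type} [NormedAddCommGroup F] [NormedSpace ℝ F] {G : E → F}

/-- Mean value inequality on the closed ball of radius `‖x‖`. -/
theorem isBigO_norm_pow_of_fderiv (hG : ContDiffAt ℝ 1 G 0) (h0 : G 0 = 0) {N : ℕ}
    (h : fderiv ℝ G =O[𝓝 0] fun x => ‖x‖ ^ N) : G =O[𝓝 0] fun x => ‖x‖ ^ (N + 1) := by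
  obtain ⟨C, hC0, r, hr, hC⟩ := exists_bound_of_isBigO_norm_pow h
  have hd : ∀ᶠ x in 𝓝 (0 : E), DifferentiableAt ℝ G x :=
    (hG.eventually (by simp)).mono fun x hx => hx.differentiableAt one_ne_zero
  obtain ⟨s, hs, hball⟩ := Metric.eventually_nhds_iff_ball.1 hd
  refine isBigO_norm_pow_of_bound (C := C) (lt_min hr hs) fun x hx => ?_
  have hsub : ∀ y ∈ Metric.closedBall (0 : E) ‖x‖, ‖y‖ ≤ ‖x‖ := fun y hy => by
    rwa [Metric.mem_closedBall, dist_zero_right] at hy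
  have := (convex_closedBall (0 : E) ‖x‖).norm_image_sub_le_of_norm_fderiv_le (𝕜 := ℝ)
    (C := C * ‖x‖ ^ N)
    (fun y hy => hball y (by
      simpa using (hsub y hy).trans_lt (hx.trans_le (min_le_right _ _))))
    (fun y hy => (hC y ((hsub y hy).trans_lt (hx.trans_le (min_le_left _ _)))).trans
      (by gcongr; exact hsub y hy)) (x := 0) (y := x) (by simp) (by simp)
  rw [h0, sub_zero, sub_zero] at this
  rwa [pow_succ, ← mul_assoc]

/-- A Landau-type interpolation: a difference quotient bounds the derivative, at the price of
halving the order of vanishing. The loss is harmless for flat maps, so their derivatives are flat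
again. -/
theorem isBigO_fderiv_norm_pow (hG : ContDiffAt ℝ 2 G 0) {N : ℕ}
    (h : G =O[𝓝 0] fun x => ‖x‖ ^ (2 * (N + 1))) :
    fderiv ℝ G =O[𝓝 0] fun x => ‖x‖ ^ (N + 1) := by
  obtain ⟨C, hC0, r, hr, hC⟩ := exists_bound_of_isBigO_norm_pow h
  obtain ⟨K, t, ht, hK⟩ := (hG.fderiv_right (m := 1) (by norm_num)).exists_lipschitzOnWith
  have hd : ∀ᶠ x in 𝓝 (0 : E), DifferentiableAt ℝ G x :=
    (hG.eventually (by simp)).mono fun x hx => hx.differentiableAt two_ne_zero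
  obtain ⟨s, hs, hball⟩ := Metric.eventually_nhds_iff_ball.1 (hd.and ht)
  refine isBigO_norm_pow_of_bound (C := C * 2 ^ (2 * (N + 1)) + C + K)
    (r := min (min r s / 2) 1) (by positivity) fun x hx => ?_
  have hx1 : ‖x‖ < 1 := hx.trans_le (min_le_right _ _)
  have hx2 : ‖x‖ < min r s / 2 := hx.trans_le (min_le_left _ _)
  have hxr : 2 * ‖x‖ < r := by linarith [min_le_left r s]
  have hxs : 2 * ‖x‖ < s := by linarith [min_le_right r s]
  have hC' : 0 ≤ (C * 2 ^ (2 * (N + 1)) + C + K) * ‖x‖ ^ (N + 1) := by positivity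
  -- The step length chosen below vanishes at the origin, where the derivative is zero because `G`
  -- is at least quadratically small.
  rcases eq_or_ne x 0 with rfl | hx0
  · have := Asymptotics.IsBigO.hasFDerivAt (x₀ := (0 : E)) (𝕜 := ℝ) (n := 2 * (N + 1)) (f := G)
      (by simpa using h) (by omega)
    rw [this.fderiv, norm_zero]; exact hC'
  have hn : 0 < ‖x‖ := norm_pos_iff.2 hx0
  refine ContinuousLinearMap.opNorm_le_of_unit_norm hC' fun v hv => ?_
  -- With this step length the values of `G` and the second-order error `K * η * η` are both of
  -- order `η ^ 2`, so dividing by `η` leaves order `η`.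
  set η := ‖x‖ ^ (N + 1) with hη
  have hη0 : 0 < η := by positivity
  have hηx : η ≤ ‖x‖ := by
    rw [hη, pow_succ]; exact mul_le_of_le_one_left hn.le (pow_le_one₀ hn.le hx1.le)
  have hsub : ∀ y ∈ Metric.closedBall x η, ‖y‖ ≤ 2 * ‖x‖ := fun y hy => by
    rw [Metric.mem_closedBall, dist_eq_norm] at hy
    have := norm_add_le (y - x) x
    rw [sub_add_cancel] at this; linarith
  have hmem : ∀ y ∈ Metric.closedBall x η, y ∈ Metric.ball (0 : E) s := fun y hy => by
    simpa using (hsub y hy).trans_lt hxs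
  have hxη : x + η • v ∈ Metric.closedBall x η := by
    simp [norm_smul, hv, abs_of_pos hη0]
  have key := (convex_closedBall x η).norm_image_sub_le_of_norm_fderiv_le' (𝕜 := ℝ) (f := G)
    (φ := fderiv ℝ G x) (C := K * η) (fun y hy => (hball y (hmem y hy)).1)
    (fun y hy => by
      have h1 := hK.dist_le_mul y (hball y (hmem y hy)).2 x
        (hball x (by simpa using (by linarith : ‖x‖ < s))).2
      rw [dist_eq_norm] at h1
      refine h1.trans ?_
      gcongr
      exact hy)
    (x := x) (y := x + η • v) (by simp [hη0.le]) hxη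
  rw [add_sub_cancel_left, map_smul, norm_smul η v, hv, mul_one, Real.norm_of_nonneg hη0.le] at key
  have hb1 := hC x (by linarith)
  have hb2 := (hC (x + η • v) ((hsub _ hxη).trans_lt hxr)).trans
    (mul_le_mul_of_nonneg_left (pow_le_pow_left₀ (norm_nonneg _) (hsub _ hxη) _) hC0)
  have hpow : ‖x‖ ^ (2 * (N + 1)) = η * η := by rw [hη, two_mul, pow_add]
  rw [mul_pow, hpow] at hb2
  rw [hpow] at hb1
  have hfin : η * ‖fderiv ℝ G x v‖ ≤ η * ((C * 2 ^ (2 * (N + 1)) + C + K) * η) := by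
    have e : η • fderiv ℝ G x v =
        G (x + η • v) - G x - (G (x + η • v) - G x - η • fderiv ℝ G x v) := by abel
    have : ‖η • fderiv ℝ G x v‖ = η * ‖fderiv ℝ G x v‖ := by
      rw [norm_smul, Real.norm_of_nonneg hη0.le]
    rw [← this, e]
    refine (norm_sub_le _ _).trans ((add_le_add (norm_sub_le _ _) key).trans ?_)
    nlinarith
  exact le_of_mul_le_mul_left hfin hη0

theorem IsFlatBigO.fderiv (hG : ContDiffAt ℝ ∞ G 0) (h : IsFlatBigO G) :
    IsFlatBigO (fderiv ℝ G) := fun N =>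
  (isBigO_fderiv_norm_pow (hG.of_le (by exact WithTop.coe_le_coe.2 le_top)) (h _)).trans
    (isBigO_norm_pow_of_le (Nat.le_succ N))

theorem IsFlatBigO.apply_zero {E F : Type*} [NormedAddCommGroup E] [NormedAddCommGroup F]
    {G : E → F} (h : IsFlatBigO G) : G 0 = 0 := by
  obtain ⟨C, -, r, hr, hC⟩ := exists_bound_of_isBigO_norm_pow (h 1)
  simpa using hC 0 (by simpa using hr)

/-- The codomain is quantified inside the induction because passing to `fderiv` changes it. -/
theorem IsFlatBigO.iteratedFDeriv_eq_zero (m : ℕ) : ∀ {F : Type} [NormedAddCommGroup F]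
    [NormedSpace ℝ F] {G : E → F}, ContDiffAt ℝ ∞ G 0 → IsFlatBigO G →
    iteratedFDeriv ℝ m G 0 = 0 := by
  induction m with
  | zero =>
    intro F _ _ G hG h
    rw [← norm_eq_zero, norm_iteratedFDeriv_zero, h.apply_zero, norm_zero]
  | succ m ih =>
    intro F _ _ G hG h
    rw [← norm_eq_zero, ← norm_iteratedFDeriv_fderiv,
      ih (hG.fderiv_right (m := ∞) (by simp)) (h.fderiv hG), norm_zero]

theorem IsFlatBigO.isFlatAt (hG : ContDiffAt ℝ ∞ G 0) (h : IsFlatBigO G) : IsFlatAt G 0 :=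
  ⟨hG, fun m => IsFlatBigO.iteratedFDeriv_eq_zero m hG h⟩

/-- The derivative of a flat map is flat, and integrating it gains one order at each induction step.
-/
theorem isBigO_of_isFlatAt (N : ℕ) : ∀ {F : Type} [NormedAddCommGroup F]
    [NormedSpace ℝ F] {G : E → F}, IsFlatAt G 0 → G =O[𝓝 0] fun x => ‖x‖ ^ N := by
  induction N with
  | zero =>
    intro F _ _ G h
    simpa using h.1.continuousAt.isBigO_one ℝ
  | succ N ih =>
    intro F _ _ G h
    refine isBigO_norm_pow_of_fderiv (h.1.of_le (by exact_mod_cast le_top)) ?_ (ih ⟨?_, fun m => ?_⟩)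
    · rw [← norm_eq_zero, ← norm_iteratedFDeriv_zero (𝕜 := ℝ), h.2 0, norm_zero]
    · exact h.1.fderiv_right (m := ∞) (by simp)
    · rw [← norm_eq_zero, norm_iteratedFDeriv_fderiv, h.2, norm_zero]

theorem IsFlatAt.isFlatBigO (h : IsFlatAt G 0) : IsFlatBigO G := fun N => isBigO_of_isFlatAt N h

end Flat

/-! ### Taylor expansion along rays. -/

section Taylor

open Asymptotics

variable {E : Type*} [NormedAddCommGroup E] [NormedSpace ℝ E]

theorem iteratedDeriv_comp_smul_line {R : E → ℝ} (hR : ContDiff ℝ ∞ R) (x : E) (k : ℕ) (t : ℝ) :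
    iteratedDeriv k (fun s : ℝ => R (s • x)) t = iteratedFDeriv ℝ k R (t • x) fun _ => x := by
  have h := ((1 : ℝ →L[ℝ] ℝ).smulRight x).iteratedFDeriv_comp_right hR t (i := k)
    (WithTop.coe_le_coe.2 le_top)
  have e : (R ∘ ((1 : ℝ →L[ℝ] ℝ).smulRight x)) = fun s : ℝ => R (s • x) := by
    ext s; simp
  rw [e] at h
  rw [iteratedDeriv_eq_iteratedFDeriv, h]
  simp

/-- One-variable Taylor expansion of `s ↦ R (s • x)` between 0 and 1; each derivative in `s`
contributes one factor `x`, which yields the power of `‖x‖`. -/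
theorem isBigO_sub_taylor {R : E → ℝ} (hR : ContDiff ℝ ∞ R) (m : ℕ) :
    (fun x => R x - ∑ j ∈ Finset.range (m + 1),
      (j.factorial : ℝ)⁻¹ * iteratedFDeriv ℝ j R 0 fun _ => x)
      =O[𝓝 0] fun x => ‖x‖ ^ (m + 1) := by
  have hc : Continuous (iteratedFDeriv ℝ (m + 1) R) :=
    hR.continuous_iteratedFDeriv (WithTop.coe_le_coe.2 le_top)
  set C := ‖iteratedFDeriv ℝ (m + 1) R 0‖ + 1
  have hC : ∀ᶠ y in 𝓝 (0 : E), ‖iteratedFDeriv ℝ (m + 1) R y‖ < C :=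
    hc.norm.continuousAt.eventually_lt_const (lt_add_one _)
  obtain ⟨r, hr, hball⟩ := Metric.eventually_nhds_iff_ball.1 hC
  refine isBigO_norm_pow_of_bound (C := C / m.factorial) hr fun x hx => ?_
  set g : ℝ → ℝ := fun s => R (s • x) with hg
  have hgs : ContDiff ℝ ∞ g := hR.comp (contDiff_id.smul contDiff_const)
  have hw : ∀ k : ℕ, ∀ t ∈ Icc (0 : ℝ) 1, iteratedDerivWithin k g (Icc 0 1) t =
      iteratedFDeriv ℝ k R (t • x) fun _ => x := fun k t ht => by
    rw [iteratedDerivWithin_eq_iteratedDeriv (uniqueDiffOn_Icc one_pos)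
      (hgs.contDiffAt.of_le (WithTop.coe_le_coe.2 le_top)) ht, hg, iteratedDeriv_comp_smul_line hR]
  have key := taylor_mean_remainder_bound (f := g) (a := 0) (b := 1) (n := m) (x := 1)
    (C := C * ‖x‖ ^ (m + 1)) zero_le_one
    (hgs.contDiffOn.of_le (by exact_mod_cast (WithTop.coe_le_coe.2 le_top))) (by simp)
    (fun t ht => by
      rw [hw _ t ht]
      refine (ContinuousMultilinearMap.le_opNorm _ _).trans ?_
      rw [Finset.prod_const, Finset.card_univ, Fintype.card_fin]
      gcongr
      refine (hball _ ?_).le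
      rw [mem_ball_zero_iff, norm_smul, Real.norm_of_nonneg ht.1]
      exact (mul_le_of_le_one_left (norm_nonneg _) ht.2).trans_lt hx)
  rw [taylor_within_apply] at key
  have h1 : g 1 = R x := by simp [hg]
  have h2 : ∀ k ∈ Finset.range (m + 1), (((k.factorial : ℝ)⁻¹ * (1 - 0) ^ k) •
      iteratedDerivWithin k g (Icc 0 1) 0) =
      (k.factorial : ℝ)⁻¹ * iteratedFDeriv ℝ k R 0 fun _ => x := fun k _ => by
    rw [hw k 0 (by simp)]; simp
  rw [h1, Finset.sum_congr rfl h2] at key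
  refine key.trans (le_of_eq ?_)
  simp; ring

/-- Once the lower terms are gone, the term of degree `j` is a difference of two quantities of order
`‖x‖ ^ (j + 1)`, and a homogeneous polynomial of degree `j` of that order is zero. -/
theorem iteratedFDeriv_apply_eq_zero_of_isBigO {R : E → ℝ} (hR : ContDiff ℝ ∞ R) {m : ℕ}
    (h : R =O[𝓝 0] fun x => ‖x‖ ^ m) {j : ℕ} (hj : j < m) (x : E) :
    iteratedFDeriv ℝ j R 0 (fun _ => x) = 0 := by
  induction j using Nat.strong_induction_on generalizing x with
  | _ j ih =>
  have h1 := isBigO_sub_taylor hR j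
  have h2 := h.trans (isBigO_norm_pow_of_le (E := E) (Nat.succ_le_of_lt hj))
  have h3 := (h2.sub h1).const_mul_left (j.factorial : ℝ)
  refine IsBigO.continuousMultilinearMap_apply_eq_zero (p := iteratedFDeriv ℝ j R 0)
    (h3.congr_left fun y => ?_) x
  rw [Finset.sum_range_succ, Finset.sum_eq_zero (fun i hi => by
    rw [ih i (Finset.mem_range.1 hi) ((Finset.mem_range.1 hi).trans hj), mul_zero])]
  have : (j.factorial : ℝ) ≠ 0 := by positivity
  field_simp
  ring

end Taylor

/-! ### Homogeneous forms, and their derivative along the standard field. -/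

section Forms

open Asymptotics

variable {n : ℕ}

/-- The form of degree `m` on `ℝⁿ` with coefficients `c`, in noncommutative monomials. -/
def form {m : ℕ} (c : (Fin m → Fin n) → ℝ) (x : Rn n) : ℝ := ∑ s, c s * ∏ l, x (s l)

theorem contDiff_form {m : ℕ} (c : (Fin m → Fin n) → ℝ) : ContDiff ℝ ∞ (form c) := by
  unfold form
  refine ContDiff.sum fun s _ => contDiff_const.mul (contDiff_prod fun l _ => ?_)
  exact (EuclideanSpace.proj (s l) : Rn n →L[ℝ] ℝ).contDiff

theorem form_smul {m : ℕ} (c : (Fin m → Fin n) → ℝ) (t : ℝ) (x : Rn n) :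
    form c (t • x) = t ^ m * form c x := by
  simp only [form, PiLp.smul_apply, smul_eq_mul, Finset.prod_mul_distrib, Finset.prod_const,
    Finset.card_univ, Fintype.card_fin, Finset.mul_sum]
  exact Finset.sum_congr rfl fun s _ => by ring

theorem abs_form_le {m : ℕ} (c : (Fin m → Fin n) → ℝ) (x : Rn n) :
    |form c x| ≤ (∑ s, |c s|) * ‖x‖ ^ m := by
  unfold form
  refine (Finset.abs_sum_le_sum_abs _ _).trans ?_
  rw [Finset.sum_mul]
  refine Finset.sum_le_sum fun s _ => ?_
  rw [abs_mul, Finset.abs_prod]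
  gcongr
  refine (Finset.prod_le_prod (fun _ _ => abs_nonneg _)
    (fun l _ => PiLp.norm_apply_le x (s l))).trans ?_
  simp

theorem hasFDerivAt_form {m : ℕ} (c : (Fin m → Fin n) → ℝ) (x : Rn n) :
    HasFDerivAt (form c) (∑ s, c s • ∑ l, (∏ j ∈ Finset.univ.erase l, x (s j)) •
      (EuclideanSpace.proj (s l) : Rn n →L[ℝ] ℝ)) x := by
  unfold form
  refine HasFDerivAt.fun_sum fun s _ => HasFDerivAt.const_mul ?_ (c s)
  exact HasFDerivAt.finsetProd fun l _ =>
    (EuclideanSpace.proj (s l) : Rn n →L[ℝ] ℝ).hasFDerivAt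

/-- Ensures that the nonlinear part of the field only affects degrees higher than that of the form.
-/
theorem abs_fderiv_form_le {m : ℕ} (c : (Fin (m + 1) → Fin n) → ℝ) (x v : Rn n) :
    |fderiv ℝ (form c) x v| ≤ ((∑ s, |c s|) * (m + 1)) * ‖x‖ ^ m * ‖v‖ := by
  rw [(hasFDerivAt_form c x).fderiv]
  simp only [sum_apply, smul_apply, smul_eq_mul]
  refine (Finset.abs_sum_le_sum_abs _ _).trans ?_
  rw [Finset.sum_mul, Finset.sum_mul, Finset.sum_mul]
  refine Finset.sum_le_sum fun s _ => ?_
  rw [abs_mul, mul_assoc, mul_assoc]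
  refine mul_le_mul_of_nonneg_left ?_ (abs_nonneg _)
  refine (Finset.abs_sum_le_sum_abs _ _).trans ?_
  refine (Finset.sum_le_card_nsmul _ _ (‖x‖ ^ m * ‖v‖) fun l _ => ?_).trans (by simp)
  rw [abs_mul, Finset.abs_prod]
  have h1 : |(EuclideanSpace.proj (s l) : Rn n →L[ℝ] ℝ) v| ≤ ‖v‖ := PiLp.norm_apply_le v (s l)
  refine mul_le_mul ?_ h1 (abs_nonneg _) (by positivity)
  refine (Finset.prod_le_prod (fun _ _ => abs_nonneg _)
    (fun j _ => PiLp.norm_apply_le x (s j))).trans ?_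
  simp

/-- Every monomial is an eigenfunction of the derivation along `standardForm`, with the sum of the
eigenvalues attached to its letters. Indexing by words makes this diagonal without symmetrizing the
coefficients. -/
theorem fderiv_form_standardForm {m : ℕ} (c : (Fin m → Fin n) → ℝ) (lam : Fin n → ℝ) (x : Rn n) :
    fderiv ℝ (form c) x (standardForm lam x) =
      form (fun s => (∑ l, lam (s l)) * c s) x := by
  rw [(hasFDerivAt_form c x).fderiv]
  simp only [sum_apply, smul_apply, smul_eq_mul, form]
  refine Finset.sum_congr rfl fun s _ => ?_
  rw [Finset.sum_mul, Finset.sum_mul, Finset.mul_sum]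
  refine Finset.sum_congr rfl fun l _ => ?_
  rw [← Finset.prod_erase_mul _ _ (Finset.mem_univ l)]
  simp only [standardForm, EuclideanSpace.proj, PiLp.proj_apply]
  ring

theorem multilinear_diag_eq_form {m : ℕ} (T : ContinuousMultilinearMap ℝ (fun _ : Fin m => Rn n) ℝ)
    (x : Rn n) :
    T (fun _ => x) = form (fun s => T fun l => EuclideanSpace.single (s l) 1) x := by
  have hx : x = ∑ i, x i • EuclideanSpace.single i (1 : ℝ) := by
    ext j
    simp [Finset.sum_apply, Pi.single_apply]
  conv_lhs => rw [hx]
  rw [ContinuousMultilinearMap.map_sum]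
  refine Finset.sum_congr rfl fun s _ => ?_
  rw [ContinuousMultilinearMap.map_smul_univ, smul_eq_mul, mul_comm]

/-- The form is the degree `m` Taylor term; all the lower ones vanish. -/
theorem exists_form_isBigO {R : Rn n → ℝ} (hR : ContDiff ℝ ∞ R) {m : ℕ}
    (h : R =O[𝓝 0] fun x => ‖x‖ ^ m) :
    ∃ c : (Fin m → Fin n) → ℝ, (fun x => R x - form c x) =O[𝓝 0] fun x => ‖x‖ ^ (m + 1) := by
  refine ⟨fun s => ((m.factorial : ℝ)⁻¹ • iteratedFDeriv ℝ m R 0) fun l =>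
    EuclideanSpace.single (s l) 1, (isBigO_sub_taylor hR m).congr_left fun x => ?_⟩
  rw [← multilinear_diag_eq_form, Finset.sum_range_succ, Finset.sum_eq_zero (fun i hi => by
    rw [iteratedFDeriv_apply_eq_zero_of_isBigO hR h (Finset.mem_range.1 hi), mul_zero])]
  simp

end Forms

/-! ### Borel's lemma. -/

section Borel

open Asymptotics

variable {n : ℕ}

/-- **Borel's lemma**: a formal sum of homogeneous smooth functions of increasing degrees is the
asymptotic expansion of a smooth function. -/
theorem exists_contDiff_isBigO_sub_sum (P : ℕ → Rn n → ℝ) (hP : ∀ j, ContDiff ℝ ∞ (P j))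
    (hhom : ∀ j (t : ℝ) x, P j (t • x) = t ^ (j + 1) * P j x)
    (M : ℕ → ℝ) (hM : ∀ j x, |P j x| ≤ M j * ‖x‖ ^ (j + 1)) :
    ∃ H : Rn n → ℝ, ContDiff ℝ ∞ H ∧
      ∀ N : ℕ, (fun x => H x - ∑ j ∈ Finset.range N, P j x) =O[𝓝 0] fun x => ‖x‖ ^ N := by
  let χ : ContDiffBump (0 : Rn n) := ⟨1, 2, one_pos, one_lt_two⟩
  have hχ1 : ∀ x : Rn n, ‖x‖ ≤ 1 → χ x = 1 := fun x hx =>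
    χ.one_of_mem_closedBall (by simpa using hx)
  have hχ0 : ∀ x : Rn n, 2 ≤ ‖x‖ → χ x = 0 := fun x hx =>
    χ.zero_of_le_dist (by simpa using hx)
  let f : ℕ → Rn n → ℝ := fun j x => χ x * P j x
  have hf : ∀ j, ContDiff ℝ ∞ (f j) := fun j => χ.contDiff.mul (hP j)
  have hB : ∀ j k : ℕ, ∃ B, ∀ x, ‖iteratedFDeriv ℝ k (f j) x‖ ≤ B := fun j k =>
    ((χ.hasCompactSupport.mul_right (f' := P j)).iteratedFDeriv k).exists_bound_of_continuous
      ((hf j).continuous_iteratedFDeriv (WithTop.coe_le_coe.2 le_top))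
  choose B hB using hB
  have hB0 : ∀ j k, 0 ≤ B j k := fun j k => (norm_nonneg _).trans (hB j k 0)
  -- Dilation factors of the cutoffs. The middle term makes the derivatives of `g j` of order below
  -- `j` at most `2⁻ʲ`, hence summable. The last one gives `|M j| * ‖x‖ ≤ 2⁻ʲ` wherever the cutoff
  -- can be nonzero, which controls the tail of the expansion.
  let s : ℕ → ℝ := fun j => 1 + 2 ^ j * (∑ k ∈ Finset.range j, B j k) + 2 ^ (j + 1) * |M j|
  have hs1 : ∀ j, 1 ≤ s j := fun j => by
    have := Finset.sum_nonneg fun k (_ : k ∈ Finset.range j) => hB0 j k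
    simp only [s]; nlinarith [mul_nonneg (pow_nonneg zero_le_two j) this,
      mul_nonneg (pow_nonneg (zero_le_two (α := ℝ)) (j + 1)) (abs_nonneg (M j))]
  have hs0 : ∀ j, 0 < s j := fun j => one_pos.trans_le (hs1 j)
  have hsB : ∀ j, ∀ k < j, 2 ^ j * B j k ≤ s j := fun j k hk => by
    have := Finset.single_le_sum (fun k (_ : k ∈ Finset.range j) => hB0 j k) (Finset.mem_range.2 hk)
    have h2 : (0 : ℝ) < 2 ^ j := by positivity
    have h3 : 0 ≤ 2 ^ (j + 1) * |M j| := by positivity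
    simp only [s]; nlinarith
  have hsM : ∀ j, 2 ^ (j + 1) * |M j| ≤ s j := fun j => by
    have := Finset.sum_nonneg fun k (_ : k ∈ Finset.range j) => hB0 j k
    have h2 : 0 ≤ 2 ^ j * ∑ k ∈ Finset.range j, B j k := by positivity
    simp only [s]; linarith
  let g : ℕ → Rn n → ℝ := fun j x => (s j)⁻¹ ^ (j + 1) * f j (s j • x)
  have hgP : ∀ j x, g j x = χ (s j • x) * P j x := fun j x => by
    simp only [g, f, hhom, inv_pow]
    have := (pow_pos (hs0 j) (j + 1)).ne'
    field_simp
  have hg : ∀ j, ContDiff ℝ ∞ (g j) := fun j =>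
    contDiff_const.mul ((hf j).comp (contDiff_id.const_smul (s j)))
  have hgd : ∀ j, ∀ k < j, ∀ x, ‖iteratedFDeriv ℝ k (g j) x‖ ≤ (1 / 2) ^ j := fun j k hk x => by
    have hk' : ContDiff ℝ k (f j) := (hf j).of_le (WithTop.coe_le_coe.2 le_top)
    have e1 : g j = (s j)⁻¹ ^ (j + 1) • fun y => f j (s j • y) := rfl
    have e2 : ContDiff ℝ k fun y => f j (s j • y) := hk'.comp (contDiff_id.const_smul (s j))
    rw [e1, iteratedFDeriv_const_smul_apply e2.contDiffAt,
      iteratedFDeriv_comp_const_smul _ hk', norm_smul]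
    simp only [norm_smul, norm_pow, norm_inv, Real.norm_of_nonneg (hs0 j).le]
    have h1 := hB j k (s j • x)
    have h2 : (s j)⁻¹ ^ (j + 1) * s j ^ k ≤ (s j)⁻¹ := by
      have h3 : (s j)⁻¹ ^ (j + 1) * s j ^ (j + 1) = 1 := by
        rw [← mul_pow, inv_mul_cancel₀ (hs0 j).ne', one_pow]
      have h4 : s j ^ k * s j ≤ s j ^ (j + 1) := by
        rw [← pow_succ]; exact pow_le_pow_right₀ (hs1 j) (by omega)
      rw [le_inv_comm₀ (by have := hs0 j; positivity) (hs0 j)]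
      have h5 : 0 < (s j)⁻¹ ^ (j + 1) := by have := hs0 j; positivity
      rw [le_inv_comm₀ (hs0 j) (by have := hs0 j; positivity), ← one_div, le_div_iff₀ (hs0 j)]
      calc _ = (s j)⁻¹ ^ (j + 1) * (s j ^ k * s j) := by ring
        _ ≤ 1 := by rw [← h3]; gcongr
    calc (s j)⁻¹ ^ (j + 1) * (s j ^ k * ‖iteratedFDeriv ℝ k (f j) (s j • x)‖)
        = ((s j)⁻¹ ^ (j + 1) * s j ^ k) * ‖iteratedFDeriv ℝ k (f j) (s j • x)‖ := by ring
      _ ≤ (s j)⁻¹ * B j k := by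
        have := hs0 j
        gcongr
      _ ≤ (1 / 2) ^ j := by
        rw [inv_mul_le_iff₀ (hs0 j), one_div, inv_pow, ← div_eq_mul_inv,
          le_div_iff₀ (by positivity), mul_comm]
        exact hsB j k hk
  refine ⟨fun x => ∑' j, g j x, ?_, fun N => ?_⟩
  · refine contDiff_tsum_of_eventually (v := fun _ j => (1 / 2 : ℝ) ^ j) hg
      (fun _ _ => summable_geometric_two) fun k _ => ?_
    rw [Nat.cofinite_eq_atTop]
    filter_upwards [eventually_gt_atTop k] with j hj
    exact hgd j k hj
  have hgle : ∀ j, N ≤ j → ∀ x, ‖x‖ ≤ 1 → ‖g j x‖ ≤ (1 / 2) ^ j * ‖x‖ ^ N := fun j hj x hx => by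
    rw [hgP]
    rcases le_or_gt 2 ‖s j • x‖ with h | h
    · rw [hχ0 _ h, zero_mul, norm_zero]; positivity
    rw [norm_smul, Real.norm_of_nonneg (hs0 j).le] at h
    rw [norm_mul, Real.norm_of_nonneg χ.nonneg]
    have hx' : ‖x‖ ^ (j + 1) ≤ ‖x‖ ^ N * ‖x‖ := by
      rw [← pow_succ]; exact pow_le_pow_of_le_one (norm_nonneg _) hx (by omega)
    calc χ (s j • x) * ‖P j x‖ ≤ 1 * (|M j| * (‖x‖ ^ N * ‖x‖)) := by
          refine mul_le_mul χ.le_one ((hM j x).trans ?_) (norm_nonneg _) zero_le_one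
          exact mul_le_mul (le_abs_self _) hx' (by positivity) (abs_nonneg _)
      _ = (|M j| * ‖x‖) * ‖x‖ ^ N := by ring
      _ ≤ _ := by
          refine mul_le_mul_of_nonneg_right ?_ (by positivity)
          rw [one_div, inv_pow, ← one_div, le_div_iff₀ (by positivity)]
          have h1 := hsM j
          rw [pow_succ] at h1
          have h2 := mul_le_mul_of_nonneg_right h1 (norm_nonneg x)
          nlinarith
  have hsum0 : ∀ x : Rn n, ‖x‖ ≤ 1 → Summable fun j => g (j + N) x := fun x hx => by
    refine Summable.of_norm_bounded (g := fun j => (1 / 2 : ℝ) ^ (j + N) * ‖x‖ ^ N) ?_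
      fun j => hgle (j + N) (Nat.le_add_left _ _) x hx
    exact ((summable_nat_add_iff N).2 summable_geometric_two).mul_right _
  -- On the ball of radius `(1 + S)⁻¹` the first `N` cutoffs are all equal to 1.
  let S := ∑ j ∈ Finset.range N, s j
  have hS0 : 0 ≤ S := Finset.sum_nonneg fun j _ => (hs0 j).le
  refine isBigO_norm_pow_of_bound (C := 2) (r := (1 + S)⁻¹) (by positivity) fun x hx => ?_
  have hx1 : ‖x‖ ≤ 1 := hx.le.trans (inv_le_one_of_one_le₀ (by linarith))
  have hgeq : ∀ j ∈ Finset.range N, g j x = P j x := fun j hj => by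
    rw [hgP, hχ1, one_mul]
    have : s j ≤ S := Finset.single_le_sum (fun j _ => (hs0 j).le) hj
    rw [norm_smul, Real.norm_of_nonneg (hs0 j).le]
    calc s j * ‖x‖ ≤ (1 + S) * (1 + S)⁻¹ := by gcongr; linarith
      _ = 1 := mul_inv_cancel₀ (by positivity)
  have hsum : Summable fun j => g j x := (summable_nat_add_iff N).1 (hsum0 x hx1)
  beta_reduce
  rw [← hsum.sum_add_tsum_nat_add N, Finset.sum_congr rfl hgeq, add_sub_cancel_left]
  refine tsum_of_norm_bounded (g := fun j => (1 / 2 : ℝ) ^ j * ‖x‖ ^ N)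
    (hasSum_geometric_two.mul_right _) fun j => ?_
  refine (hgle (j + N) (Nat.le_add_left _ _) x hx1).trans ?_
  gcongr ?_ * _
  exact pow_le_pow_of_le_one (by norm_num) (by norm_num) (Nat.le_add_right _ _)

end Borel

/-! ### Formal linearization without resonances. -/

section Linearization

open Asymptotics

variable {n : ℕ} {lam : Fin n → ℝ}

/-- Counting the occurrences of each letter turns a word into an exponent vector. -/
theorem NLinearity.sum_sub_ne_zero (hN : NLinearity lam) {m : ℕ} (hm : 2 ≤ m)
    (s : Fin m → Fin n) (i : Fin n) : (∑ l, lam (s l)) - lam i ≠ 0 := by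
  have h := hN (fun j => (Finset.univ.filter fun l => s l = j).card) i (by
    rw [← Finset.card_eq_sum_card_fiberwise (f := s) (s := Finset.univ) (t := Finset.univ)
      (fun _ _ => Finset.mem_coe.2 (Finset.mem_univ _))]
    simpa using hm)
  convert h using 2
  rw [← Finset.sum_fiberwise_of_maps_to (s := Finset.univ) (t := Finset.univ) (g := s)
    (fun _ _ => Finset.mem_univ _)]
  refine Finset.sum_congr rfl fun j _ => ?_
  rw [Finset.sum_congr rfl (fun l hl => by rw [(Finset.mem_filter.1 hl).2]), Finset.sum_const,
    nsmul_eq_mul]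

/-- The homological equation: the leading form `c` of the error is cancelled by a form `d` with
`dd(V₀) - λᵢ d = -c`. The remaining contribution of `V - V₀` to the derivative of `d` is of higher
order. -/
theorem exists_form_improving (hN : NLinearity lam) {V : Rn n → Rn n} (hV : ContDiff ℝ ∞ V)
    (hV2 : (fun x => V x - standardForm lam x) =O[𝓝 0] fun x => ‖x‖ ^ 2) (i : Fin n) {m : ℕ}
    {S : Rn n → ℝ} (hS : ContDiff ℝ ∞ S)
    (hR : (fun x => fderiv ℝ S x (V x) - lam i * S x) =O[𝓝 0] fun x => ‖x‖ ^ (m + 2)) :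
    ∃ d : (Fin (m + 2) → Fin n) → ℝ,
      (fun x => fderiv ℝ (fun y => S y + form d y) x (V x) - lam i * (S x + form d x))
        =O[𝓝 0] fun x => ‖x‖ ^ (m + 3) := by
  have hRs : ContDiff ℝ ∞ fun x => fderiv ℝ S x (V x) - lam i * S x :=
    ((hS.fderiv_right (m := ∞) (by simp)).clm_apply hV).sub (contDiff_const.mul hS)
  obtain ⟨c, hc⟩ := exists_form_isBigO hRs hR
  let d : (Fin (m + 2) → Fin n) → ℝ := fun s => -c s / ((∑ l, lam (s l)) - lam i)
  have hd : ∀ x, fderiv ℝ (form d) x (standardForm lam x) - lam i * form d x = - form c x := by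
    intro x
    rw [fderiv_form_standardForm]
    simp only [form, Finset.mul_sum, ← Finset.sum_sub_distrib, ← Finset.sum_neg_distrib]
    refine Finset.sum_congr rfl fun s _ => ?_
    have := hN.sum_sub_ne_zero (Nat.le_add_left 2 m) s i
    have e : ((∑ l, lam (s l)) - lam i) * d s = - c s := by
      simp only [d]; field_simp
    rw [← mul_assoc, ← sub_mul, ← sub_mul, e, neg_mul]
  refine ⟨d, ?_⟩
  have h2 : (fun x => fderiv ℝ (form d) x (V x - standardForm lam x)) =O[𝓝 0]
      fun x => ‖x‖ ^ (m + 3) := by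
    obtain ⟨C, hC0, r, hr, hC⟩ := exists_bound_of_isBigO_norm_pow hV2
    refine isBigO_norm_pow_of_bound (C := ((∑ s, |d s|) * ((m + 1 : ℕ) + 1)) * C) hr fun x hx => ?_
    refine (abs_fderiv_form_le d x _).trans ?_
    calc _ ≤ (∑ s, |d s|) * ((m + 1 : ℕ) + 1) * ‖x‖ ^ (m + 1) * (C * ‖x‖ ^ 2) := by
          gcongr; exact hC x hx
      _ = _ := by ring
  refine (hc.add h2).congr_left fun x => ?_
  have e1 : fderiv ℝ (fun y => S y + form d y) x = fderiv ℝ S x + fderiv ℝ (form d) x :=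
    fderiv_fun_add (hS.differentiable (by simp) x) ((contDiff_form d).differentiable (by simp) x)
  rw [e1, map_sub, add_apply]
  linear_combination -hd x

/-- Successive corrections of `x i` give approximate eigenfunctions to every finite order. Borel
summation provides one function agreeing with all of them, whose error is then flat. -/
theorem exists_formal_eigenfunction (hN : NLinearity lam) {V : Rn n → Rn n}
    (hV : ContDiff ℝ ∞ V)
    (hV2 : (fun x => V x - standardForm lam x) =O[𝓝 0] fun x => ‖x‖ ^ 2) (i : Fin n) :
    ∃ H : Rn n → ℝ, ContDiff ℝ ∞ H ∧ ((fun x => H x - x i) =O[𝓝 0] fun x => ‖x‖ ^ 2) ∧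
      IsFlatBigO fun x => fderiv ℝ H x (V x) - lam i * H x := by
  let Q : ℕ → (Rn n → ℝ) → Prop := fun m S => ContDiff ℝ ∞ S ∧
    (fun x => fderiv ℝ S x (V x) - lam i * S x) =O[𝓝 0] fun x => ‖x‖ ^ (m + 2)
  have step : ∀ m (S : {S // Q m S}), ∃ d : (Fin (m + 2) → Fin n) → ℝ,
      Q (m + 1) fun x => S.1 x + form d x := fun m S => by
    obtain ⟨d, hd⟩ := exists_form_improving hN hV hV2 i S.2.1 S.2.2
    exact ⟨d, S.2.1.add (contDiff_form d), hd⟩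
  choose d hd using step
  have hi : ContDiff ℝ ∞ fun x : Rn n => x i :=
    (EuclideanSpace.proj i : Rn n →L[ℝ] ℝ).contDiff
  have h0 : Q 0 fun x => x i := by
    refine ⟨hi, (((EuclideanSpace.proj i : Rn n →L[ℝ] ℝ).isBigO_comp _ _).trans hV2).congr_left
      fun x => ?_⟩
    have : fderiv ℝ (fun y : Rn n => y i) x = EuclideanSpace.proj i :=
      (EuclideanSpace.proj i : Rn n →L[ℝ] ℝ).fderiv
    rw [this, map_sub]
    rfl
  let T : ∀ m, {S // Q m S} := fun m =>
    Nat.rec ⟨_, h0⟩ (fun m S => ⟨_, hd m S⟩) m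
  -- `P j` has degree `j + 1`, as Borel's lemma requires: the correction made at stage `j` has
  -- degree `j + 2` and sits at index `j + 1`.
  let P : ℕ → Rn n → ℝ := fun j => Nat.casesOn j (fun x => x i) fun j => form (d j (T j))
  have hPT : ∀ N x, ∑ j ∈ Finset.range (N + 1), P j x = (T N).1 x := by
    intro N x
    induction N with
    | zero => simp [P, T]
    | succ N ih => rw [Finset.sum_range_succ, ih]
  obtain ⟨H, hH, hHP⟩ := exists_contDiff_isBigO_sub_sum P
    (fun j => by cases j with
      | zero => exact hi
      | succ j => exact contDiff_form _)
    (fun j t x => by cases j with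
      | zero => simp [P]
      | succ j => exact form_smul _ _ _)
    (fun j => Nat.casesOn j 1 fun j => ∑ s, |d j (T j) s|)
    (fun j x => by cases j with
      | zero => simpa [P] using PiLp.norm_apply_le x i
      | succ j => exact abs_form_le _ _)
  refine ⟨H, hH, ?_, fun M => ?_⟩
  · have h1 := hHP 2
    have h2 : P 1 =O[𝓝 0] fun x => ‖x‖ ^ 2 :=
      isBigO_norm_pow_of_bound one_pos fun x _ => abs_form_le _ x
    refine (h1.add h2).congr_left fun x => ?_
    have hP0 : P 0 x = x i := rfl
    rw [Finset.sum_range_succ, Finset.sum_range_one, hP0]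
    ring
  · have h1 := hHP (2 * (M + 1))
    -- Differentiating the remainder halves its order, so order `2 * (M + 1)` is needed to keep `M +
    -- 1`.
    set N := 2 * M + 1 with hNdef
    have hN1 : 2 * (M + 1) = N + 1 := by omega
    rw [hN1] at h1
    simp only [hPT] at h1
    have hD : ContDiff ℝ ∞ fun x => H x - (T N).1 x := hH.sub (T N).2.1
    have h2 := isBigO_fderiv_norm_pow (N := M)
      (hD.contDiffAt.of_le (WithTop.coe_le_coe.2 le_top)) (by rw [hN1]; exact h1)
    have h3 : (fun x => fderiv ℝ (fun x => H x - (T N).1 x) x (V x)) =O[𝓝 0]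
        fun x => ‖x‖ ^ (M + 1) := by
      have hVb : V =O[𝓝 0] fun _ => (1 : ℝ) := hV.continuous.continuousAt.isBigO_one ℝ
      refine (IsBigO.of_bound' (Eventually.of_forall fun x => ?_)).trans
        ((h2.norm_left.mul hVb.norm_left).congr_right fun x => mul_one _)
      rw [Real.norm_of_nonneg (r := _ * _) (by positivity)]
      exact ContinuousLinearMap.le_opNorm _ _
    have h4 := ((T N).2.2.trans (isBigO_norm_pow_of_le (E := Rn n) (show M ≤ N + 2 by omega))).add
      (h3.trans (isBigO_norm_pow_of_le (E := Rn n) (Nat.le_succ M)))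
    refine (h4.sub ((h1.trans (isBigO_norm_pow_of_le (E := Rn n)
      (show M ≤ N + 1 by omega))).const_mul_left (lam i))).congr_left fun x => ?_
    have e1 : fderiv ℝ (fun x => H x - (T N).1 x) x = fderiv ℝ H x - fderiv ℝ (T N).1 x :=
      fderiv_fun_sub (hH.differentiable (by simp) x) ((T N).2.1.differentiable (by simp) x)
    rw [e1, sub_apply]
    ring

theorem isBigO_euclidean {α : Type*} {l : Filter α} {G : α → Rn n} {g : α → ℝ}
    (h : ∀ i, (fun x => G x i) =O[l] g) : G =O[l] g :=
  ((EuclideanSpace.equiv (Fin n) ℝ).isBigO_comp_rev G l).trans (isBigO_pi.2 h)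

/-- Formal linearization of a vector field: there is a smooth map, tangent to the identity at the
origin, which conjugates `V` to its linear part up to a flat error. -/
theorem exists_formal_linearization (hN : NLinearity lam) {V : Rn n → Rn n}
    (hV : ContDiff ℝ ∞ V)
    (hV2 : (fun x => V x - standardForm lam x) =O[𝓝 0] fun x => ‖x‖ ^ 2) :
    ∃ h : Rn n → Rn n, ContDiff ℝ ∞ h ∧ h 0 = 0 ∧ HasFDerivAt h (ContinuousLinearMap.id ℝ _) 0 ∧
      IsFlatBigO fun x => fderiv ℝ h x (V x) - standardForm lam (h x) := by
  choose H hH hH2 hflat using exists_formal_eigenfunction hN hV hV2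
  let h : Rn n → Rn n := fun x => WithLp.toLp 2 fun i => H i x
  have hh : ContDiff ℝ ∞ h := contDiff_euclidean.2 hH
  have h2 : (fun x => h x - x) =O[𝓝 0] fun x => ‖x‖ ^ 2 := isBigO_euclidean hH2
  have hd : HasFDerivAt (fun x => h x - x) (0 : Rn n →L[ℝ] Rn n) 0 :=
    IsBigO.hasFDerivAt (n := 2) (by simpa using h2) (by norm_num)
  have hd' : HasFDerivAt h (ContinuousLinearMap.id ℝ (Rn n)) 0 := by
    simpa using hd.fun_add (hasFDerivAt_id (0 : Rn n))
  refine ⟨h, hh, ?_, hd', fun N => isBigO_euclidean fun i => (hflat i N).congr_left fun x => ?_⟩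
  · obtain ⟨C, -, r, hr, hC⟩ := exists_bound_of_isBigO_norm_pow h2
    simpa using hC 0 (by simpa using hr)
  · have e : HasFDerivAt (H i) ((EuclideanSpace.proj i : Rn n →L[ℝ] ℝ).comp (fderiv ℝ h x)) x :=
      (EuclideanSpace.proj i : Rn n →L[ℝ] ℝ).hasFDerivAt.comp x
        (hh.differentiable (by simp) x).hasFDerivAt
    rw [e.fderiv]
    rfl

end Linearization

/-! ### Smooth inverse function theorem. -/

section LocalDiffeo

/-- The inverse function theorem, with smoothness on whole neighbourhoods. -/
theorem exists_smooth_local_inverse {E F : Type*} [NormedAddCommGroup E] [NormedSpace ℝ E]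
    [CompleteSpace E] [NormedAddCommGroup F] [NormedSpace ℝ F] {f : E → F} {U : Set E}
    (hU : IsOpen U) {a : E} (ha : a ∈ U) (hf : ContDiffOn ℝ ∞ f U) (f' : E ≃L[ℝ] F)
    (hf' : HasFDerivAt f (f' : E →L[ℝ] F) a) :
    ∃ e : OpenPartialHomeomorph E F, a ∈ e.source ∧ e.source ⊆ U ∧ (∀ x, e x = f x) ∧
      ContDiffOn ℝ ∞ e e.source ∧ ContDiffOn ℝ ∞ e.symm e.target := by
  have hat : ∀ x ∈ U, ContDiffAt ℝ ∞ f x := fun x hx => hf.contDiffAt (hU.mem_nhds hx)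
  have hdf : ContinuousOn (fderiv ℝ f) U :=
    hf.continuousOn_fderiv_of_isOpen hU (by simp)
  -- Invertibility of the derivative is an open condition; restricting to `W` makes the inverse
  -- smooth on the whole target.
  set W := U ∩ fderiv ℝ f ⁻¹' range ((↑) : (E ≃L[ℝ] F) → E →L[ℝ] F) with hW
  have hWo : IsOpen W := hdf.isOpen_inter_preimage hU ContinuousLinearEquiv.isOpen
  set e₀ := (hat a ha).toOpenPartialHomeomorph f hf' (by simp)
  have he₀ : ∀ x, e₀ x = f x := fun x => rfl
  refine ⟨e₀.restrOpen W hWo, ⟨(hat a ha).mem_toOpenPartialHomeomorph_source hf' (by simp), ha,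
    ⟨f', hf'.fderiv.symm⟩⟩, fun x hx => hx.2.1, fun x => rfl,
    fun x hx => (hat x hx.2.1).contDiffWithinAt, fun y hy => ?_⟩
  have hx := (e₀.restrOpen W hWo).map_target hy
  obtain ⟨f'', hf''⟩ := hx.2.2
  refine ((e₀.restrOpen W hWo).contDiffAt_symm hy (f₀' := f'') ?_ ?_).contDiffWithinAt
  · rw [hf'']
    exact ((hat _ hx.2.1).differentiableAt (by simp)).hasFDerivAt
  · exact hat _ hx.2.1

end LocalDiffeo

set_option linter.unusedSectionVars false

/-! ### Smoothness of superposition operators on bounded continuous functions. -/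

section Nemytskii

open BoundedContinuousFunction

variable {T : Type} [TopologicalSpace T] {E F : Type} [NormedAddCommGroup E] [NormedSpace ℝ E]
  [NormedAddCommGroup F] [NormedSpace ℝ F]

/-- The superposition operator `x ↦ g ∘ x`. -/
noncomputable def superposition (T : Type) [TopologicalSpace T] (g : E →ᵇ F) (x : T →ᵇ E) : T →ᵇ F :=
  g.compContinuous x.toContinuousMap

@[simp] theorem superposition_apply (g : E →ᵇ F) (x : T →ᵇ E) (t : T) :
    superposition T g x t = g (x t) := rfl

set_option synthInstance.maxHeartbeats 200000 in
theorem norm_clm_apply_apply_le (A : T →ᵇ (E →L[ℝ] F)) (h : T →ᵇ E) (t : T) :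
    ‖A t (h t)‖ ≤ ‖A‖ * ‖h‖ :=
  calc ‖A t (h t)‖ ≤ ‖A t‖ * ‖h t‖ := (A t).le_opNorm _
    _ ≤ ‖A‖ * ‖h‖ := by
      gcongr
      · exact A.norm_coe_le_norm t
      · exact h.norm_coe_le_norm t

set_option synthInstance.maxHeartbeats 200000 in
/-- Pointwise evaluation of operator-valued functions on vector-valued functions. -/
noncomputable def pointwiseApply (T E F : Type) [TopologicalSpace T] [NormedAddCommGroup E]
    [NormedSpace ℝ E] [NormedAddCommGroup F] [NormedSpace ℝ F] :
    (T →ᵇ (E →L[ℝ] F)) →L[ℝ] (T →ᵇ E) →L[ℝ] (T →ᵇ F) :=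
  LinearMap.mkContinuous₂
    (LinearMap.mk₂ ℝ
      (fun (A : T →ᵇ (E →L[ℝ] F)) (h : T →ᵇ E) => (ofNormedAddCommGroup (fun t => A t (h t))
        (A.continuous.clm_apply h.continuous) (‖A‖ * ‖h‖) (norm_clm_apply_apply_le A h) : T →ᵇ F))
      (fun _ _ _ => by ext; simp) (fun _ _ _ => by ext; simp)
      (fun _ _ _ => by ext; simp) (fun _ _ _ => by ext; simp))
    1 (fun A h => by
      rw [one_mul]
      exact (norm_le (by positivity)).2 (norm_clm_apply_apply_le A h))

set_option synthInstance.maxHeartbeats 200000 in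
@[simp] theorem pointwiseApply_apply (A : T →ᵇ (E →L[ℝ] F)) (h : T →ᵇ E) (t : T) :
    pointwiseApply T E F A h t = A t (h t) := rfl

theorem exists_boundedContinuous_of_compactSupport {g : E → F} (hg : Continuous g)
    (hs : HasCompactSupport g) : ∃ G : E →ᵇ F, ⇑G = g := by
  obtain ⟨C, hC⟩ := hs.exists_bound_of_continuous hg
  exact ⟨ofNormedAddCommGroup g hg C hC, rfl⟩

-- The first-order error at each `t` is bounded by the oscillation of `DG` near `x t`; uniform
-- continuity makes this bound independent of `t`, as the sup norm demands.
set_option synthInstance.maxHeartbeats 200000 in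
theorem hasFDerivAt_superposition {G : E →ᵇ F} {DG : E →ᵇ (E →L[ℝ] F)}
    (hd : ∀ x, HasFDerivAt G (DG x) x) (hu : UniformContinuous DG) (x : T →ᵇ E) :
    HasFDerivAt (superposition T G) (pointwiseApply T E F (superposition T DG x)) x := by
  rw [hasFDerivAt_iff_isLittleO_nhds_zero, Asymptotics.isLittleO_iff]
  intro c hc
  obtain ⟨δ, hδ, hu⟩ := Metric.uniformContinuous_iff.1 hu c hc
  filter_upwards [Metric.ball_mem_nhds (0 : T →ᵇ E) hδ] with h hh
  rw [mem_ball_zero_iff] at hh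
  refine (norm_le (by positivity)).2 fun t => ?_
  have hht : ‖h t‖ < δ := (h.norm_coe_le_norm t).trans_lt hh
  have key := (convex_ball (x t) δ).norm_image_sub_le_of_norm_hasFDerivWithin_le' (f := G)
    (f' := DG) (φ := DG (x t)) (C := c) (fun y _ => (hd y).hasFDerivWithinAt)
    (fun y hy => by
      rw [← dist_eq_norm]
      exact (hu hy).le)
    (x := x t) (y := x t + h t) (by simpa using hδ) (by simpa using hht)
  rw [add_sub_cancel_left] at key
  exact key.trans (mul_le_mul_of_nonneg_left (h.norm_coe_le_norm t) hc.le)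

-- The derivative is again a superposition operator, that of `fderiv ℝ G`, followed by the bounded
-- linear map `pointwiseApply`; hence the induction, with varying codomain. Compact support supplies
-- uniform continuity at each stage.
set_option synthInstance.maxHeartbeats 200000 in
theorem contDiff_superposition_nat (m : ℕ) : ∀ {F : Type} [NormedAddCommGroup F]
    [NormedSpace ℝ F] {G : E →ᵇ F}, ContDiff ℝ ∞ G → HasCompactSupport G →
    ContDiff ℝ m (superposition T G) := by
  induction m with
  | zero =>
    intro F _ _ G hG hs
    rw [Nat.cast_zero, contDiff_zero]
    have hu := hs.uniformContinuous_of_continuous hG.continuous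
    rw [Metric.continuous_iff]
    intro x ε hε
    obtain ⟨δ, hδ, hu⟩ := Metric.uniformContinuous_iff.1 hu (ε / 2) (half_pos hε)
    refine ⟨δ, hδ, fun y hy => lt_of_le_of_lt ?_ (half_lt_self hε)⟩
    exact (dist_le (half_pos hε).le).2 fun t => (hu ((dist_coe_le_dist t).trans_lt hy)).le
  | succ m ih =>
    intro F _ _ G hG hs
    have hDc : ContDiff ℝ ∞ (fderiv ℝ G) := hG.fderiv_right (m := ∞) (by simp)
    have hDs : HasCompactSupport (fderiv ℝ G) := hs.fderiv ℝ
    obtain ⟨DG, hDG⟩ := exists_boundedContinuous_of_compactSupport hDc.continuous hDs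
    rw [Nat.cast_succ, contDiff_succ_iff_hasFDerivAt]
    refine ⟨fun x => pointwiseApply T E F (superposition T DG x),
      (ih (G := DG) (by rwa [hDG]) (by rwa [hDG])).continuousLinearMap_comp
        (pointwiseApply T E F),
      fun x => hasFDerivAt_superposition (fun y => ?_) ?_ x⟩
    · rw [hDG]; exact (hG.differentiable (by simp) y).hasFDerivAt
    · rw [hDG]; exact hDs.uniformContinuous_of_continuous hDc.continuous

theorem contDiff_superposition {G : E →ᵇ F} (hG : ContDiff ℝ ∞ G) (hs : HasCompactSupport G) :
    ContDiff ℝ ∞ (superposition T G) :=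
  contDiff_infty.2 fun m => contDiff_superposition_nat m hG hs

end Nemytskii

/-! ### Bounded solutions of scalar linear equations on the half-line. -/

section ScalarODE

open BoundedContinuousFunction MeasureTheory
open scoped NNReal

/-- `exp (-a t)` for `a > 0`, and `0` otherwise: the bounded solutions of `x' = -a x`. -/
noncomputable def expDecay (a : ℝ) : ℝ≥0 →ᵇ ℝ :=
  ofNormedAddCommGroup (fun t : ℝ≥0 => if 0 < a then Real.exp (-a * t) else 0)
    (by split_ifs <;> fun_prop) 1 fun t => by
      split_ifs with h
      · rw [Real.norm_of_nonneg (Real.exp_nonneg _), Real.exp_le_one_iff]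
        have := t.2
        simpa using mul_nonneg h.le this
      · simp

/-- The extension to `ℝ` of a function on `[0, ∞)`, constant on the negative numbers. -/
noncomputable def extendHalf {F : Type*} (y : ℝ≥0 → F) (t : ℝ) : F := y t.toNNReal

theorem continuous_extendHalf (y : ℝ≥0 →ᵇ ℝ) : Continuous (extendHalf y) :=
  y.continuous.comp continuous_real_toNNReal

theorem continuous_exp_mul_extendHalf (a : ℝ) (y : ℝ≥0 →ᵇ ℝ) :
    Continuous fun s => Real.exp (a * s) * extendHalf y s :=
  (by fun_prop : Continuous fun s : ℝ => Real.exp (a * s)).mul (continuous_extendHalf y)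

theorem norm_exp_mul_extendHalf_le (a : ℝ) (y : ℝ≥0 →ᵇ ℝ) (s : ℝ) :
    ‖Real.exp (a * s) * extendHalf y s‖ ≤ ‖y‖ * Real.exp (a * s) := by
  rw [norm_mul, Real.norm_of_nonneg (Real.exp_nonneg _), mul_comm]
  exact mul_le_mul_of_nonneg_right (y.norm_coe_le_norm _) (Real.exp_nonneg _)

theorem integrableOn_exp_mul_extendHalf {a : ℝ} (ha : a < 0) (y : ℝ≥0 →ᵇ ℝ) (c : ℝ) :
    IntegrableOn (fun s => Real.exp (a * s) * extendHalf y s) (Ioi c) :=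
  ((integrableOn_exp_mul_Ioi ha c).const_mul ‖y‖).mono'
    (continuous_exp_mul_extendHalf a y).aestronglyMeasurable
    (Eventually.of_forall fun s => norm_exp_mul_extendHalf_le a y s)

/-- The bounded solution of `x' = -a x + y` on `[0, ∞)` (the one that vanishes at `0` if
`a > 0`), by variation of constants. -/
noncomputable def variationOfConstants (a : ℝ) (y : ℝ≥0 →ᵇ ℝ) (t : ℝ) : ℝ :=
  Real.exp (-a * t) * ((if 0 < a then 0 else - ∫ s in Ioi 0, Real.exp (a * s) * extendHalf y s) +
    ∫ s in (0 : ℝ)..t, Real.exp (a * s) * extendHalf y s)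

theorem hasDerivAt_variationOfConstants (a : ℝ) (y : ℝ≥0 →ᵇ ℝ) (t : ℝ) :
    HasDerivAt (variationOfConstants a y)
      (-a * variationOfConstants a y t + extendHalf y t) t := by
  have h1 : HasDerivAt (fun t : ℝ => Real.exp (-a * t)) (Real.exp (-a * t) * (-a)) t := by
    simpa using ((hasDerivAt_id t).const_mul (-a)).exp
  have h2 := ((continuous_exp_mul_extendHalf a y).integral_hasStrictDerivAt 0 t).hasDerivAt
  refine (h1.mul (h2.const_add (if 0 < a then 0 else
    - ∫ s in Ioi 0, Real.exp (a * s) * extendHalf y s))).congr_deriv ?_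
  have h3 : Real.exp (-a * t) * Real.exp (a * t) = 1 := by
    rw [← Real.exp_add]; simp
  rw [variationOfConstants]
  linear_combination extendHalf y t * h3

theorem abs_variationOfConstants_le {a : ℝ} (ha : a ≠ 0) (y : ℝ≥0 →ᵇ ℝ) {t : ℝ} (ht : 0 ≤ t) :
    ‖variationOfConstants a y t‖ ≤ |a|⁻¹ * ‖y‖ := by
  have h3 : Real.exp (-a * t) * Real.exp (a * t) = 1 := by
    rw [← Real.exp_add]; simp
  have h4 := Real.exp_pos (-a * t)
  rw [variationOfConstants, norm_mul, Real.norm_of_nonneg h4.le]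
  rcases lt_or_gt_of_ne ha with h | h
  -- For `a < 0` the integration constant turns the formula into minus the integral over `(t, ∞)`;
  -- this is what keeps the growing factor `exp (-a t)` under control.
  · rw [if_neg h.not_gt, ← intervalIntegral.integral_interval_add_Ioi
      (integrableOn_exp_mul_extendHalf h y 0) (integrableOn_exp_mul_extendHalf h y t),
      neg_add_rev, neg_add_cancel_right, norm_neg]
    have h5 := norm_integral_le_of_norm_le ((integrableOn_exp_mul_Ioi h t).const_mul ‖y‖)
      (Eventually.of_forall fun s => norm_exp_mul_extendHalf_le a y s)
    rw [integral_const_mul, integral_exp_mul_Ioi h] at h5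
    refine (mul_le_mul_of_nonneg_left h5 h4.le).trans (le_of_eq ?_)
    rw [abs_of_neg h]
    field_simp
    rw [neg_mul] at h3
    linear_combination (-‖y‖) * h3
  · rw [if_pos h, zero_add]
    have h5 := intervalIntegral.norm_integral_le_of_norm_le (μ := volume) ht
      (Eventually.of_forall fun s _ => norm_exp_mul_extendHalf_le a y s)
      (Continuous.intervalIntegrable (by fun_prop) _ _)
    have h6 : ∫ s in (0 : ℝ)..t, ‖y‖ * Real.exp (a * s) = ‖y‖ * ((Real.exp (a * t) - 1) / a) := by
      rw [intervalIntegral.integral_const_mul, intervalIntegral.integral_eq_sub_of_hasDerivAt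
        (f := fun s => Real.exp (a * s) / a)]
      · simp; ring_nf; simp
      · intro s _
        have := ((hasDerivAt_id s).const_mul a).exp.div_const a
        simpa [h.ne'] using this
      · exact Continuous.intervalIntegrable (by fun_prop) _ _
    rw [h6] at h5
    refine (mul_le_mul_of_nonneg_left h5 h4.le).trans ?_
    rw [abs_of_pos h]
    have h7 : Real.exp (-a * t) * (‖y‖ * ((Real.exp (a * t) - 1) / a)) =
        a⁻¹ * ‖y‖ * (1 - Real.exp (-a * t)) := by
      field_simp
      rw [neg_mul] at h3
      linear_combination ‖y‖ * h3
    rw [h7]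
    refine mul_le_of_le_one_right (by positivity) (by linarith)

/-- `variationOfConstants` as a bounded operator. -/
noncomputable def solutionOp (a : ℝ) (ha : a ≠ 0) : (ℝ≥0 →ᵇ ℝ) →L[ℝ] (ℝ≥0 →ᵇ ℝ) :=
  LinearMap.mkContinuous
    { toFun := fun y => ofNormedAddCommGroup (fun t : ℝ≥0 => variationOfConstants a y t)
        ((continuous_iff_continuousAt.2 fun t =>
          (hasDerivAt_variationOfConstants a y t).continuousAt).comp NNReal.continuous_coe)
        (|a|⁻¹ * ‖y‖) fun t => abs_variationOfConstants_le ha y t.2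
      map_add' := fun y z => by
        ext t
        have e : ∀ s, Real.exp (a * s) * extendHalf (y + z : ℝ≥0 →ᵇ ℝ) s =
          Real.exp (a * s) * extendHalf y s + Real.exp (a * s) * extendHalf z s := fun s => by
            simp [extendHalf, mul_add]
        change variationOfConstants a (y + z) t =
          variationOfConstants a y t + variationOfConstants a z t
        simp only [variationOfConstants, e]
        rw [intervalIntegral.integral_add
          ((continuous_exp_mul_extendHalf a y).intervalIntegrable _ _)
          ((continuous_exp_mul_extendHalf a z).intervalIntegrable _ _)]
        split_ifs with h
        · ring
        · have h' := lt_of_le_of_ne (not_lt.1 h) ha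
          rw [integral_add (integrableOn_exp_mul_extendHalf h' y 0)
            (integrableOn_exp_mul_extendHalf h' z 0)]
          ring
      map_smul' := fun c y => by
        ext t
        have e : ∀ s, Real.exp (a * s) * extendHalf (c • y : ℝ≥0 →ᵇ ℝ) s =
          c * (Real.exp (a * s) * extendHalf y s) := fun s => by
            simp [extendHalf]; ring
        change variationOfConstants a (c • y) t = c * variationOfConstants a y t
        simp only [variationOfConstants, e]
        rw [intervalIntegral.integral_const_mul, integral_const_mul]
        split_ifs <;> ring }
    |a|⁻¹ fun y => (norm_le (by positivity)).2 fun t => abs_variationOfConstants_le ha y t.2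

theorem solutionOp_apply {a : ℝ} (ha : a ≠ 0) (y : ℝ≥0 →ᵇ ℝ) (t : ℝ≥0) :
    solutionOp a ha y t = variationOfConstants a y t := rfl

theorem solutionOp_apply_zero {a : ℝ} (ha : 0 < a) (y : ℝ≥0 →ᵇ ℝ) :
    solutionOp a ha.ne' y 0 = 0 := by
  simp [solutionOp_apply, variationOfConstants, ha]

theorem expDecay_apply_zero {a : ℝ} (ha : 0 < a) : expDecay a 0 = 1 := by
  simp [expDecay, ha]

theorem expDecay_of_neg {a : ℝ} (ha : a < 0) : expDecay a = 0 := by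
  ext t; simp [expDecay, ha.not_gt]

/-- Bounded solutions of `x' = -a x + y` on `[0, ∞)`. -/
theorem eq_expDecay_add_solutionOp_iff {a : ℝ} (ha : a ≠ 0) (x y : ℝ≥0 →ᵇ ℝ) :
    x = x 0 • expDecay a + solutionOp a ha y ↔
      ∀ t : ℝ, 0 ≤ t → HasDerivWithinAt (extendHalf x)
        (-a * extendHalf x t + extendHalf y t) (Ici 0) t := by
  constructor
  · intro h t ht
    set c := x 0
    have hx : ∀ t : ℝ, 0 ≤ t → extendHalf x t =
        c * (if 0 < a then Real.exp (-a * t) else 0) + variationOfConstants a y t := fun t ht => by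
      rw [extendHalf, h]
      simp only [coe_add, coe_smul, Pi.add_apply, solutionOp_apply, Real.coe_toNNReal t ht,
        smul_eq_mul, expDecay, coe_ofNormedAddCommGroup]
    have h1 : HasDerivAt (fun t : ℝ => if 0 < a then Real.exp (-a * t) else 0)
        (-a * (if 0 < a then Real.exp (-a * t) else 0)) t := by
      split_ifs
      · have := ((hasDerivAt_id t).const_mul (-a)).exp
        simpa [mul_comm] using this
      · simpa using hasDerivAt_const t (0 : ℝ)
    refine (((h1.const_mul c).add (hasDerivAt_variationOfConstants a y t)).hasDerivWithinAt.congr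
      (fun s hs => hx s hs) (hx t ht)).congr_deriv ?_
    rw [hx t ht]
    ring
  · intro h
    set z : ℝ → ℝ := fun t => extendHalf x t - variationOfConstants a y t
    have hz : ∀ t, 0 ≤ t → HasDerivWithinAt (fun t => Real.exp (a * t) * z t) 0 (Ici 0) t := by
      intro t ht
      have h1 : HasDerivAt (fun t : ℝ => Real.exp (a * t)) (Real.exp (a * t) * a) t := by
        simpa using ((hasDerivAt_id t).const_mul a).exp
      refine (h1.hasDerivWithinAt.mul ((h t ht).sub
        (hasDerivAt_variationOfConstants a y t).hasDerivWithinAt)).congr_deriv ?_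
      have e : (extendHalf x - variationOfConstants a y) t = extendHalf x t - variationOfConstants a y t := rfl
      linear_combination (Real.exp (a * t) * a) * e
    have hconst : ∀ t, 0 ≤ t → Real.exp (a * t) * z t = z 0 := fun t ht => by
      have := constant_of_has_deriv_right_zero (a := 0) (b := t)
        (f := fun t => Real.exp (a * t) * z t)
        (fun s hs => (hz s hs.1).continuousWithinAt.mono Icc_subset_Ici_self)
        (fun s hs => (hz s hs.1).mono (Ici_subset_Ici.2 hs.1)) t (right_mem_Icc.2 ht)
      simpa using this
    have hz' : ∀ t, 0 ≤ t → z t = z 0 * Real.exp (-a * t) := fun t ht => by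
      have h3 : Real.exp (-a * t) * Real.exp (a * t) = 1 := by
        rw [← Real.exp_add]; simp
      rw [← hconst t ht]
      linear_combination (-z t) * h3
    have hz0 : z 0 * (if 0 < a then (1 : ℝ) else 0) = x 0 * (if 0 < a then (1 : ℝ) else 0) := by
      split_ifs with h'
      · simp [z, extendHalf, variationOfConstants, h']
      · simp
    have hz1 : ∀ t, 0 ≤ t → z t = x 0 * (if 0 < a then Real.exp (-a * t) else 0) := by
      intro t ht
      rcases lt_or_gt_of_ne ha with h' | h'
      · rw [if_neg h'.not_gt, mul_zero]
        -- In the unstable case a nonzero solution of the homogeneous equation grows exponentially,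
        -- whereas `z` is bounded.
        suffices z 0 = 0 by rw [hz' t ht, this, zero_mul]
        by_contra hne
        have hb : ∀ t, 0 ≤ t → |z 0| * Real.exp (-a * t) ≤ ‖x‖ + |a|⁻¹ * ‖y‖ := fun t ht => by
          have : |z t| = |z 0| * Real.exp (-a * t) := by
            rw [hz' t ht, abs_mul, abs_of_pos (Real.exp_pos _)]
          rw [← this]
          exact (norm_sub_le _ _).trans (add_le_add (x.norm_coe_le_norm _)
            (abs_variationOfConstants_le ha y ht))
        have hlim : Tendsto (fun t => |z 0| * Real.exp (-a * t)) atTop atTop :=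
          (Real.tendsto_exp_atTop.comp
            (tendsto_id.const_mul_atTop (neg_pos.2 h'))).const_mul_atTop (abs_pos.2 hne)
        obtain ⟨t, ht1, ht2⟩ := ((hlim.eventually_gt_atTop _).and (eventually_ge_atTop 0)).exists
        exact (hb t ht2).not_gt ht1
      · rw [if_pos h', hz' t ht]
        rw [if_pos h', mul_one, mul_one] at hz0
        rw [hz0]
    ext t
    have := hz1 t t.2
    simp only [z, extendHalf, Real.toNNReal_coe] at this
    simp only [coe_add, coe_smul, Pi.add_apply, solutionOp_apply, smul_eq_mul, expDecay,
      coe_ofNormedAddCommGroup]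
    linarith

end ScalarODE

/-! ### Globalizing a local field by a cutoff. -/

section Cutoff

/-- A map that is smooth near the origin agrees there with a smooth, compactly supported one. -/
theorem exists_contDiff_hasCompactSupport_eq {n : ℕ} {F : Type*} [NormedAddCommGroup F]
    [NormedSpace ℝ F] {V : Rn n → F} {T : Set (Rn n)} (hT : T ∈ 𝓝 0)
    (hV : ContDiffOn ℝ ∞ V T) :
    ∃ W : Rn n → F, ContDiff ℝ ∞ W ∧ HasCompactSupport W ∧
      ∃ r > 0, Metric.ball 0 r ⊆ T ∧ ∀ x ∈ Metric.ball 0 r, W x = V x := by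
  obtain ⟨R, hR, hRT⟩ := Metric.mem_nhds_iff.1 hT
  let χ : ContDiffBump (0 : Rn n) := ⟨R / 4, R / 2, by positivity, by linarith⟩
  have hsub : tsupport χ ⊆ Metric.ball 0 R := by
    rw [χ.tsupport_eq]
    exact Metric.closedBall_subset_ball (show R / 2 < R by linarith)
  refine ⟨fun x => χ x • V x, contDiff_iff_contDiffAt.2 fun x => ?_,
    χ.hasCompactSupport.smul_right, R / 4, by positivity,
    (Metric.ball_subset_ball (by linarith)).trans hRT, fun x hx => ?_⟩
  · by_cases hx : x ∈ Metric.ball (0 : Rn n) R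
    · exact χ.contDiff.contDiffAt.smul ((hV.mono hRT).contDiffAt (Metric.isOpen_ball.mem_nhds hx))
    · have : (fun y => χ y • V y) =ᶠ[𝓝 x] fun _ => 0 := by
        filter_upwards [(isClosed_tsupport χ).isOpen_compl.mem_nhds fun h => hx (hsub h)] with y hy
        rw [image_eq_zero_of_notMem_tsupport hy, zero_smul]
      exact contDiffAt_const.congr_of_eventuallyEq this
  · beta_reduce
    rw [χ.one_of_mem_closedBall (Metric.ball_subset_closedBall hx), one_smul]

end Cutoff

theorem hasDerivWithinAt_euclidean {n : ℕ} {f : ℝ → Rn n} {v : Rn n} {s : Set ℝ} {t : ℝ} :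
    HasDerivWithinAt f v s t ↔ ∀ i, HasDerivWithinAt (fun s => f s i) (v i) s t := by
  simp only [hasDerivWithinAt_iff_hasFDerivWithinAt, hasFDerivWithinAt_euclidean]
  refine forall_congr' fun i => ?_
  have : (PiLp.proj 2 (fun _ : Fin n => ℝ) i).comp (ContinuousLinearMap.toSpanSingleton ℝ v) =
      ContinuousLinearMap.toSpanSingleton ℝ (v i) := by
    ext; simp
  rw [← this]

/-! ### Perron's construction of the local stable manifold. -/

section StableGraph

open BoundedContinuousFunction
open scoped NNReal

variable {n : ℕ}

/-- The projection that keeps the coordinates with `lam i > 0`. -/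
noncomputable def posPart (lam : Fin n → ℝ) : Rn n →L[ℝ] Rn n :=
  LinearMap.toContinuousLinearMap
    { toFun := fun x => WithLp.toLp 2 fun i => if 0 < lam i then x i else 0
      map_add' := fun x y => by ext i; by_cases h : 0 < lam i <;> simp [h]
      map_smul' := fun c x => by ext i; by_cases h : 0 < lam i <;> simp [h] }

theorem posPart_apply (lam : Fin n → ℝ) (x : Rn n) (i : Fin n) :
    posPart lam x i = if 0 < lam i then x i else 0 := rfl

theorem posPart_posPart (lam : Fin n → ℝ) (x : Rn n) :
    posPart lam (posPart lam x) = posPart lam x := by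
  ext i; by_cases h : 0 < lam i <;> simp [posPart_apply, h]

/-- Coordinates of vector-valued functions. -/
noncomputable def coordBCF (i : Fin n) : (ℝ≥0 →ᵇ Rn n) →L[ℝ] (ℝ≥0 →ᵇ ℝ) :=
  (EuclideanSpace.proj i : Rn n →L[ℝ] ℝ).compLeftContinuousBounded ℝ≥0

/-- A vector-valued function with one nonzero coordinate. -/
noncomputable def singleBCF (i : Fin n) : (ℝ≥0 →ᵇ ℝ) →L[ℝ] (ℝ≥0 →ᵇ Rn n) :=
  (ContinuousLinearMap.toSpanSingleton ℝ
    (EuclideanSpace.single i (1 : ℝ))).compLeftContinuousBounded ℝ≥0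

theorem coordBCF_apply (i : Fin n) (x : ℝ≥0 →ᵇ Rn n) (t : ℝ≥0) : coordBCF i x t = x t i := rfl

theorem singleBCF_apply (i j : Fin n) (x : ℝ≥0 →ᵇ ℝ) (t : ℝ≥0) :
    singleBCF i x t j = if j = i then x t else 0 := by
  change (x t • EuclideanSpace.single i (1 : ℝ)) j = _
  simp

variable (lam : Fin n → ℝ) (hlam : ∀ i, lam i ≠ 0)

/-- The solution operator of `x' = -Λ x + y`, coordinate by coordinate. -/
noncomputable def diagSolutionOp : (ℝ≥0 →ᵇ Rn n) →L[ℝ] (ℝ≥0 →ᵇ Rn n) :=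
  ∑ i, (singleBCF i).comp ((solutionOp (lam i) (hlam i)).comp (coordBCF i))

/-- The bounded solution of `x' = -Λ x` with prescribed stable part of the initial value. -/
noncomputable def diagExpDecay : Rn n →L[ℝ] (ℝ≥0 →ᵇ Rn n) :=
  ∑ i, (EuclideanSpace.proj i : Rn n →L[ℝ] ℝ).smulRight (singleBCF i (expDecay (lam i)))

theorem diagSolutionOp_apply (y : ℝ≥0 →ᵇ Rn n) (t : ℝ≥0) (j : Fin n) :
    diagSolutionOp lam hlam y t j = solutionOp (lam j) (hlam j) (coordBCF j y) t := by
  simp only [diagSolutionOp, _root_.sum_apply, ContinuousLinearMap.comp_apply,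
    BoundedContinuousFunction.sum_apply, WithLp.ofLp_sum, Finset.sum_apply, singleBCF_apply]
  simp

theorem diagExpDecay_apply (v : Rn n) (t : ℝ≥0) (j : Fin n) :
    diagExpDecay lam v t j = v j * expDecay (lam j) t := by
  simp only [diagExpDecay, _root_.sum_apply, ContinuousLinearMap.smulRight_apply,
    BoundedContinuousFunction.sum_apply, WithLp.ofLp_sum, Finset.sum_apply,
    BoundedContinuousFunction.smul_apply, PiLp.smul_apply, singleBCF_apply]
  simp

variable {lam}

/-- Turns the differential equation with a boundedness condition into an equation in a Banach space.
It decouples into the scalar statement, one coordinate at a time. -/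
theorem eq_diagExpDecay_add_iff (x y : ℝ≥0 →ᵇ Rn n) :
    x = diagExpDecay lam (x 0) + diagSolutionOp lam hlam y ↔
      ∀ t : ℝ, 0 ≤ t → HasDerivWithinAt (extendHalf x)
        (-standardForm lam (extendHalf x t) + extendHalf y t) (Ici 0) t := by
  have h1 : x = diagExpDecay lam (x 0) + diagSolutionOp lam hlam y ↔
      ∀ i, coordBCF i x = coordBCF i x 0 • expDecay (lam i) +
        solutionOp (lam i) (hlam i) (coordBCF i y) := by
    constructor
    · intro h i
      ext t
      conv_lhs => rw [h]
      simp [coordBCF_apply, diagExpDecay_apply, diagSolutionOp_apply]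
    · intro h
      ext t i
      have := DFunLike.congr_fun (h i) t
      simpa [coordBCF_apply, diagExpDecay_apply, diagSolutionOp_apply] using this
  have h2 : ∀ t : ℝ, HasDerivWithinAt (extendHalf x)
        (-standardForm lam (extendHalf x t) + extendHalf y t) (Ici 0) t ↔
      ∀ i, HasDerivWithinAt (extendHalf (coordBCF i x))
        (-lam i * extendHalf (coordBCF i x) t + extendHalf (coordBCF i y) t) (Ici 0) t := by
    intro t
    rw [hasDerivWithinAt_euclidean]
    refine forall_congr' fun i => ?_
    have : (-standardForm lam (extendHalf x t) + extendHalf y t) i =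
      -lam i * extendHalf (coordBCF i x) t + extendHalf (coordBCF i y) t := by
      simp [standardForm, extendHalf, coordBCF_apply]
    rw [this]
    rfl
  simp only [h1, h2, eq_expDecay_add_solutionOp_iff]
  exact ⟨fun h t ht i => h i t ht, fun h i t ht => h t ht i⟩

theorem posPart_diagExpDecay_zero (v : Rn n) : diagExpDecay lam v 0 = posPart lam v := by
  ext i
  rw [diagExpDecay_apply, posPart_apply]
  split_ifs with h
  · rw [expDecay_apply_zero h, mul_one]
  · rcases (not_lt.1 h).lt_or_eq with h' | h'
    · simp [expDecay_of_neg h']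
    · simp [expDecay, h]

theorem diagExpDecay_posPart (v : Rn n) : diagExpDecay lam (posPart lam v) = diagExpDecay lam v := by
  ext t i
  simp only [diagExpDecay_apply, posPart_apply]
  split_ifs with h
  · rfl
  · simp [expDecay, h]

theorem posPart_diagSolutionOp_zero (y : ℝ≥0 →ᵇ Rn n) :
    posPart lam (diagSolutionOp lam hlam y 0) = 0 := by
  ext i
  rw [posPart_apply, diagSolutionOp_apply]
  split_ifs with h
  · exact solutionOp_apply_zero h _
  · rfl

/-- The pointwise power bound holds at every `t` with the same constant, since each value is bounded
by the sup norm. -/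
theorem IsFlatBigO.superposition {G : Rn n →ᵇ Rn n} (hG : IsFlatBigO G) :
    IsFlatBigO (superposition ℝ≥0 G) := fun N => by
  obtain ⟨C, hC0, r, hr, hC⟩ := exists_bound_of_isBigO_norm_pow (hG N)
  refine isBigO_norm_pow_of_bound (C := C) hr fun x hx => (norm_le (by positivity)).2 fun t => ?_
  have ht := x.norm_coe_le_norm t
  exact (hC (x t) (ht.trans_lt hx)).trans (by gcongr)

/-- The local stable manifold of a hyperbolic zero of the vector field `-V`, with diagonal linear
part and flat nonlinearity: the points whose forward orbits stay near the zero form the graph of a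
smooth flat function. -/
theorem exists_local_stable_graph (hlam : ∀ i, lam i ≠ 0) {V : Rn n → Rn n} {T : Set (Rn n)}
    (hT : T ∈ 𝓝 0) (hV : ContDiffOn ℝ ∞ V T)
    (hflat : IsFlatBigO fun x => V x - standardForm lam x) {ρ₀ : ℝ} (hρ₀ : 0 < ρ₀) :
    ∃ ρ > 0, ρ ≤ ρ₀ ∧ ∃ δ > 0, ∃ η : Rn n → Rn n, ContDiffOn ℝ ∞ η (Metric.ball 0 δ) ∧
      IsFlatBigO η ∧ (∀ x, posPart lam (η x) = 0) ∧ (∀ x, η (posPart lam x) = η x) ∧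
      ∀ x₀ ∈ Metric.ball (0 : Rn n) δ, (x₀ - posPart lam x₀ = η x₀ ↔
        ∃ x : ℝ → Rn n, x 0 = x₀ ∧ ∀ t, 0 ≤ t → ‖x t‖ < ρ ∧
          HasDerivWithinAt x (-V (x t)) (Ici 0) t) := by
  have hstd : ContDiff ℝ ∞ (standardForm lam) :=
    contDiff_euclidean.2 fun i => contDiff_const.mul
      (EuclideanSpace.proj i : Rn n →L[ℝ] ℝ).contDiff
  obtain ⟨G, hG, hGs, r, hr, hrT, hGV⟩ :=
    exists_contDiff_hasCompactSupport_eq hT (hV.sub hstd.contDiffOn)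
  have hGflat : IsFlatBigO G := fun N => (hflat N).congr'
    (by filter_upwards [Metric.ball_mem_nhds (0 : Rn n) hr] with x hx using (hGV x hx).symm)
    EventuallyEq.rfl
  obtain ⟨Gb, rfl⟩ := exists_boundedContinuous_of_compactSupport hG.continuous hGs
  set K := diagSolutionOp lam hlam
  set N := superposition ℝ≥0 Gb
  have hN : ContDiff ℝ ∞ N := contDiff_superposition hG hGs
  have hNflat : IsFlatBigO N := hGflat.superposition
  -- Near the origin `V = V₀ + Gb`, so a small bounded `x` is an orbit of `-V` exactly if `Φ x` is
  -- the linear orbit `diagExpDecay lam (x 0)`. Flatness of `N` makes the derivative of `Φ` at 0 the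
  -- identity.
  set Φ : (ℝ≥0 →ᵇ Rn n) → (ℝ≥0 →ᵇ Rn n) := fun x => x + K (N x)
  have hΦ : ContDiff ℝ ∞ Φ := contDiff_id.add (hN.continuousLinearMap_comp K)
  have hΦ0 : Φ 0 = 0 := by simp [Φ, hNflat.apply_zero]
  have hΦd : HasFDerivAt Φ ((ContinuousLinearEquiv.refl ℝ (ℝ≥0 →ᵇ Rn n) :
      (ℝ≥0 →ᵇ Rn n) →L[ℝ] (ℝ≥0 →ᵇ Rn n))) 0 := by
    have h1 : HasFDerivAt N (0 : (ℝ≥0 →ᵇ Rn n) →L[ℝ] (ℝ≥0 →ᵇ Rn n)) 0 :=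
      Asymptotics.IsBigO.hasFDerivAt (n := 2) (by simpa using hNflat 2) (by norm_num)
    have h2 := (hasFDerivAt_id (𝕜 := ℝ) (0 : ℝ≥0 →ᵇ Rn n)).fun_add (K.hasFDerivAt.comp 0 h1)
    refine h2.congr_fderiv ?_
    ext x; simp
  obtain ⟨e, he0, heU, hee, -, hesymm⟩ := exists_smooth_local_inverse
    (Metric.isOpen_ball (x := (0 : ℝ≥0 →ᵇ Rn n)) (ε := min ρ₀ r))
    (Metric.mem_ball_self (lt_min hρ₀ hr)) hΦ.contDiffOn _ hΦd
  obtain ⟨ρ₁, hρ₁, hρ₁e⟩ := Metric.isOpen_iff.1 e.open_source 0 he0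
  have h0t : (0 : ℝ≥0 →ᵇ Rn n) ∈ e.target := by
    have := e.map_source he0
    rwa [hee, hΦ0] at this
  have hes0 : e.symm 0 = 0 := by
    have := e.left_inv he0
    rwa [hee, hΦ0] at this
  -- An orbit with `‖x t‖ < ρ` for all `t` has sup norm at most `ρ`, possibly equal; halving `ρ₁`
  -- keeps it strictly inside the domain of the local inverse.
  set ρ := min (ρ₁ / 2) (min ρ₀ r) with hρ
  have hρ0 : 0 < ρ := by positivity
  have hρr : ρ ≤ r := (min_le_right _ _).trans (min_le_right _ _)
  have hρρ₁ : ρ < ρ₁ := (min_le_left _ _).trans_lt (half_lt_self hρ₁)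
  set D := diagExpDecay lam
  set X : Rn n → (ℝ≥0 →ᵇ Rn n) := fun ξ => e.symm (D ξ)
  have hDt : ∀ᶠ ξ in 𝓝 (0 : Rn n), D ξ ∈ e.target :=
    D.continuous.continuousAt.eventually_mem (by
      rw [map_zero]; exact e.open_target.mem_nhds h0t)
  have hXs : ∀ ξ, D ξ ∈ e.target → ContDiffAt ℝ ∞ X ξ := fun ξ hξ =>
    (hesymm.contDiffAt (e.open_target.mem_nhds hξ)).comp ξ D.contDiff.contDiffAt
  have hX0 : X 0 = 0 := by simp only [X, map_zero, hes0]
  have hXc : ContDiffAt ℝ ∞ X 0 := hXs 0 hDt.self_of_nhds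
  have hXρ : ∀ᶠ ξ in 𝓝 (0 : Rn n), ‖X ξ‖ < ρ :=
    hXc.continuousAt.norm.eventually_lt_const (by beta_reduce; rw [hX0, norm_zero]; exact hρ0)
  obtain ⟨δ, hδ, hball⟩ := Metric.eventually_nhds_iff_ball.1 (hDt.and hXρ)
  let ev : (ℝ≥0 →ᵇ Rn n) →L[ℝ] Rn n := BoundedContinuousFunction.evalCLM ℝ 0
  let Q : Rn n →L[ℝ] Rn n := ContinuousLinearMap.id ℝ (Rn n) - posPart lam
  have hQ : ∀ v, Q v = v - posPart lam v := fun v => rfl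
  have hXeq : ∀ ξ, D ξ ∈ e.target → X ξ + K (N (X ξ)) = D ξ := fun ξ hξ => by
    have := e.right_inv hξ
    rwa [hee] at this
  -- `Q` annihilates the initial value of the linear orbit, so the graph function only sees the flat
  -- operator `N`. Its flatness comes from here.
  have hQX : ∀ ξ, D ξ ∈ e.target → Q (ev (X ξ)) = - Q (ev (K (N (X ξ)))) := fun ξ hξ => by
    have h1 : ev (X ξ) = posPart lam ξ - ev (K (N (X ξ))) := by
      rw [← posPart_diagExpDecay_zero ξ]
      change _ = ev (D ξ) - _
      rw [← hXeq ξ hξ, map_add, add_sub_cancel_right]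
    rw [h1, map_sub, hQ (posPart lam ξ), posPart_posPart, sub_self, zero_sub]
  have hPX : ∀ ξ, D ξ ∈ e.target → posPart lam (ev (X ξ)) = posPart lam ξ := fun ξ hξ => by
    have h1 : ev (X ξ) = posPart lam ξ - ev (K (N (X ξ))) := by
      rw [← posPart_diagExpDecay_zero ξ]
      change _ = ev (D ξ) - _
      rw [← hXeq ξ hξ, map_add, add_sub_cancel_right]
    have h2 : posPart lam (ev (K (N (X ξ)))) = 0 := posPart_diagSolutionOp_zero hlam _
    rw [h1, map_sub, posPart_posPart, h2, sub_zero]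
  refine ⟨ρ, hρ0, (min_le_right _ _).trans (min_le_left _ _), δ, hδ, fun ξ => Q (ev (X ξ)),
    fun ξ hξ => ?_, fun M => ?_, fun ξ => ?_, fun ξ => ?_, fun ξ hξ => ⟨fun h => ?_, ?_⟩⟩
  · exact (((hXs ξ (hball ξ hξ).1).continuousLinearMap_comp ev).continuousLinearMap_comp
      Q).contDiffWithinAt
  · have h1 : X =O[𝓝 0] fun ξ => ξ := by
      have := (hXc.differentiableAt (by simp)).isBigO_sub
      simpa [hX0] using this
    have h2 : (fun ξ => N (X ξ)) =O[𝓝 0] fun ξ => ‖X ξ‖ ^ M :=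
      (hNflat M).comp_tendsto (by simpa only [hX0] using hXc.continuousAt.tendsto)
    have h3 := ((Q.comp (ev.comp K)).isBigO_comp (fun ξ => N (X ξ)) (𝓝 0)).trans
      (h2.trans (h1.norm_norm.pow M))
    refine h3.neg_left.congr' ?_ EventuallyEq.rfl
    filter_upwards [hDt] with ξ hξ
    exact (hQX ξ hξ).symm
  · beta_reduce
    rw [hQ, map_sub, posPart_posPart, sub_self]
  · simp only [X, D, diagExpDecay_posPart]
  · have hξt := (hball ξ hξ).1
    have hξρ := (hball ξ hξ).2
    have hx0 : X ξ 0 = ξ := by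
      have h1 := hPX ξ hξt
      have h2 : Q (ev (X ξ)) = ξ - posPart lam ξ := h.symm
      rw [hQ, h1] at h2
      exact sub_left_injective h2
    have h2 : X ξ = D (X ξ 0) + K (-N (X ξ)) := by
      rw [hx0, ← hXeq ξ hξt, map_neg, add_neg_cancel_right]
    have h3 := (eq_diagExpDecay_add_iff hlam (X ξ) (-N (X ξ))).1 h2
    refine ⟨extendHalf (X ξ), ?_, fun t ht => ?_⟩
    · simp [extendHalf, hx0]
    have hlt : ‖extendHalf (X ξ) t‖ < ρ := ((X ξ).norm_coe_le_norm _).trans_lt hξρ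
    refine ⟨hlt, (h3 t ht).congr_deriv ?_⟩
    have h4 := hGV (extendHalf (X ξ) t) (by simpa using hlt.trans_le hρr)
    have h5 : extendHalf (-N (X ξ) : ℝ≥0 →ᵇ Rn n) t = - Gb (extendHalf (X ξ) t) := rfl
    rw [h5, h4]
    abel
  · rintro ⟨x, hx0, hx⟩
    have hxc : Continuous fun t : ℝ≥0 => x t := by
      have : ContinuousOn x (Ici 0) := fun t ht => (hx t ht).2.continuousWithinAt
      exact this.comp_continuous NNReal.continuous_coe fun t => t.2
    let Z : ℝ≥0 →ᵇ Rn n := ofNormedAddCommGroup (fun t : ℝ≥0 => x t) hxc ρ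
      fun t => (hx t t.2).1.le
    have hZx : ∀ t, 0 ≤ t → extendHalf Z t = x t := fun t ht => by
      change x (t.toNNReal : ℝ) = x t
      rw [Real.coe_toNNReal t ht]
    have hZ0 : Z 0 = ξ := hx0
    -- Membership in the source of `e` gives uniqueness: `Φ` is injective there, so the given orbit
    -- must be the constructed one.
    have hZs : Z ∈ e.source := hρ₁e (by
      rw [mem_ball_zero_iff]
      exact (norm_ofNormedAddCommGroup_le _ hρ0.le _).trans_lt hρρ₁)
    have h1 : Z = D (Z 0) + K (-N Z) := by
      refine (eq_diagExpDecay_add_iff hlam Z (-N Z)).2 fun t ht => ?_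
      refine ((hx t ht).2.congr (fun s hs => hZx s hs) (hZx t ht)).congr_deriv ?_
      have h5 : extendHalf (-N Z : ℝ≥0 →ᵇ Rn n) t = - Gb (extendHalf Z t) := rfl
      rw [h5, hZx t ht, hGV (x t) (by simpa using (hx t ht).1.trans_le hρr)]
      abel
    have h2 : Φ Z = D ξ := by
      rw [← hZ0]
      conv_lhs => simp only [Φ]
      nth_rewrite 1 [h1]
      simp
    have h3 : X ξ = Z := by
      have := e.left_inv hZs
      rw [hee, h2] at this
      exact this
    change _ = Q (ev (X ξ))
    rw [h3, hQ]
    change _ = Z 0 - posPart lam (Z 0)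
    rw [hZ0]

end StableGraph

/-! ### The metric, the gradient and its orbits in a chart. -/

section Geometry

set_option linter.unusedSectionVars false

variable {n : ℕ} {X : Type*} [TopologicalSpace X] [ChartedSpace (Rn n) X]
  [RiemannianBundle (fun x : X => TangentSpace 𝓘(ℝ, Rn n) x)]

/-- The derivative of the parametrization of a chart. -/
noncomputable def paramDeriv (φ : OpenPartialHomeomorph X (Rn n)) (x : Rn n) :
    Rn n →L[ℝ] TSp n (φ.symm x) :=
  mfderiv 𝓘(ℝ, Rn n) 𝓘(ℝ, Rn n) φ.symm x

/-- The metric in the coordinates of a chart. -/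
noncomputable def metricInChart (φ : OpenPartialHomeomorph X (Rn n)) (x : Rn n) :
    Rn n →L[ℝ] Rn n →L[ℝ] ℝ :=
  LinearMap.toContinuousBilinearMap (LinearMap.mk₂ ℝ
    (fun u v => inner ℝ (paramDeriv φ x u) (paramDeriv φ x v))
    (by intros; simp [inner_add_left]) (by intros; simp [inner_smul_left])
    (by intros; simp [inner_add_right]) (by intros; simp [inner_smul_right]))

theorem metricInChart_apply (φ : OpenPartialHomeomorph X (Rn n)) (x u v : Rn n) :
    metricInChart φ x u v = inner ℝ (paramDeriv φ x u) (paramDeriv φ x v) := rfl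

variable [IsManifold 𝓘(ℝ, Rn n) ∞ X] {φ : OpenPartialHomeomorph X (Rn n)}

theorem mdifferentiable_of_mem_maximalAtlas
    (hφ : φ ∈ IsManifold.maximalAtlas 𝓘(ℝ, Rn n) ∞ X) :
    φ.MDifferentiable 𝓘(ℝ, Rn n) 𝓘(ℝ, Rn n) :=
  ⟨(contMDiffOn_of_mem_maximalAtlas hφ).mdifferentiableOn (by simp),
    (contMDiffOn_symm_of_mem_maximalAtlas hφ).mdifferentiableOn (by simp)⟩

theorem paramDeriv_comp_mfderiv (hφ : φ ∈ IsManifold.maximalAtlas 𝓘(ℝ, Rn n) ∞ X) {x : Rn n}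
    (hx : x ∈ φ.target) (v : TSp n (φ.symm x)) :
    paramDeriv φ x (mfderiv 𝓘(ℝ, Rn n) 𝓘(ℝ, Rn n) φ (φ.symm x) v) = v := by
  have h := (mdifferentiable_of_mem_maximalAtlas hφ).symm_comp_deriv (φ.map_target hx)
  rw [φ.right_inv hx] at h
  exact DFunLike.congr_fun h v

theorem mfderiv_comp_paramDeriv (hφ : φ ∈ IsManifold.maximalAtlas 𝓘(ℝ, Rn n) ∞ X) {x : Rn n}
    (hx : x ∈ φ.target) (v : Rn n) :
    mfderiv 𝓘(ℝ, Rn n) 𝓘(ℝ, Rn n) φ (φ.symm x) (paramDeriv φ x v) = v :=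
  DFunLike.congr_fun ((mdifferentiable_of_mem_maximalAtlas hφ).comp_symm_deriv hx) v

theorem gradInChart_eq (f : X → ℝ) (hφ : φ ∈ IsManifold.maximalAtlas 𝓘(ℝ, Rn n) ∞ X) {x : Rn n}
    (hx : x ∈ φ.target) : gradInChart f φ x =
      mfderiv 𝓘(ℝ, Rn n) 𝓘(ℝ, Rn n) φ (φ.symm x) (grad n f (φ.symm x)) := by
  have : paramDeriv φ x = (ContinuousLinearEquiv.equivOfInverse (paramDeriv φ x)
      (mfderiv 𝓘(ℝ, Rn n) 𝓘(ℝ, Rn n) φ (φ.symm x))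
      (mfderiv_comp_paramDeriv hφ hx) (paramDeriv_comp_mfderiv hφ hx) :
        Rn n →L[ℝ] TSp n (φ.symm x)) := rfl
  rw [gradInChart, VectorField.mpullback_apply]
  change (paramDeriv φ x).inverse _ = _
  rw [this, ContinuousLinearMap.inverse_equiv]
  rfl

theorem paramDeriv_gradInChart (f : X → ℝ) (hφ : φ ∈ IsManifold.maximalAtlas 𝓘(ℝ, Rn n) ∞ X)
    {x : Rn n} (hx : x ∈ φ.target) :
    paramDeriv φ x (gradInChart f φ x) = grad n f (φ.symm x) := by
  rw [gradInChart_eq f hφ hx, paramDeriv_comp_mfderiv hφ hx]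

theorem mfderiv_grad (f : X → ℝ) (hφ : φ ∈ IsManifold.maximalAtlas 𝓘(ℝ, Rn n) ∞ X)
    {q : X} (hq : q ∈ φ.source) :
    mfderiv 𝓘(ℝ, Rn n) 𝓘(ℝ, Rn n) φ q (grad n f q) = gradInChart f φ (φ q) := by
  rw [gradInChart_eq f hφ (φ.map_source hq), φ.left_inv hq]

theorem contDiffOn_comp_symm {f : X → ℝ} (hf : ContMDiff 𝓘(ℝ, Rn n) 𝓘(ℝ, ℝ) ∞ f)
    (hφ : φ ∈ IsManifold.maximalAtlas 𝓘(ℝ, Rn n) ∞ X) :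
    ContDiffOn ℝ ∞ (f ∘ φ.symm) φ.target := by
  rw [← contMDiffOn_iff_contDiffOn]
  exact hf.comp_contMDiffOn (contMDiffOn_symm_of_mem_maximalAtlas hφ)

/-- The defining relation of the gradient in coordinates. Solving it for the field gives smoothness,
and differentiating it at a critical point gives the Hessian. -/
theorem metricInChart_gradInChart {f : X → ℝ} (hf : ContMDiff 𝓘(ℝ, Rn n) 𝓘(ℝ, ℝ) ∞ f)
    (hφ : φ ∈ IsManifold.maximalAtlas 𝓘(ℝ, Rn n) ∞ X) {x : Rn n} (hx : x ∈ φ.target) :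
    metricInChart φ x (gradInChart f φ x) = fderiv ℝ (f ∘ φ.symm) x := by
  ext v
  rw [metricInChart_apply, paramDeriv_gradInChart f hφ hx, ← mfderiv_eq_fderiv,
    mfderiv_comp x (hf.mdifferentiableAt (by simp))
      ((mdifferentiable_of_mem_maximalAtlas hφ).mdifferentiableAt_symm hx)]
  exact inner_sharp n _ _ _

/-- For constant `u`, the vectors `paramDeriv φ x u` form a smooth map into the tangent bundle,
being the tangent map of the parametrization along a constant section; the bundle metric is smooth
on such maps. -/
theorem contDiffOn_metricInChart [IsContMDiffRiemannianBundle 𝓘(ℝ, Rn n) ∞ (Rn n)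
      (fun x : X => TangentSpace 𝓘(ℝ, Rn n) x)]
    (hφ : φ ∈ IsManifold.maximalAtlas 𝓘(ℝ, Rn n) ∞ X) :
    ContDiffOn ℝ ∞ (metricInChart φ) φ.target := by
  have key (u : Rn n) : ContMDiffOn 𝓘(ℝ, Rn n) (𝓘(ℝ, Rn n).prod 𝓘(ℝ, Rn n)) ∞
      (fun x => (⟨φ.symm x, paramDeriv φ x u⟩ : TangentBundle 𝓘(ℝ, Rn n) X)) φ.target := by
    have h := (contMDiffOn_symm_of_mem_maximalAtlas hφ).contMDiffOn_tangentMapWithin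
      (m := ∞) (by simp) φ.open_target.uniqueMDiffOn
    have hc : ContMDiffOn 𝓘(ℝ, Rn n) (𝓘(ℝ, Rn n).prod 𝓘(ℝ, Rn n)) ∞
        (fun x => (⟨x, u⟩ : TangentBundle 𝓘(ℝ, Rn n) (Rn n))) φ.target := by
      intro x hx
      exact contMDiffWithinAt_vectorSpace_iff_contDiffWithinAt.2
        (contDiffWithinAt_const (c := u))
    refine (h.comp hc fun x hx => hx).congr fun x hx => ?_
    simp only [Function.comp, tangentMapWithin]
    rw [mfderivWithin_of_isOpen φ.open_target hx]
    rfl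
  refine contDiffOn_clm_apply.2 fun u => contDiffOn_clm_apply.2 fun v => ?_
  rw [← contMDiffOn_iff_contDiffOn]
  exact (key u).inner_bundle (key v)

theorem metricInChart_injective (hφ : φ ∈ IsManifold.maximalAtlas 𝓘(ℝ, Rn n) ∞ X) {x : Rn n}
    (hx : x ∈ φ.target) : Function.Injective (metricInChart φ x) := by
  refine (injective_iff_map_eq_zero _).2 fun v hv => ?_
  have h : metricInChart φ x v v = 0 := by rw [hv]; rfl
  rw [metricInChart_apply, inner_self_eq_zero] at h
  rw [← mfderiv_comp_paramDeriv hφ hx v, h, map_zero]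
  rfl

/-- The metric in a chart, as an isomorphism onto the dual space. -/
noncomputable def metricEquiv (hφ : φ ∈ IsManifold.maximalAtlas 𝓘(ℝ, Rn n) ∞ X) {x : Rn n}
    (hx : x ∈ φ.target) : Rn n ≃L[ℝ] (Rn n →L[ℝ] ℝ) :=
  (LinearEquiv.ofBijective (metricInChart φ x : Rn n →ₗ[ℝ] (Rn n →L[ℝ] ℝ))
    ⟨metricInChart_injective hφ hx,
      (LinearMap.injective_iff_surjective_of_finrank_eq_finrank
        (InnerProductSpace.toDual ℝ (Rn n)).toLinearEquiv.finrank_eq).1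
        (metricInChart_injective hφ hx)⟩).toContinuousLinearEquiv

/-- The field is the inverse of the metric applied to the differential, and inversion of continuous
linear maps is smooth at isomorphisms. -/
theorem contDiffOn_gradInChart [IsContMDiffRiemannianBundle 𝓘(ℝ, Rn n) ∞ (Rn n)
      (fun x : X => TangentSpace 𝓘(ℝ, Rn n) x)] {f : X → ℝ}
    (hf : ContMDiff 𝓘(ℝ, Rn n) 𝓘(ℝ, ℝ) ∞ f)
    (hφ : φ ∈ IsManifold.maximalAtlas 𝓘(ℝ, Rn n) ∞ X) :
    ContDiffOn ℝ ∞ (gradInChart f φ) φ.target := by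
  have h : ContDiffOn ℝ ∞ (fun x => (metricInChart φ x).inverse (fderiv ℝ (f ∘ φ.symm) x))
      φ.target := by
    refine ContDiffOn.clm_apply (fun x hx => ?_)
      ((contDiffOn_comp_symm hf hφ).fderiv_of_isOpen φ.open_target (by simp))
    have := contDiffAt_map_inverse (n := ∞) (metricEquiv hφ hx)
    exact this.comp_contDiffWithinAt x (contDiffOn_metricInChart hφ x hx)
  refine h.congr fun x hx => ?_
  rw [← metricInChart_gradInChart hf hφ hx]
  change _ = (metricEquiv hφ hx : Rn n →L[ℝ] (Rn n →L[ℝ] ℝ)).inverse (metricEquiv hφ hx _)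
  rw [ContinuousLinearMap.inverse_equiv]
  exact ((metricEquiv hφ hx).symm_apply_apply _).symm

theorem hasDerivWithinAt_chart_comp {f : X → ℝ}
    (hφ : φ ∈ IsManifold.maximalAtlas 𝓘(ℝ, Rn n) ∞ X) {γ : ℝ → X} {s : Set ℝ} {t : ℝ}
    (hγ : HasMFDerivWithinAt 𝓘(ℝ, ℝ) 𝓘(ℝ, Rn n) γ s t
      ((1 : ℝ →L[ℝ] ℝ).smulRight (-grad n f (γ t)))) (ht : γ t ∈ φ.source) :
    HasDerivWithinAt (φ ∘ γ) (-gradInChart f φ (φ (γ t))) s t := by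
  have h := ((mdifferentiable_of_mem_maximalAtlas hφ).mdifferentiableAt ht).hasMFDerivAt
    |>.comp_hasMFDerivWithinAt t hγ
  have h1 : HasFDerivWithinAt (φ ∘ γ) _ s t := hasMFDerivWithinAt_iff_hasFDerivWithinAt.1 h
  have h2 : mfderiv 𝓘(ℝ, Rn n) 𝓘(ℝ, Rn n) φ (γ t) ((1 : ℝ) • -grad n f (γ t)) =
      -gradInChart f φ (φ (γ t)) := by
    rw [one_smul, map_neg, mfderiv_grad f hφ ht]
    rfl
  refine hasDerivWithinAt_iff_hasFDerivWithinAt.2 (h1.congr_fderiv ?_)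
  refine ContinuousLinearMap.ext_ring ?_
  exact h2.trans (one_smul ℝ _).symm

theorem hasMFDerivWithinAt_symm_comp {f : X → ℝ}
    (hφ : φ ∈ IsManifold.maximalAtlas 𝓘(ℝ, Rn n) ∞ X) {x : ℝ → Rn n} {s : Set ℝ} {t : ℝ}
    (hx : HasDerivWithinAt x (-gradInChart f φ (x t)) s t) (ht : x t ∈ φ.target) :
    HasMFDerivWithinAt 𝓘(ℝ, ℝ) 𝓘(ℝ, Rn n) (φ.symm ∘ x) s t
      ((1 : ℝ →L[ℝ] ℝ).smulRight (-grad n f (φ.symm (x t)))) := by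
  have h := ((mdifferentiable_of_mem_maximalAtlas hφ).mdifferentiableAt_symm ht).hasMFDerivAt
    |>.comp_hasMFDerivWithinAt t hx.hasFDerivWithinAt.hasMFDerivWithinAt
  have h2 : ∀ L L' : ℝ →L[ℝ] TSp n (φ.symm (x t)), L 1 = L' 1 →
      HasMFDerivWithinAt 𝓘(ℝ, ℝ) 𝓘(ℝ, Rn n) (φ.symm ∘ x) s t L →
      HasMFDerivWithinAt 𝓘(ℝ, ℝ) 𝓘(ℝ, Rn n) (φ.symm ∘ x) s t L' := by
    intro L L' hL
    rw [ContinuousLinearMap.ext_ring hL]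
    exact id
  refine h2 _ _ ?_ h
  symm
  change (1 : ℝ) • -grad n f (φ.symm (x t)) =
    paramDeriv φ (x t) ((1 : ℝ) • -gradInChart f φ (x t))
  rw [one_smul, one_smul, map_neg, paramDeriv_gradInChart f hφ ht]

end Geometry

/-! ### Eigenbases with prescribed order. -/

section Diagonalization

/-- Two factorizations of a polynomial into linear factors agree up to a permutation. -/
theorem exists_perm_of_prod_X_sub_C_eq {ι R : Type*} [Fintype ι] [CommRing R] [IsDomain R]
    {a b : ι → R}
    (h : ∏ i, (Polynomial.X - Polynomial.C (a i)) = ∏ i, (Polynomial.X - Polynomial.C (b i))) :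
    ∃ σ : Equiv.Perm ι, ∀ i, b (σ i) = a i := by
  classical
  have key (c : ι → R) : (∏ i, (Polynomial.X - Polynomial.C (c i))).roots =
      Multiset.map c Finset.univ.val := by
    have := Polynomial.roots_multiset_prod_X_sub_C (Multiset.map c Finset.univ.val)
    rwa [Multiset.map_map] at this
  have hm : Multiset.map a Finset.univ.val = Multiset.map b Finset.univ.val := by
    rw [← key, h, key]
  have hcard (c : R) : Nonempty ({i // a i = c} ≃ {i // b i = c}) := by
    refine ⟨Fintype.equivOfCardEq ?_⟩
    have := congrArg (Multiset.count c) hm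
    rw [Multiset.count_map, Multiset.count_map] at this
    simp only [Fintype.card_subtype]
    simp only [eq_comm (a := c)] at this
    exact this
  exact ⟨Equiv.ofFiberEquiv fun c => (hcard c).some, fun i => Equiv.ofFiberEquiv_map _ i⟩

/-- A symmetric operator has an eigenbasis for any listing of its eigenvalues. -/
theorem exists_basis_of_charpoly_eq {n : ℕ} {E : Type*} [NormedAddCommGroup E]
    [InnerProductSpace ℝ E] [FiniteDimensional ℝ E] (hn : Module.finrank ℝ E = n)
    {T : E →ₗ[ℝ] E} (hT : T.IsSymmetric) {lam : Fin n → ℝ}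
    (h : T.charpoly = ∏ i, (Polynomial.X - Polynomial.C (lam i))) :
    ∃ b : Module.Basis (Fin n) ℝ E, ∀ i, T (b i) = lam i • b i := by
  rw [hT.charpoly_eq hn] at h
  obtain ⟨σ, hσ⟩ := exists_perm_of_prod_X_sub_C_eq h.symm
  refine ⟨(hT.eigenvectorBasis hn).toBasis.reindex σ.symm, fun i => ?_⟩
  simp only [Module.Basis.reindex_apply, Equiv.symm_symm, OrthonormalBasis.coe_toBasis]
  rw [hT.apply_eigenvectorBasis, ← hσ i]

/-- The standard form, as a continuous linear map. -/
noncomputable def standardCLM {n : ℕ} (lam : Fin n → ℝ) : Rn n →L[ℝ] Rn n :=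
  Matrix.toEuclideanCLM (n := Fin n) (𝕜 := ℝ) (Matrix.diagonal lam)

theorem standardCLM_apply {n : ℕ} (lam : Fin n → ℝ) (x : Rn n) :
    standardCLM lam x = standardForm lam x := by
  ext i
  simp [standardCLM, standardForm, Matrix.mulVec_diagonal]

end Diagonalization

/-! ### Changes of chart, and diagonal linear part at the critical point. -/

section GeometryCharts

set_option linter.unusedSectionVars false

variable {n : ℕ} {X : Type*} [TopologicalSpace X] [ChartedSpace (Rn n) X]
  [RiemannianBundle (fun x : X => TangentSpace 𝓘(ℝ, Rn n) x)] [IsManifold 𝓘(ℝ, Rn n) ∞ X]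
  {φ : OpenPartialHomeomorph X (Rn n)} {f : X → ℝ} {p : X}

theorem IsCentredChart.zero_mem_target (hφ : IsCentredChart φ p) : (0 : Rn n) ∈ φ.target := by
  rw [← hφ.2.2]
  exact φ.map_source hφ.2.1

theorem IsCentredChart.symm_zero (hφ : IsCentredChart φ p) : φ.symm 0 = p := by
  rw [← hφ.2.2, φ.left_inv hφ.2.1]

theorem gradInChart_apply_of_isCritical (hφ : φ ∈ IsManifold.maximalAtlas 𝓘(ℝ, Rn n) ∞ X)
    (hps : p ∈ φ.source) (hp : IsCritical n f p) : gradInChart f φ (φ p) = 0 := by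
  rw [← mfderiv_grad f hφ hps, hp, map_zero]
  rfl

/-- Product rule for metric times field: the term that differentiates the metric vanishes at a zero
of the field. -/
theorem metricInChart_fderiv_gradInChart
    [IsContMDiffRiemannianBundle 𝓘(ℝ, Rn n) ∞ (Rn n)
      (fun x : X => TangentSpace 𝓘(ℝ, Rn n) x)]
    (hf : ContMDiff 𝓘(ℝ, Rn n) 𝓘(ℝ, ℝ) ∞ f)
    (hφ : φ ∈ IsManifold.maximalAtlas 𝓘(ℝ, Rn n) ∞ X) {c : Rn n} (hc : c ∈ φ.target)
    (h0 : gradInChart f φ c = 0) (a : Rn n) :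
    metricInChart φ c (fderiv ℝ (gradInChart f φ) c a) =
      fderiv ℝ (fderiv ℝ (f ∘ φ.symm)) c a := by
  have hmem := φ.open_target.mem_nhds hc
  have hG := (((contDiffOn_metricInChart hφ).contDiffAt hmem).differentiableAt
    (by simp)).hasFDerivAt
  have hV := (((contDiffOn_gradInChart hf hφ).contDiffAt hmem).differentiableAt
    (by simp)).hasFDerivAt
  have h1 := (hG.clm_apply hV).congr_of_eventuallyEq (f₁ := fderiv ℝ (f ∘ φ.symm)) (by
    filter_upwards [hmem] with x hx
    exact (metricInChart_gradInChart hf hφ hx).symm)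
  rw [h1.fderiv]
  simp [h0]

/-- A smooth change of coordinates turns a chart of the maximal atlas into another one. -/
theorem trans_mem_maximalAtlas (hφ : φ ∈ IsManifold.maximalAtlas 𝓘(ℝ, Rn n) ∞ X)
    {h : OpenPartialHomeomorph (Rn n) (Rn n)} (hh : ContDiffOn ℝ ∞ h h.source)
    (hh' : ContDiffOn ℝ ∞ h.symm h.target) :
    φ.trans h ∈ IsManifold.maximalAtlas 𝓘(ℝ, Rn n) ∞ X := by
  refine OpenPartialHomeomorph.mem_maximalAtlas_of_contMDiffOn _ ?_ ?_
  · refine (contMDiffOn_iff_contDiffOn.2 hh).comp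
      ((contMDiffOn_of_mem_maximalAtlas hφ).mono ?_) ?_
    · intro x hx; exact hx.1
    · intro x hx; exact hx.2
  · refine (contMDiffOn_symm_of_mem_maximalAtlas hφ).comp
      ((contMDiffOn_iff_contDiffOn.2 hh').mono ?_) ?_
    · intro x hx; exact hx.1
    · intro x hx; exact hx.2

theorem gradInChart_trans (hφ : φ ∈ IsManifold.maximalAtlas 𝓘(ℝ, Rn n) ∞ X)
    {h : OpenPartialHomeomorph (Rn n) (Rn n)} (hh : ContDiffOn ℝ ∞ h h.source)
    (hh' : ContDiffOn ℝ ∞ h.symm h.target) {y : Rn n} (hy : y ∈ (φ.trans h).target) :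
    gradInChart f (φ.trans h) y = fderiv ℝ h (h.symm y) (gradInChart f φ (h.symm y)) := by
  have hy1 : y ∈ h.target := hy.1
  have hy2 : h.symm y ∈ φ.target := hy.2
  have hy3 := h.map_target hy1
  rw [gradInChart_eq f (trans_mem_maximalAtlas hφ hh hh') hy, gradInChart_eq f hφ hy2,
    ← mfderiv_eq_fderiv]
  have hd : MDifferentiableAt 𝓘(ℝ, Rn n) 𝓘(ℝ, Rn n) h (φ (φ.symm (h.symm y))) := by
    rw [φ.right_inv hy2]
    exact ((hh.contDiffAt (h.open_source.mem_nhds hy3)).differentiableAt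
      (by simp)).mdifferentiableAt
  have := mfderiv_comp (φ.symm (h.symm y)) hd
    ((mdifferentiable_of_mem_maximalAtlas hφ).mdifferentiableAt (φ.map_target hy2))
  rw [φ.right_inv hy2] at this
  exact DFunLike.congr_fun this _

theorem paramDeriv_chartAt (p : X) (u : Rn n) :
    paramDeriv (chartAt (Rn n) p) (chartAt (Rn n) p p) u = u := by
  have : IsManifold 𝓘(ℝ, Rn n) 1 X := IsManifold.of_le (n := ∞) (by simp)
  have h := mfderivWithin_range_extChartAt_symm (I := 𝓘(ℝ, Rn n)) (x := p)
  have h2 : range (𝓘(ℝ, Rn n)) = univ := by simp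
  rw [h2, mfderivWithin_univ] at h
  exact DFunLike.congr_fun h u

theorem metricInChart_chartAt (p : X) (u v : Rn n) :
    metricInChart (chartAt (Rn n) p) (chartAt (Rn n) p p) u v =
      @inner ℝ (TSp n p) _ u v := by
  -- The base point obtained by going through the chart and back equals `p` only propositionally, so
  -- the two inner products are compared by substitution.
  have key : ∀ q : X, q = p → ∀ u v : Rn n,
      @inner ℝ (TSp n q) _ u v = @inner ℝ (TSp n p) _ u v := by
    rintro q rfl u v; rfl
  rw [metricInChart_apply]
  have h1 := paramDeriv_chartAt p u
  have h2 := paramDeriv_chartAt p v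
  refine Eq.trans ?_ (key _ ((chartAt (Rn n) p).left_inv (mem_chart_source (Rn n) p)) u v)
  exact congrArg₂ (fun a b : TSp n _ => inner ℝ a b) h1 h2

variable [IsContMDiffRiemannianBundle 𝓘(ℝ, Rn n) ∞ (Rn n)
      (fun x : X => TangentSpace 𝓘(ℝ, Rn n) x)]

/-- Both sides represent the second derivative through the metric, and in the preferred chart the
coordinate metric at `p` is the inner product of the tangent space itself. -/
theorem hessOp_eq_fderiv_gradInChart (hf : ContMDiff 𝓘(ℝ, Rn n) 𝓘(ℝ, ℝ) ∞ f)
    (hp : IsCritical n f p) (u : Rn n) :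
    hessOp n f p u = fderiv ℝ (gradInChart f (chartAt (Rn n) p)) (chartAt (Rn n) p p) u := by
  have hmax := IsManifold.chart_mem_maximalAtlas (I := 𝓘(ℝ, Rn n)) (n := ∞) p
  refine ext_inner_right ℝ (E := TSp n p) fun v => ?_
  refine (inner_sharp n p (hess n f p u) v).trans ?_
  have h1 := metricInChart_fderiv_gradInChart hf hmax (mem_chart_target (Rn n) p)
    (gradInChart_apply_of_isCritical hmax (mem_chart_source (Rn n) p) hp) u
  exact (DFunLike.congr_fun h1 v).symm.trans (metricInChart_chartAt p _ v)

theorem hessOp_isSymmetric (hf : ContMDiff 𝓘(ℝ, Rn n) 𝓘(ℝ, ℝ) ∞ f) :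
    (hessOp n f p).IsSymmetric := by
  intro u v
  have hmax := IsManifold.chart_mem_maximalAtlas (I := 𝓘(ℝ, Rn n)) (n := ∞) p
  have hs := (((contDiffOn_comp_symm hf hmax).contDiffAt ((chartAt (Rn n) p).open_target.mem_nhds
    (mem_chart_target (Rn n) p))).isSymmSndFDerivAt
      (by
      simp only [minSmoothness_of_isRCLikeNormedField]
      exact WithTop.coe_le_coe.2 (le_top (a := (2 : ℕ∞))))).eq u v
  refine (inner_sharp n p (hess n f p u) v).trans ?_
  refine Eq.trans hs ?_
  refine Eq.trans ?_ (real_inner_comm _ _)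
  exact (inner_sharp n p (hess n f p v) u).symm

theorem standardForm_single (lam : Fin n → ℝ) (i : Fin n) :
    standardForm lam (EuclideanSpace.single i (1 : ℝ)) =
      lam i • EuclideanSpace.single i (1 : ℝ) := by
  ext j
  simp only [standardForm, PiLp.smul_apply, smul_eq_mul]
  by_cases h : j = i <;> simp [h]

/-- Following the preferred chart by the affine map that moves `p` to 0 and the eigenbasis to the
standard one conjugates the derivative of the field into diagonal form. -/
theorem exists_isCentredChart_fderiv_gradInChart (hf : ContMDiff 𝓘(ℝ, Rn n) 𝓘(ℝ, ℝ) ∞ f)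
    (hp : IsCritical n f p) {lam : Fin n → ℝ} (hlam : IsMorseEigenvalues n f p lam) :
    ∃ φ : OpenPartialHomeomorph X (Rn n), IsCentredChart φ p ∧
      ∀ v, fderiv ℝ (gradInChart f φ) 0 v = standardForm lam v := by
  have : FiniteDimensional ℝ (TSp n p) := inferInstanceAs (FiniteDimensional ℝ (Rn n))
  obtain ⟨b', hb'⟩ := exists_basis_of_charpoly_eq (E := TSp n p) (n := n) (by
    exact (finrank_euclideanSpace_fin : Module.finrank ℝ (Rn n) = n)) (hessOp_isSymmetric hf) hlam
  set φ₀ := chartAt (Rn n) p with hφ₀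
  set c := φ₀ p with hc
  have hcs : c ∈ φ₀.target := mem_chart_target (Rn n) p
  have hmax : φ₀ ∈ IsManifold.maximalAtlas 𝓘(ℝ, Rn n) ∞ X :=
    IsManifold.chart_mem_maximalAtlas (I := 𝓘(ℝ, Rn n)) (n := ∞) p
  let b : Module.Basis (Fin n) ℝ (Rn n) := b'
  have hb (i : Fin n) : fderiv ℝ (gradInChart f φ₀) c (b i) = lam i • b i :=
    (hessOp_eq_fderiv_gradInChart hf hp (b i)).symm.trans (hb' i)
  let e : Rn n ≃L[ℝ] Rn n :=
    (b.equiv (EuclideanSpace.basisFun (Fin n) ℝ).toBasis (Equiv.refl _)).toContinuousLinearEquiv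
  have he (i : Fin n) : e (b i) = EuclideanSpace.single i (1 : ℝ) := by
    change b.equiv _ _ (b i) = _
    simp
  let h : OpenPartialHomeomorph (Rn n) (Rn n) :=
    ((Homeomorph.addRight (-c)).trans e.toHomeomorph).toOpenPartialHomeomorph
  have hh (x : Rn n) : h x = e (x - c) := by simp [h, sub_eq_add_neg]
  have hh' (y : Rn n) : h.symm y = e.symm y + c := by
    change e.symm y + - -c = _
    rw [neg_neg]
  have hhs : ContDiff ℝ ∞ h := by
    rw [show (h : Rn n → Rn n) = fun x => e (x - c) from funext hh]
    fun_prop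
  have hhs' : ContDiff ℝ ∞ h.symm := by
    rw [show (h.symm : Rn n → Rn n) = fun x => e.symm x + c from funext hh']
    fun_prop
  have hm := trans_mem_maximalAtlas hmax hhs.contDiffOn hhs'.contDiffOn
  have hcen : IsCentredChart (φ₀.trans h) p :=
    ⟨hm, ⟨mem_chart_source (Rn n) p, mem_univ _⟩, by
      rw [OpenPartialHomeomorph.coe_trans, Function.comp, hh, ← hc, sub_self, map_zero]⟩
  refine ⟨φ₀.trans h, hcen, ?_⟩
  have hfd (x : Rn n) : fderiv ℝ h x = (e : Rn n →L[ℝ] Rn n) := by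
    rw [show (h : Rn n → Rn n) = fun x => e (x - c) from funext hh]
    exact (e.hasFDerivAt.comp x ((hasFDerivAt_id x).sub_const c)).fderiv
  have hV : HasFDerivAt (gradInChart f φ₀) (fderiv ℝ (gradInChart f φ₀) c) (e.symm 0 + c) := by
    rw [map_zero, zero_add]
    exact (((contDiffOn_gradInChart hf hmax).contDiffAt
      (φ₀.open_target.mem_nhds hcs)).differentiableAt (by simp)).hasFDerivAt
  have hcomp := (e : Rn n →L[ℝ] Rn n).hasFDerivAt.comp (0 : Rn n)
    (hV.comp (0 : Rn n) (e.symm.hasFDerivAt.add_const c))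
  have hcongr : gradInChart f (φ₀.trans h) =ᶠ[𝓝 0]
      (e : Rn n →L[ℝ] Rn n) ∘ gradInChart f φ₀ ∘ fun x => e.symm x + c := by
    filter_upwards [(φ₀.trans h).open_target.mem_nhds hcen.zero_mem_target] with y hy
    rw [gradInChart_trans hmax hhs.contDiffOn hhs'.contDiffOn hy, hfd, hh']
    rfl
  rw [(hcomp.congr_of_eventuallyEq hcongr).fderiv]
  intro v
  rw [← standardCLM_apply]
  refine DFunLike.congr_fun (f := ((e : Rn n →L[ℝ] Rn n).comp
    ((fderiv ℝ (gradInChart f φ₀) c).comp (e.symm : Rn n →L[ℝ] Rn n)))) ?_ v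
  refine ContinuousLinearMap.coe_injective
    ((EuclideanSpace.basisFun (Fin n) ℝ).toBasis.ext fun i => ?_)
  simp only [OrthonormalBasis.coe_toBasis, EuclideanSpace.basisFun_apply,
    ContinuousLinearMap.coe_coe, ContinuousLinearMap.comp_apply, ContinuousLinearEquiv.coe_coe]
  rw [standardCLM_apply, standardForm_single, ← he i, e.symm_apply_apply, hb, map_smul]

end GeometryCharts

/-! ### Lyapunov functions for gradient-like fields. -/

section Lyapunov

variable {E : Type*} [NormedAddCommGroup E] [InnerProductSpace ℝ E]
  {u : E → ℝ} {V : E → E} {r c M : ℝ}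

/-- If `u` grows quadratically along `V`, then `u + κ ‖x‖ ^ 2` is a Lyapunov function of `-V` for
small `κ`. -/
theorem antitoneOn_lyapunov (hu : ∀ x ∈ Metric.ball (0 : E) r, DifferentiableAt ℝ u x)
    (hc : ∀ x ∈ Metric.ball (0 : E) r, c * ‖x‖ ^ 2 ≤ fderiv ℝ u x (V x))
    (hM : ∀ x ∈ Metric.ball (0 : E) r, ‖V x‖ ≤ M * ‖x‖) {κ : ℝ} (hκ : 0 ≤ κ)
    (hκ' : 2 * κ * M ≤ c) {D : Set ℝ} (hD : Convex ℝ D) {x : ℝ → E}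
    (hxr : ∀ t ∈ D, x t ∈ Metric.ball (0 : E) r)
    (hx : ∀ t ∈ D, HasDerivWithinAt x (-V (x t)) D t) :
    AntitoneOn (fun t => u (x t) + κ * ‖x t‖ ^ 2) D := by
  have hd : ∀ t ∈ D, HasDerivWithinAt (fun t => u (x t) + κ * ‖x t‖ ^ 2)
      (fderiv ℝ u (x t) (-V (x t)) + κ * (2 * inner ℝ (x t) (-V (x t)))) D t := fun t ht =>
    ((hu _ (hxr t ht)).hasFDerivAt.comp_hasDerivWithinAt t (hx t ht)).add
      ((hx t ht).norm_sq.const_mul κ)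
  refine antitoneOn_of_hasDerivWithinAt_nonpos hD (fun t ht => (hd t ht).continuousWithinAt)
    (fun t ht => (hd t (interior_subset ht)).mono interior_subset) fun t ht => ?_
  have ht' := hxr t (interior_subset ht)
  have h1 : |inner ℝ (x t) (V (x t))| ≤ ‖x t‖ * (M * ‖x t‖) :=
    (abs_real_inner_le_norm _ _).trans (by gcongr; exact hM _ ht')
  have h2 := (abs_le.1 h1).1
  have h3 := mul_le_mul_of_nonneg_left h2 hκ
  have h4 := mul_le_mul_of_nonneg_right hκ' (sq_nonneg ‖x t‖)
  have h5 := hc _ ht'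
  rw [map_neg, inner_neg_right]
  nlinarith

/-- An orbit of `-V` that stays close to the origin converges to it. -/
theorem tendsto_zero_of_lyapunov [FiniteDimensional ℝ E]
    (hu : ∀ x ∈ Metric.ball (0 : E) r, DifferentiableAt ℝ u x)
    (hc : ∀ x ∈ Metric.ball (0 : E) r, c * ‖x‖ ^ 2 ≤ fderiv ℝ u x (V x))
    (hM : ∀ x ∈ Metric.ball (0 : E) r, ‖V x‖ ≤ M * ‖x‖) (hc0 : 0 < c) (hM0 : 0 < M)
    {ρ : ℝ} (hρ : ρ < r) {x : ℝ → E}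
    (hx : ∀ t, 0 ≤ t → ‖x t‖ < ρ ∧ HasDerivWithinAt x (-V (x t)) (Ici 0) t) :
    Tendsto x atTop (𝓝 0) := by
  have hxr : ∀ t ∈ Ici (0 : ℝ), x t ∈ Metric.ball (0 : E) r := fun t ht => by
    simpa using (hx t ht).1.trans hρ
  have hcu : ContinuousOn u (Metric.closedBall 0 ρ) := fun y hy =>
    (hu y (Metric.closedBall_subset_ball hρ hy)).continuousAt.continuousWithinAt
  obtain ⟨m, hm⟩ := ((isCompact_closedBall (0 : E) ρ).image_of_continuousOn hcu).bddBelow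
  have hmu : ∀ t, 0 ≤ t → m ≤ u (x t) := fun t ht =>
    hm (mem_image_of_mem u (by simpa using (hx t ht).1.le))
  -- Both `u` and `u + κ ‖x‖ ^ 2` decrease along the orbit and are bounded below, so both converge,
  -- and so does `‖x t‖ ^ 2`.
  set κ := c / (2 * M) with hκ
  have hκ0 : 0 < κ := by positivity
  have hconv : ∀ κ' : ℝ, 0 ≤ κ' → κ' ≤ κ →
      ∃ l, Tendsto (fun t => u (x t) + κ' * ‖x t‖ ^ 2) atTop (𝓝 l) := by
    intro κ' h0 h1
    have hanti := antitoneOn_lyapunov hu hc hM h0 (by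
      calc 2 * κ' * M ≤ 2 * κ * M := by gcongr
        _ = c := by rw [hκ]; field_simp) (convex_Ici 0) hxr fun t ht => (hx t ht).2
    have hanti' : Antitone fun t => u (x (max t 0)) + κ' * ‖x (max t 0)‖ ^ 2 := fun s t hst =>
      hanti (le_max_right s 0) (le_max_right t 0) (max_le_max_right 0 hst)
    have hb : BddBelow (range fun t => u (x (max t 0)) + κ' * ‖x (max t 0)‖ ^ 2) := by
      refine ⟨m, ?_⟩
      rintro _ ⟨t, rfl⟩
      have := hmu _ (le_max_right t 0)
      have : 0 ≤ κ' * ‖x (max t 0)‖ ^ 2 := by positivity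
      dsimp only
      linarith
    refine ⟨_, (tendsto_atTop_ciInf hanti' hb).congr' ?_⟩
    filter_upwards [eventually_ge_atTop 0] with t ht
    rw [max_eq_left ht]
  obtain ⟨l₁, hl₁⟩ := hconv κ hκ0.le le_rfl
  obtain ⟨l₂, hl₂⟩ := hconv 0 le_rfl hκ0.le
  have hsq : Tendsto (fun t => ‖x t‖ ^ 2) atTop (𝓝 (κ⁻¹ * (l₁ - l₂))) := by
    refine ((hl₁.sub hl₂).const_mul κ⁻¹).congr fun t => ?_
    field_simp
    ring
  set l := κ⁻¹ * (l₁ - l₂)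
  have hl : l = 0 := by
    have hl0 : 0 ≤ l := ge_of_tendsto' hsq fun t => by positivity
    by_contra hne
    have hlpos : 0 < l := lt_of_le_of_ne hl0 (Ne.symm hne)
    obtain ⟨T, hT⟩ := eventually_atTop.1 (hsq.eventually (lt_mem_nhds (half_lt_self hlpos)))
    set T' := max T 0
    have hd : ∀ t ∈ Ici T', HasDerivWithinAt (fun t => u (x t) + c * (l / 2) * t)
        (fderiv ℝ u (x t) (-V (x t)) + c * (l / 2) * 1) (Ici T') t := fun t ht => by
      have ht0 : 0 ≤ t := (le_max_right T 0).trans ht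
      refine HasDerivWithinAt.add ?_ ((hasDerivWithinAt_id t _).const_mul _)
      exact (hu _ (hxr t ht0)).hasFDerivAt.comp_hasDerivWithinAt t
        ((hx t ht0).2.mono (Ici_subset_Ici.2 (le_max_right T 0)))
    have hanti := antitoneOn_of_hasDerivWithinAt_nonpos (convex_Ici T')
      (fun t ht => (hd t ht).continuousWithinAt)
      (fun t ht => (hd t (interior_subset ht)).mono interior_subset) fun t ht => by
        have ht' : T' ≤ t := interior_subset (s := Ici T') ht
        have h1 := hc _ (hxr t ((le_max_right T 0).trans ht'))
        have h2 := hT t ((le_max_left T 0).trans ht')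
        have h3 := mul_le_mul_of_nonneg_left h2.le hc0.le
        rw [map_neg]
        linarith
    -- If the limit `l` were positive, `u` would eventually fall at rate at least `c * (l / 2)`; by
    -- time `s` it would lie below its lower bound `m`.
    set s := T' + (u (x T') - m + 1) / (c * (l / 2)) with hs
    have hmT := hmu T' (le_max_right T 0)
    have hsT : T' ≤ s := by
      rw [hs]
      have : 0 ≤ (u (x T') - m + 1) / (c * (l / 2)) := by
        apply div_nonneg <;> [linarith; positivity]
      linarith
    have h1 := hanti (mem_Ici.2 le_rfl) (mem_Ici.2 hsT) hsT
    have h2 := hmu s ((le_max_right T 0).trans hsT)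
    have h3 : c * (l / 2) * s = c * (l / 2) * T' + (u (x T') - m + 1) := by
      rw [hs]; field_simp
    dsimp only at h1
    linarith
  rw [hl] at hsq
  rw [tendsto_zero_iff_norm_tendsto_zero]
  have := hsq.sqrt
  simpa [Real.sqrt_sq] using this

end Lyapunov

/-! ### Coercivity estimates. -/

section Coercive

theorem exists_pos_mul_sq_norm_le {E : Type*} [NormedAddCommGroup E] [NormedSpace ℝ E]
    [FiniteDimensional ℝ E] (B : E →L[ℝ] E →L[ℝ] ℝ) (hB : ∀ v, v ≠ 0 → 0 < B v v) :
    ∃ c > 0, ∀ v, c * ‖v‖ ^ 2 ≤ B v v := by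
  by_cases hE : (Metric.sphere (0 : E) 1).Nonempty
  · obtain ⟨w, hw, hmin⟩ := (isCompact_sphere (0 : E) 1).exists_isMinOn hE
      (f := fun v => B v v)
      (B.isBoundedBilinearMap.continuous.comp (continuous_id.prodMk continuous_id)).continuousOn
    have hw1 : ‖w‖ = 1 := by simpa using hw
    refine ⟨B w w, hB w (by rintro rfl; simp at hw1), fun v => ?_⟩
    by_cases hv : v = 0
    · simp [hv]
    have hv' : 0 < ‖v‖ := norm_pos_iff.2 hv
    have h1 : B w w ≤ B (‖v‖⁻¹ • v) (‖v‖⁻¹ • v) :=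
      hmin (by simp [norm_smul, hv'.ne'])
    simp only [map_smul, smul_apply, smul_eq_mul] at h1
    calc B w w * ‖v‖ ^ 2 ≤ ‖v‖⁻¹ * (‖v‖⁻¹ * B v v) * ‖v‖ ^ 2 := by gcongr
      _ = B v v := by field_simp
  -- The unit sphere is empty only in the zero space.
  · refine ⟨1, one_pos, fun v => ?_⟩
    have hv : v = 0 := by
      by_contra hv
      exact hE ⟨‖v‖⁻¹ • v, by simp [norm_smul, norm_ne_zero_iff.2 hv]⟩
    simp [hv]

theorem eventually_mul_sq_norm_le {E : Type*} [NormedAddCommGroup E] [NormedSpace ℝ E]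
    [FiniteDimensional ℝ E] {B : E → E →L[ℝ] E →L[ℝ] ℝ} {x₀ : E} (hBc : ContinuousAt B x₀)
    (hB : ∀ v, v ≠ 0 → 0 < B x₀ v v) :
    ∃ c > 0, ∀ᶠ x in 𝓝 x₀, ∀ v, c * ‖v‖ ^ 2 ≤ B x v v := by
  obtain ⟨a, ha, hG⟩ := exists_pos_mul_sq_norm_le (B x₀) hB
  refine ⟨a / 2, half_pos ha, ?_⟩
  let _ : NormedAddCommGroup (E →L[ℝ] E →L[ℝ] ℝ) := ContinuousLinearMap.toNormedAddCommGroup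
  have hn : Tendsto (fun x => ‖B x - B x₀‖) (𝓝 x₀) (𝓝 0) :=
    tendsto_iff_norm_sub_tendsto_zero.1 hBc
  filter_upwards [hn.eventually (gt_mem_nhds (half_pos ha))] with x hx v
  have h2 : ‖(B x - B x₀) v v‖ ≤ a / 2 * ‖v‖ ^ 2 := by
    calc _ ≤ ‖B x - B x₀‖ * ‖v‖ * ‖v‖ := ContinuousLinearMap.le_opNorm₂ _ _ _
      _ = ‖B x - B x₀‖ * ‖v‖ ^ 2 := by ring
      _ ≤ _ := by gcongr
  have h4 : B x v v = B x₀ v v + (B x - B x₀) v v := by simp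
  have h7 := (abs_le.1 (Real.norm_eq_abs _ ▸ h2)).1
  have h8 := hG v
  rw [h4]
  linarith

/-- The standard form with the reciprocal eigenvalues is a bounded inverse. -/
theorem exists_pos_mul_norm_le_standardForm {n : ℕ} {lam : Fin n → ℝ} (hlam : ∀ i, lam i ≠ 0) :
    ∃ m > 0, ∀ x, m * ‖x‖ ≤ ‖standardForm lam x‖ := by
  set A := standardCLM fun i => (lam i)⁻¹
  refine ⟨(‖A‖ + 1)⁻¹, by positivity, fun x => ?_⟩
  have h : A (standardForm lam x) = x := by
    rw [standardCLM_apply]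
    ext i
    simp [standardForm, hlam i]
  have h1 := A.le_opNorm (standardForm lam x)
  rw [h] at h1
  rw [inv_mul_le_iff₀ (by positivity)]
  nlinarith [norm_nonneg (standardForm lam x)]

end Coercive

/-! ### The global stable manifold near the critical point. -/

section StableManifold

set_option linter.unusedSectionVars false

variable {n : ℕ} {X : Type*} [TopologicalSpace X] [ChartedSpace (Rn n) X]
  [RiemannianBundle (fun x : X => TangentSpace 𝓘(ℝ, Rn n) x)] [IsManifold 𝓘(ℝ, Rn n) ∞ X]
  [IsContMDiffRiemannianBundle 𝓘(ℝ, Rn n) ∞ (Rn n)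
      (fun x : X => TangentSpace 𝓘(ℝ, Rn n) x)]
  {φ : OpenPartialHomeomorph X (Rn n)} {f : X → ℝ} {p : X}

/-- `df(V)` is the metric square of `V`, hence bounded below by `‖V‖ ^ 2`, and `V` is at least of
linear size because its linear part is invertible. -/
theorem exists_coercive (hf : ContMDiff 𝓘(ℝ, Rn n) 𝓘(ℝ, ℝ) ∞ f) (hφ : IsCentredChart φ p)
    {lam : Fin n → ℝ} (hlam : ∀ i, lam i ≠ 0)
    (hV : (fun x => gradInChart f φ x - standardForm lam x) =O[𝓝 0] fun x => ‖x‖ ^ 2) :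
    ∃ r > 0, ∃ c > 0, ∃ M > 0, Metric.ball 0 r ⊆ φ.target ∧
      (∀ x ∈ Metric.ball (0 : Rn n) r,
        c * ‖x‖ ^ 2 ≤ fderiv ℝ (f ∘ φ.symm) x (gradInChart f φ x)) ∧
      ∀ x ∈ Metric.ball (0 : Rn n) r, ‖gradInChart f φ x‖ ≤ M * ‖x‖ := by
  have h0 := hφ.zero_mem_target
  have hmem := φ.open_target.mem_nhds h0
  obtain ⟨a, ha, hG⟩ := eventually_mul_sq_norm_le
    ((contDiffOn_metricInChart hφ.1).contDiffAt hmem).continuousAt fun v hv => by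
      rw [metricInChart_apply]
      refine real_inner_self_pos.2 fun h => hv ?_
      rw [← mfderiv_comp_paramDeriv hφ.1 h0 v, h, map_zero]
      rfl
  obtain ⟨m, hm, hstd⟩ := exists_pos_mul_norm_le_standardForm hlam
  obtain ⟨C, hC, r₁, hr₁, hVC⟩ := exists_bound_of_isBigO_norm_pow hV
  obtain ⟨r₂, hr₂, hG2⟩ := Metric.mem_nhds_iff.1 hG
  obtain ⟨r₃, hr₃, hr3⟩ := Metric.mem_nhds_iff.1 hmem
  set A := standardCLM lam
  -- The last bound makes the quadratic error at most half of the lower bound `m * ‖x‖` for the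
  -- linear part.
  set r := min (min r₁ r₂) (min r₃ (m / (2 * (C + 1)))) with hr
  have hrpos : 0 < r := by positivity
  have hV' : ∀ x ∈ Metric.ball (0 : Rn n) r,
      ‖gradInChart f φ x - standardForm lam x‖ ≤ m / 2 * ‖x‖ := by
    intro x hx
    have hx' : ‖x‖ < r := by simpa using hx
    have h1 : ‖x‖ ≤ m / (2 * (C + 1)) := by
      refine hx'.le.trans ((min_le_right _ _).trans (min_le_right _ _))
    have h2 : C * ‖x‖ ≤ m / 2 := by
      rw [le_div_iff₀ (by positivity)] at h1
      nlinarith [norm_nonneg x]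
    calc _ ≤ C * ‖x‖ ^ 2 := hVC x (hx'.trans_le ((min_le_left _ _).trans (min_le_left _ _)))
      _ = C * ‖x‖ * ‖x‖ := by ring
      _ ≤ _ := by gcongr
  refine ⟨r, hrpos, a * (m / 2) ^ 2, by positivity, m / 2 + ‖A‖, by positivity,
    fun x hx => hr3 (Metric.ball_subset_ball ((min_le_right _ _).trans (min_le_left _ _)) hx),
    fun x hx => ?_, fun x hx => ?_⟩
  · have hxt : x ∈ φ.target :=
      hr3 (Metric.ball_subset_ball ((min_le_right _ _).trans (min_le_left _ _)) hx)
    rw [← metricInChart_gradInChart hf hφ.1 hxt]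
    set v := gradInChart f φ x
    have h3 : a * ‖v‖ ^ 2 ≤ metricInChart φ x v v :=
      hG2 (Metric.ball_subset_ball ((min_le_left _ _).trans (min_le_right _ _)) hx) v
    have h5 : m / 2 * ‖x‖ ≤ ‖v‖ := by
      have h6 := hV' x hx
      have h7 := hstd x
      have h8 := norm_sub_norm_le (standardForm lam x) (standardForm lam x - v)
      rw [sub_sub_cancel, norm_sub_rev] at h8
      linarith
    have h6 : (m / 2 * ‖x‖) ^ 2 ≤ ‖v‖ ^ 2 := by gcongr
    calc a * (m / 2) ^ 2 * ‖x‖ ^ 2 = a * (m / 2 * ‖x‖) ^ 2 := by ring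
      _ ≤ a * ‖v‖ ^ 2 := by gcongr
      _ ≤ _ := h3
  · have h1 := hV' x hx
    have h2 := A.le_opNorm x
    rw [standardCLM_apply] at h2
    have h3 := norm_le_norm_add_norm_sub' (gradInChart f φ x) (standardForm lam x)
    linarith

/-- The derivative of `f` along the curve is minus the squared norm of the gradient. -/
theorem antitoneOn_comp_integralCurve (hf : ContMDiff 𝓘(ℝ, Rn n) 𝓘(ℝ, ℝ) ∞ f) {γ : ℝ → X}
    (hγ : IsMIntegralCurveOn (I := 𝓘(ℝ, Rn n)) γ (fun y => -grad n f y) (Ici 0)) :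
    AntitoneOn (f ∘ γ) (Ici 0) := by
  have hd : ∀ t ∈ Ici (0 : ℝ), HasDerivWithinAt (f ∘ γ)
      (-@inner ℝ (TSp n (γ t)) _ (grad n f (γ t)) (grad n f (γ t))) (Ici 0) t := by
    intro t ht
    have h := (hf.mdifferentiableAt (x := γ t) (by simp)).hasMFDerivAt.comp_hasMFDerivWithinAt t
      (hγ t ht)
    have h1 : HasFDerivWithinAt (f ∘ γ) _ (Ici 0) t :=
      hasMFDerivWithinAt_iff_hasFDerivWithinAt.1 h
    refine hasDerivWithinAt_iff_hasFDerivWithinAt.2 (h1.congr_fderiv ?_)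
    refine ContinuousLinearMap.ext_ring ?_
    have h2 : mfderiv 𝓘(ℝ, Rn n) 𝓘(ℝ, ℝ) f (γ t) ((1 : ℝ) • -grad n f (γ t)) =
        -@inner ℝ (TSp n (γ t)) _ (grad n f (γ t)) (grad n f (γ t)) := by
      rw [one_smul, map_neg]
      exact congrArg Neg.neg (inner_sharp n (γ t) _ _).symm
    exact h2.trans (one_smul ℝ _).symm
  exact antitoneOn_of_hasDerivWithinAt_nonpos (convex_Ici 0)
    (fun t ht => (hd t ht).continuousWithinAt)
    (fun t ht => (hd t (interior_subset ht)).mono interior_subset)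
    fun t _ => neg_nonpos.2 real_inner_self_nonneg

/-- Near `p`, the stable manifold consists of the points whose forward orbit stays close
to `p`. -/
theorem exists_mem_stableManifold_iff [T2Space X] (hf : ContMDiff 𝓘(ℝ, Rn n) 𝓘(ℝ, ℝ) ∞ f)
    (hφ : IsCentredChart φ p) {lam : Fin n → ℝ} (hlam : ∀ i, lam i ≠ 0)
    (hV : (fun x => gradInChart f φ x - standardForm lam x) =O[𝓝 0] fun x => ‖x‖ ^ 2) :
    ∃ ρ₀ > 0, ∀ ρ > 0, ρ ≤ ρ₀ → ∃ δ > 0, ∀ x₀ ∈ Metric.ball (0 : Rn n) δ,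
      (φ.symm x₀ ∈ stableManifold n f p ↔ ∃ x : ℝ → Rn n, x 0 = x₀ ∧ ∀ t, 0 ≤ t →
        ‖x t‖ < ρ ∧ HasDerivWithinAt x (-gradInChart f φ (x t)) (Ici 0) t) := by
  obtain ⟨r, hr, c, hc, M, hM, hrt, hcu, hMV⟩ := exists_coercive hf hφ hlam hV
  have hu : ∀ x ∈ Metric.ball (0 : Rn n) r, DifferentiableAt ℝ (f ∘ φ.symm) x := fun x hx =>
    ((contDiffOn_comp_symm hf hφ.1).contDiffAt
      (φ.open_target.mem_nhds (hrt hx))).differentiableAt (by simp)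
  refine ⟨r / 2, half_pos hr, fun ρ hρ hρr => ?_⟩
  set κ := c / (2 * M) with hκ
  have hκ0 : 0 < κ := by positivity
  have hκM : 2 * κ * M ≤ c := le_of_eq (by rw [hκ]; field_simp)
  set L : Rn n → ℝ := fun x => (f ∘ φ.symm) x + κ * ‖x‖ ^ 2 with hL
  have hLc : ContinuousOn L (Metric.ball 0 r) := fun x hx =>
    ((hu x hx).continuousAt.add (by fun_prop)).continuousWithinAt
  have hL0 : L 0 = f p := by simp [hL, hφ.symm_zero]
  have hLρ : L 0 < f p + κ * (ρ / 2) ^ 2 := by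
    rw [hL0]
    exact lt_add_of_pos_right _ (by positivity)
  obtain ⟨δ₁, hδ₁, hLδ⟩ := Metric.mem_nhds_iff.1
    ((hLc.continuousAt (Metric.ball_mem_nhds 0 hr)).eventually
      (gt_mem_nhds hLρ))
  refine ⟨min δ₁ (ρ / 2), by positivity, fun x₀ hx₀ => ⟨?_, ?_⟩⟩
  · rintro ⟨γ, hγ0, hγ, hγp⟩
    have hx₀L : L x₀ < f p + κ * (ρ / 2) ^ 2 :=
      hLδ (Metric.ball_subset_ball (min_le_left _ _) hx₀)
    have hx₀ρ : ‖x₀‖ < ρ / 2 := by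
      simpa using Metric.ball_subset_ball (min_le_right _ _) hx₀
    have hballs : Metric.closedBall (0 : Rn n) (ρ / 2) ⊆ Metric.ball 0 r :=
      Metric.closedBall_subset_ball (by linarith)
    have hx₀t : x₀ ∈ φ.target := hrt (hballs (by simpa using hx₀ρ.le))
    have hγc : ContinuousOn γ (Ici 0) := fun t ht => (hγ t ht).continuousWithinAt
    have hanti := antitoneOn_comp_integralCurve hf hγ
    have hfp : ∀ t, 0 ≤ t → f p ≤ f (γ t) := by
      intro t ht
      refine le_of_tendsto ((hf.continuous.tendsto p).comp hγp) ?_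
      filter_upwards [eventually_ge_atTop t] with s hs
      exact hanti ht (ht.trans hs) hs
    -- The trap. Along the orbit `f ≥ f p`, so on this sublevel set of `L` the norm is automatically
    -- strictly below `ρ / 2`, and the orbit cannot leave through the sphere.
    set K : Set (Rn n) := Metric.closedBall 0 (ρ / 2) ∩ L ⁻¹' Iic (L x₀) with hK
    have hKc : IsCompact K := by
      refine (isCompact_closedBall (0 : Rn n) (ρ / 2)).of_isClosed_subset ?_ inter_subset_left
      exact (hLc.mono hballs).preimage_isClosed_of_isClosed Metric.isClosed_closedBall isClosed_Iic
    have hKt : K ⊆ φ.target := fun x hx => hrt (hballs hx.1)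
    -- The Hausdorff property enters here. Closedness in `X`, not just in the chart, is what the
    -- continuity argument in `t` needs.
    have hKX : IsClosed (φ.symm '' K) :=
      (hKc.image_of_continuousOn (φ.continuousOn_symm.mono hKt)).isClosed
    have hstep : ∀ t, 0 ≤ t → γ t ∈ φ.symm '' K →
        γ t ∈ φ.source ∧ ‖φ (γ t)‖ < ρ / 2 ∧ L (φ (γ t)) ≤ L x₀ := by
      rintro t ht ⟨x, hx, hxγ⟩
      have h1 := hfp t ht
      rw [← hxγ] at h1 ⊢
      rw [φ.right_inv (hKt hx)]
      refine ⟨φ.map_target (hKt hx), ?_, hx.2⟩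
      have h2 : L x ≤ L x₀ := hx.2
      have h3 : κ * ‖x‖ ^ 2 < κ * (ρ / 2) ^ 2 := by
        have : L x = f (φ.symm x) + κ * ‖x‖ ^ 2 := rfl
        linarith
      exact lt_of_pow_lt_pow_left₀ 2 (by positivity) (lt_of_mul_lt_mul_left h3 hκ0.le)
    have hmain : ∀ b, 0 ≤ b → γ b ∈ φ.symm '' K := by
      intro b hb
      have hclosed : IsClosed (γ ⁻¹' (φ.symm '' K) ∩ Icc 0 b) := by
        rw [inter_comm]
        exact (hγc.mono Icc_subset_Ici_self).preimage_isClosed_of_isClosed isClosed_Icc hKX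
      refine hclosed.Icc_subset_of_forall_mem_nhdsWithin ?_ ?_ (right_mem_Icc.2 hb)
      · exact ⟨x₀, ⟨by simpa using hx₀ρ.le, mem_preimage.2 (mem_Iic.2 le_rfl)⟩, hγ0.symm⟩
      · rintro t ⟨htK, ht0, -⟩
        obtain ⟨h1, h2, h3⟩ := hstep t ht0 htK
        have hO : φ.source ∩ φ ⁻¹' Metric.ball 0 (ρ / 2) ∈ 𝓝 (γ t) :=
          (φ.isOpen_inter_preimage Metric.isOpen_ball).mem_nhds ⟨h1, by simpa using h2⟩
        have h4 : ∀ᶠ s in 𝓝[Ici t] t, γ s ∈ φ.source ∩ φ ⁻¹' Metric.ball 0 (ρ / 2) :=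
          ((hγc t ht0).mono (Ici_subset_Ici.2 ht0)).eventually hO
        obtain ⟨s₀, hs₀, hs₀'⟩ := mem_nhdsGE_iff_exists_Icc_subset.1 h4
        -- On a short interval after `t` the orbit remains in the chart ball, so `L` keeps
        -- decreasing and the sublevel condition persists.
        refine mem_nhdsWithin.2 ⟨Iio s₀, isOpen_Iio, hs₀, fun s ⟨hs1, hs2⟩ => ?_⟩
        have hts : t < s := hs2
        have hss : s < s₀ := hs1
        have hantiL := antitoneOn_lyapunov hu hcu hMV hκ0.le hκM (convex_Icc t s₀) (x := φ ∘ γ)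
          (fun τ hτ => hballs (Metric.ball_subset_closedBall (hs₀' hτ).2))
          fun τ hτ => (hasDerivWithinAt_chart_comp hφ.1 (hγ τ (ht0.trans hτ.1))
            (hs₀' hτ).1).mono (Icc_subset_Ici_self.trans (Ici_subset_Ici.2 ht0))
        have h5 := hs₀' ⟨hts.le, hss.le⟩
        exact ⟨φ (γ s), ⟨Metric.ball_subset_closedBall h5.2,
          (hantiL ⟨le_rfl, hts.le.trans hss.le⟩ ⟨hts.le, hss.le⟩ hts.le).trans h3⟩,
          φ.left_inv h5.1⟩
    refine ⟨φ ∘ γ, by simp [hγ0, φ.right_inv hx₀t], fun t ht => ?_⟩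
    obtain ⟨h1, h2, -⟩ := hstep t ht (hmain t ht)
    exact ⟨h2.trans (half_lt_self hρ), hasDerivWithinAt_chart_comp hφ.1 (hγ t ht) h1⟩
  · rintro ⟨x, hx0, hx⟩
    have hρr' : ρ < r := by linarith
    have hxt : ∀ t, 0 ≤ t → x t ∈ φ.target := fun t ht =>
      hrt (by simpa using (hx t ht).1.trans hρr')
    refine ⟨φ.symm ∘ x, congrArg φ.symm hx0, fun t ht =>
      hasMFDerivWithinAt_symm_comp hφ.1 (hx t ht).2 (hxt t ht), ?_⟩
    have hlim := tendsto_zero_of_lyapunov hu hcu hMV hc hM hρr' hx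
    have h1 : Tendsto φ.symm (𝓝 0) (𝓝 p) := by
      have := φ.continuousAt_symm hφ.zero_mem_target
      rwa [ContinuousAt, hφ.symm_zero] at this
    exact h1.comp hlim

end StableManifold

/-! ### Time reversal. -/

section Reversal

set_option linter.unusedSectionVars false

variable {n : ℕ} {X : Type*} [TopologicalSpace X] [ChartedSpace (Rn n) X]
  [RiemannianBundle (fun x : X => TangentSpace 𝓘(ℝ, Rn n) x)]
  {φ : OpenPartialHomeomorph X (Rn n)} {f : X → ℝ} {p : X}

theorem grad_neg (hf : ContMDiff 𝓘(ℝ, Rn n) 𝓘(ℝ, ℝ) ∞ f) (x : X) :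
    grad n (-f) x = -grad n f x := by
  refine ext_inner_right ℝ fun v => ?_
  rw [inner_neg_left]
  refine (inner_sharp n x _ v).trans (Eq.trans ?_ (congrArg Neg.neg (inner_sharp n x _ v)).symm)
  have h := ((hf.mdifferentiableAt (x := x) (by simp)).hasMFDerivAt).neg
  rw [h.mfderiv]
  rfl

theorem gradInChart_neg (hf : ContMDiff 𝓘(ℝ, Rn n) 𝓘(ℝ, ℝ) ∞ f) (x : Rn n) :
    gradInChart (-f) φ x = -gradInChart f φ x := by
  rw [gradInChart, gradInChart, VectorField.mpullback_apply, VectorField.mpullback_apply,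
    grad_neg hf]
  exact map_neg _ _

/-- Reversing time exchanges the stable and the unstable manifold. -/
theorem unstableManifold_eq (hf : ContMDiff 𝓘(ℝ, Rn n) 𝓘(ℝ, ℝ) ∞ f) :
    unstableManifold n f p = stableManifold n (-f) p := by
  have h1 : (fun y => -grad n (-f) y) = (-1 : ℝ) • fun y => -grad n f y := by
    funext y
    simp [grad_neg hf]
  have h2 : (fun y => -grad n f y) = (-1 : ℝ) • fun y => -grad n (-f) y := by
    funext y
    simp [grad_neg hf]
  have hs : {t : ℝ | t * -1 ∈ Iic 0} = Ici 0 := by ext; simp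
  have hs' : {t : ℝ | t * -1 ∈ Ici 0} = Iic 0 := by ext; simp
  ext x
  constructor
  · rintro ⟨γ, h0, hγ, hp⟩
    refine ⟨γ ∘ fun t => t * -1, by simp [h0], ?_, hp.comp ?_⟩
    · rw [h1, ← hs]
      exact hγ.comp_mul (-1)
    · simpa using tendsto_neg_atTop_atBot
  · rintro ⟨γ, h0, hγ, hp⟩
    refine ⟨γ ∘ fun t => t * -1, by simp [h0], ?_, hp.comp ?_⟩
    · rw [h2, ← hs']
      exact hγ.comp_mul (-1)
    · simpa using tendsto_neg_atBot_atTop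

end Reversal

/-! ### Stable and unstable manifolds as flat graphs in a chart. -/

section Graphs

set_option linter.unusedSectionVars false

variable {n : ℕ} {lam : Fin n → ℝ}

theorem standardForm_neg (lam : Fin n → ℝ) (x : Rn n) :
    standardForm (fun i => -lam i) x = -standardForm lam x := by
  ext i
  simp [standardForm]

/-- Changing the signs of the eigenvalues exchanges the stable and unstable directions; nonzero
eigenvalues make the two projections complementary. -/
theorem posPart_neg (hlam : ∀ i, lam i ≠ 0) (x : Rn n) :
    posPart (fun i => -lam i) x = x - posPart lam x := by
  ext i
  rw [PiLp.sub_apply, posPart_apply, posPart_apply]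
  rcases lt_or_gt_of_ne (hlam i) with h | h
  · simp [h, h.not_gt]
  · simp [h, h.not_gt]

variable {X : Type*} [TopologicalSpace X] [ChartedSpace (Rn n) X]
  [RiemannianBundle (fun x : X => TangentSpace 𝓘(ℝ, Rn n) x)] [IsManifold 𝓘(ℝ, Rn n) ∞ X]
  [IsContMDiffRiemannianBundle 𝓘(ℝ, Rn n) ∞ (Rn n)
      (fun x : X => TangentSpace 𝓘(ℝ, Rn n) x)] [T2Space X]
  {φ : OpenPartialHomeomorph X (Rn n)} {f : X → ℝ} {p : X}

/-- In a chart in which the gradient is standard up to a flat error, the stable manifold is the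
graph of a flat map. -/
theorem exists_graph_stableManifold (hf : ContMDiff 𝓘(ℝ, Rn n) 𝓘(ℝ, ℝ) ∞ f)
    (hφ : IsCentredChart φ p) (hlam : ∀ i, lam i ≠ 0)
    (hV : IsFlatBigO fun x => gradInChart f φ x - standardForm lam x) :
    ∃ δ > 0, ∃ η : Rn n → Rn n, Metric.ball 0 δ ⊆ φ.target ∧
      ContDiffOn ℝ ∞ η (Metric.ball 0 δ) ∧ IsFlatBigO η ∧
      (∀ x, posPart lam (η x) = 0) ∧ (∀ x, η (posPart lam x) = η x) ∧
      ∀ x ∈ Metric.ball (0 : Rn n) δ,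
        φ.symm x ∈ stableManifold n f p ↔ x - posPart lam x = η x := by
  have hmem := φ.open_target.mem_nhds hφ.zero_mem_target
  obtain ⟨ρ₀, hρ₀, H⟩ := exists_mem_stableManifold_iff hf hφ hlam (hV 2)
  obtain ⟨ρ, hρ, hρρ₀, δ, hδ, η, hη, hηf, hη0, hηp, hiff⟩ :=
    exists_local_stable_graph hlam hmem (contDiffOn_gradInChart hf hφ.1) hV hρ₀
  obtain ⟨δ', hδ', H'⟩ := H ρ hρ hρρ₀
  obtain ⟨r, hr, hrt⟩ := Metric.mem_nhds_iff.1 hmem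
  refine ⟨min δ (min δ' r), by positivity, η, ?_, ?_, hηf, hη0, hηp, fun x hx => ?_⟩
  · exact (Metric.ball_subset_ball ((min_le_right _ _).trans (min_le_right _ _))).trans hrt
  · exact hη.mono (Metric.ball_subset_ball (min_le_left _ _))
  · rw [H' x (Metric.ball_subset_ball ((min_le_right _ _).trans (min_le_left _ _)) hx),
      hiff x (Metric.ball_subset_ball (min_le_left _ _) hx)]

/-- In a chart in which the gradient is standard up to a flat error, the unstable manifold is the
graph of a flat map. -/
theorem exists_graph_unstableManifold (hf : ContMDiff 𝓘(ℝ, Rn n) 𝓘(ℝ, ℝ) ∞ f)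
    (hφ : IsCentredChart φ p) (hlam : ∀ i, lam i ≠ 0)
    (hV : IsFlatBigO fun x => gradInChart f φ x - standardForm lam x) :
    ∃ δ > 0, ∃ η : Rn n → Rn n, Metric.ball 0 δ ⊆ φ.target ∧
      ContDiffOn ℝ ∞ η (Metric.ball 0 δ) ∧ IsFlatBigO η ∧
      (∀ x, posPart lam (η x) = η x) ∧ (∀ x, η (x - posPart lam x) = η x) ∧
      ∀ x ∈ Metric.ball (0 : Rn n) δ,
        φ.symm x ∈ unstableManifold n f p ↔ posPart lam x = η x := by
  have hV' : IsFlatBigO fun x => gradInChart (-f) φ x - standardForm (fun i => -lam i) x := by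
    intro N
    have h : (fun x => gradInChart (-f) φ x - standardForm (fun i => -lam i) x) =
        fun x => -(gradInChart f φ x - standardForm lam x) := by
      funext x
      rw [gradInChart_neg hf, standardForm_neg]
      abel
    rw [h]
    exact (hV N).neg_left
  obtain ⟨δ, hδ, η, ht, hη, hηf, hη0, hηp, hiff⟩ :=
    exists_graph_stableManifold (f := -f) hf.neg hφ (fun i => neg_ne_zero.2 (hlam i)) hV'
  refine ⟨δ, hδ, η, ht, hη, hηf, fun x => ?_, fun x => ?_, fun x hx => ?_⟩
  · have := hη0 x
    rw [posPart_neg hlam, sub_eq_zero] at this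
    exact this.symm
  · rw [← posPart_neg hlam, hηp]
  · rw [unstableManifold_eq hf, hiff x hx, posPart_neg hlam, sub_sub_cancel]

end Graphs

/-! ### Splitting the coordinates into the first `k` and the last `n - k`. -/

section Coordinates

variable {n k : ℕ}

/-- The inclusion of `ℝᵏ` as the first coordinate plane. -/
noncomputable def inFirst (n k : ℕ) : Rn k →L[ℝ] Rn n :=
  LinearMap.toContinuousLinearMap
    { toFun := fun a => joinCoords (n := n) a 0
      map_add' := fun a b => by ext i; by_cases h : (i : ℕ) < k <;> simp [joinCoords, h]
      map_smul' := fun c a => by ext i; by_cases h : (i : ℕ) < k <;> simp [joinCoords, h] }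

/-- The inclusion of `ℝⁿ⁻ᵏ` as the last coordinate plane. -/
noncomputable def inLast (n k : ℕ) : Rn (n - k) →L[ℝ] Rn n :=
  LinearMap.toContinuousLinearMap
    { toFun := fun b => joinCoords (n := n) (k := k) 0 b
      map_add' := fun a b => by ext i; by_cases h : (i : ℕ) < k <;> simp [joinCoords, h]
      map_smul' := fun c a => by ext i; by_cases h : (i : ℕ) < k <;> simp [joinCoords, h] }

/-- The first `k` coordinates. -/
noncomputable def firstCoords (hk : k ≤ n) : Rn n →L[ℝ] Rn k :=
  LinearMap.toContinuousLinearMap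
    { toFun := fun x => WithLp.toLp 2 fun j => x (Fin.castLE hk j)
      map_add' := fun a b => by ext i; simp
      map_smul' := fun c a => by ext i; simp }

/-- The last `n - k` coordinates. -/
noncomputable def lastCoords (hk : k ≤ n) : Rn n →L[ℝ] Rn (n - k) :=
  LinearMap.toContinuousLinearMap
    { toFun := fun x => WithLp.toLp 2 fun j => x ⟨k + j, by omega⟩
      map_add' := fun a b => by ext i; simp
      map_smul' := fun c a => by ext i; simp }

theorem inFirst_apply (a : Rn k) : inFirst n k a = joinCoords a 0 := rfl

theorem inLast_apply (b : Rn (n - k)) : inLast n k b = joinCoords 0 b := rfl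

theorem joinCoords_eq_add (a : Rn k) (b : Rn (n - k)) :
    joinCoords a b = inFirst n k a + inLast n k b := by
  ext i
  by_cases h : (i : ℕ) < k <;> simp [inFirst_apply, inLast_apply, joinCoords, h]

theorem firstCoords_inFirst (hk : k ≤ n) (a : Rn k) : firstCoords hk (inFirst n k a) = a := by
  ext j
  change joinCoords (n := n) a 0 (Fin.castLE hk j) = a j
  simp [joinCoords]

theorem lastCoords_inLast (hk : k ≤ n) (b : Rn (n - k)) : lastCoords hk (inLast n k b) = b := by
  ext j
  change joinCoords (n := n) (k := k) 0 b ⟨k + j, _⟩ = b j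
  simp [joinCoords]

theorem inFirst_firstCoords (hk : k ≤ n) {x : Rn n} (hx : ∀ i : Fin n, k ≤ i → x i = 0) :
    inFirst n k (firstCoords hk x) = x := by
  ext i
  by_cases h : (i : ℕ) < k
  · simp only [inFirst_apply, joinCoords, h, dite_true]
    rfl
  · simp [inFirst_apply, joinCoords, h, hx i (not_lt.1 h)]

theorem inLast_lastCoords (hk : k ≤ n) {x : Rn n} (hx : ∀ i : Fin n, (i : ℕ) < k → x i = 0) :
    inLast n k (lastCoords hk x) = x := by
  ext i
  by_cases h : (i : ℕ) < k
  · simp [inLast_apply, joinCoords, h, hx i h]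
  · simp only [inLast_apply, joinCoords, h, dite_false]
    exact congrArg x (Fin.ext (by simp only; omega))

variable {lam : Fin n → ℝ}

theorem posPart_eq_zero_iff_mem_firstPlane (hneg : ∀ i : Fin n, (i : ℕ) < k → lam i < 0)
    (hpos : ∀ i : Fin n, k ≤ (i : ℕ) → 0 < lam i) (x : Rn n) :
    posPart lam x = 0 ↔ x ∈ firstPlane n k := by
  constructor
  · intro h i hi
    have := congrArg (fun y : Rn n => y i) h
    simpa [posPart_apply, hpos i hi] using this
  · intro h
    ext i
    rw [posPart_apply]
    split_ifs with hi
    · exact h i (not_lt.1 fun hik => (hneg i hik).not_gt hi)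
    · rfl

theorem posPart_eq_self_iff_mem_lastPlane (hneg : ∀ i : Fin n, (i : ℕ) < k → lam i < 0)
    (hpos : ∀ i : Fin n, k ≤ (i : ℕ) → 0 < lam i) (x : Rn n) :
    posPart lam x = x ↔ x ∈ lastPlane n k := by
  constructor
  · intro h i hi
    rw [← h, posPart_apply, if_neg (hneg i hi).not_gt]
  · intro h
    ext i
    rw [posPart_apply]
    split_ifs with hi
    · rfl
    · exact (h i (not_le.1 fun hik => hi (hpos i hik))).symm

theorem posPart_joinCoords (hneg : ∀ i : Fin n, (i : ℕ) < k → lam i < 0)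
    (hpos : ∀ i : Fin n, k ≤ (i : ℕ) → 0 < lam i) (a : Rn k) (b : Rn (n - k)) :
    posPart lam (joinCoords a b) = inLast n k b := by
  rw [joinCoords_eq_add, map_add, (posPart_eq_zero_iff_mem_firstPlane hneg hpos _).2,
    (posPart_eq_self_iff_mem_lastPlane hneg hpos _).2, zero_add]
  · intro i hi
    simp [inLast_apply, joinCoords, hi]
  · intro i hi
    simp [inFirst_apply, joinCoords, hi.not_gt]

end Coordinates

/-! ### Flatness under composition. -/

section FlatComposition

open Asymptotics

set_option linter.unusedSectionVars false

variable {E F G : Type*} [NormedAddCommGroup E] [NormedSpace ℝ E] [NormedAddCommGroup F]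
  [NormedSpace ℝ F] [NormedAddCommGroup G] [NormedSpace ℝ G]

theorem IsFlatBigO.comp_isBigO {η : F → G} (hη : IsFlatBigO η) {h : E → F}
    (h0 : Tendsto h (𝓝 0) (𝓝 0)) (hO : h =O[𝓝 0] fun x => ‖x‖) :
    IsFlatBigO fun x => η (h x) := fun N =>
  ((hη N).comp_tendsto h0).trans (hO.norm_left.pow N)

theorem IsFlatBigO.clm_comp {η : E → F} (hη : IsFlatBigO η) (A : F →L[ℝ] G) :
    IsFlatBigO fun x => A (η x) := fun N => (A.isBigO_comp η _).trans (hη N)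

theorem IsFlatBigO.comp_clm {η : F → G} (hη : IsFlatBigO η) (A : E →L[ℝ] F) :
    IsFlatBigO fun x => η (A x) :=
  hη.comp_isBigO (by simpa using A.continuous.tendsto 0) (A.isBigO_id _).norm_right

/-- Quadratic smallness gives `‖η x‖ ≤ ‖x‖` near 0. Having this for all small radii allows one
radius for two maps at once. -/
theorem IsFlatBigO.eventually_mapsTo_ball {η : E → F} (hη : IsFlatBigO η) :
    ∃ r₀ > 0, ∀ r > 0, r ≤ r₀ → MapsTo η (Metric.ball 0 r) (Metric.ball 0 r) := by
  obtain ⟨C, hC, r₁, hr₁, h⟩ := exists_bound_of_isBigO_norm_pow (hη 2)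
  refine ⟨min r₁ (C + 1)⁻¹, by positivity, fun r hr hrr x hx => ?_⟩
  have hx' : ‖x‖ < r := by simpa using hx
  have h1 : (C + 1) * ‖x‖ ≤ 1 := by
    have := (hx'.le.trans hrr).trans (min_le_right _ _)
    rwa [← one_div, le_div_iff₀' (by positivity)] at this
  have h2 := h x (hx'.trans_le (hrr.trans (min_le_left _ _)))
  have h3 : C * ‖x‖ ^ 2 ≤ ‖x‖ := by nlinarith [norm_nonneg x]
  simpa using (h2.trans h3).trans_lt hx'

end FlatComposition

/-! ### The graphs in split coordinates. -/

section FlatGraphs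

set_option linter.unusedSectionVars false

variable {n k : ℕ} {lam : Fin n → ℝ}
variable {X : Type*} [TopologicalSpace X] [ChartedSpace (Rn n) X]
  [RiemannianBundle (fun x : X => TangentSpace 𝓘(ℝ, Rn n) x)] [IsManifold 𝓘(ℝ, Rn n) ∞ X]
  [IsContMDiffRiemannianBundle 𝓘(ℝ, Rn n) ∞ (Rn n)
      (fun x : X => TangentSpace 𝓘(ℝ, Rn n) x)] [T2Space X]
  {φ : OpenPartialHomeomorph X (Rn n)} {f : X → ℝ} {p : X}

theorem exists_flat_graphs (hk : k ≤ n) (hf : ContMDiff 𝓘(ℝ, Rn n) 𝓘(ℝ, ℝ) ∞ f)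
    (hφ : IsCentredChart φ p) (hneg : ∀ i : Fin n, (i : ℕ) < k → lam i < 0)
    (hpos : ∀ i : Fin n, k ≤ (i : ℕ) → 0 < lam i)
    (hV : IsFlatBigO fun x => gradInChart f φ x - standardForm lam x) :
    ∃ (A : Set (Rn k)) (B : Set (Rn (n - k))) (Y : Rn k → Rn (n - k)) (Z : Rn (n - k) → Rn k),
      IsOpen A ∧ 0 ∈ A ∧ IsOpen B ∧ 0 ∈ B ∧
      (∀ a ∈ A, ∀ b ∈ B, joinCoords (n := n) a b ∈ φ.target) ∧
      ContDiffOn ℝ ∞ Y A ∧ MapsTo Y A B ∧ ContDiffOn ℝ ∞ Z B ∧ MapsTo Z B A ∧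
      (∀ a ∈ A, ∀ b ∈ B, φ.symm (joinCoords a b) ∈ unstableManifold n f p ↔ b = Y a) ∧
      (∀ a ∈ A, ∀ b ∈ B, φ.symm (joinCoords a b) ∈ stableManifold n f p ↔ a = Z b) ∧
      IsFlatAt Y 0 ∧ IsFlatAt Z 0 := by
  have hlam : ∀ i, lam i ≠ 0 := fun i => (lt_or_ge (i : ℕ) k).elim
    (fun h => (hneg i h).ne) fun h => (hpos i h).ne'
  obtain ⟨δs, hδs, ηs, hst, hηs, hηsf, hηs0, hηsp, hs⟩ := exists_graph_stableManifold hf hφ hlam hV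
  obtain ⟨δu, hδu, ηu, -, hηu, hηuf, hηu0, hηup, hu⟩ :=
    exists_graph_unstableManifold hf hφ hlam hV
  set Y : Rn k → Rn (n - k) := fun a => lastCoords hk (ηu (inFirst n k a))
  set Z : Rn (n - k) → Rn k := fun b => firstCoords hk (ηs (inLast n k b))
  have hYf : IsFlatBigO Y := (hηuf.comp_clm (inFirst n k)).clm_comp (lastCoords hk)
  have hZf : IsFlatBigO Z := (hηsf.comp_clm (inLast n k)).clm_comp (firstCoords hk)
  obtain ⟨r₁, hr₁, hY⟩ := hYf.eventually_mapsTo_ball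
  obtain ⟨r₂, hr₂, hZ⟩ := hZf.eventually_mapsTo_ball
  have hjoin : ∀ᶠ q : Rn k × Rn (n - k) in 𝓝 (0, 0),
      inFirst n k q.1 + inLast n k q.2 ∈ Metric.ball (0 : Rn n) (min δs δu) := by
    have hc : Continuous fun q : Rn k × Rn (n - k) => inFirst n k q.1 + inLast n k q.2 := by
      fun_prop
    refine hc.continuousAt.eventually (Metric.isOpen_ball.mem_nhds ?_)
    simp [hδs, hδu]
  obtain ⟨r₃, hr₃, hr⟩ := Metric.eventually_nhds_iff.1 hjoin
  -- A single radius for both balls, so that `Y` maps the first into the second and `Z` the second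
  -- into the first.
  set r := min (min r₁ r₂) r₃
  have hr0 : 0 < r := by positivity
  have hmem : ∀ a ∈ Metric.ball (0 : Rn k) r, ∀ b ∈ Metric.ball (0 : Rn (n - k)) r,
      joinCoords a b ∈ Metric.ball (0 : Rn n) (min δs δu) := by
    intro a ha b hb
    rw [joinCoords_eq_add]
    exact hr (y := (a, b)) (max_lt (lt_of_lt_of_le ha (min_le_right _ _))
      (lt_of_lt_of_le hb (min_le_right _ _)))
  have hA : (0 : Rn k) ∈ Metric.ball (0 : Rn k) r := Metric.mem_ball_self hr0
  have hB : (0 : Rn (n - k)) ∈ Metric.ball (0 : Rn (n - k)) r := Metric.mem_ball_self hr0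
  have hYc : ContDiffOn ℝ ∞ Y (Metric.ball 0 r) :=
    (lastCoords hk).contDiff.comp_contDiffOn (hηu.comp (inFirst n k).contDiff.contDiffOn
      fun a ha => Metric.ball_subset_ball (min_le_right _ _) (hmem a ha 0 hB))
  have hZc : ContDiffOn ℝ ∞ Z (Metric.ball 0 r) :=
    (firstCoords hk).contDiff.comp_contDiffOn (hηs.comp (inLast n k).contDiff.contDiffOn
      fun b hb => Metric.ball_subset_ball (min_le_left _ _) (hmem 0 hA b hb))
  refine ⟨Metric.ball 0 r, Metric.ball 0 r, Y, Z, Metric.isOpen_ball, hA, Metric.isOpen_ball, hB,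
    fun a ha b hb => hst (Metric.ball_subset_ball (min_le_left _ _) (hmem a ha b hb)), hYc,
    hY r hr0 ((min_le_left _ _).trans (min_le_left _ _)), hZc,
    hZ r hr0 ((min_le_left _ _).trans (min_le_right _ _)), fun a ha b hb => ?_,
    fun a ha b hb => ?_, hYf.isFlatAt (hYc.contDiffAt (Metric.isOpen_ball.mem_nhds hA)),
    hZf.isFlatAt (hZc.contDiffAt (Metric.isOpen_ball.mem_nhds hB))⟩
  -- The graph equation becomes `inLast n k b = ηu (inFirst n k a)`. Its right-hand side lies in the
  -- last plane, so it is determined by its last coordinates, which are `Y a`.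
  · rw [hu _ (Metric.ball_subset_ball (min_le_right _ _) (hmem a ha b hb)), ← hηup,
      posPart_joinCoords hneg hpos, joinCoords_eq_add, add_sub_cancel_right]
    have h1 : inLast n k (Y a) = ηu (inFirst n k a) := inLast_lastCoords hk
      ((posPart_eq_self_iff_mem_lastPlane hneg hpos _).1 (hηu0 _))
    rw [← h1]
    exact (Function.LeftInverse.injective (lastCoords_inLast hk)).eq_iff
  · rw [hs _ (Metric.ball_subset_ball (min_le_left _ _) (hmem a ha b hb)), ← hηsp,
      posPart_joinCoords hneg hpos, joinCoords_eq_add, add_sub_cancel_right]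
    have h1 : inFirst n k (Z b) = ηs (inLast n k b) := inFirst_firstCoords hk
      ((posPart_eq_zero_iff_mem_firstPlane hneg hpos _).1 (hηs0 _))
    rw [← h1]
    exact (Function.LeftInverse.injective (firstCoords_inFirst hk)).eq_iff

end FlatGraphs

/-! ### Charts with flat error and straight invariant manifolds. -/

section StraightChart

open Asymptotics

set_option linter.unusedSectionVars false

variable {n k : ℕ} {lam : Fin n → ℝ}
variable {X : Type*} [TopologicalSpace X] [ChartedSpace (Rn n) X]
  [RiemannianBundle (fun x : X => TangentSpace 𝓘(ℝ, Rn n) x)] [IsManifold 𝓘(ℝ, Rn n) ∞ X]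
  {φ : OpenPartialHomeomorph X (Rn n)} {f : X → ℝ} {p : X}

theorem IsCentredChart.trans (hφ : IsCentredChart φ p) {e : OpenPartialHomeomorph (Rn n) (Rn n)}
    (he0 : 0 ∈ e.source) (he : e 0 = 0) (hes : ContDiffOn ℝ ∞ e e.source)
    (het : ContDiffOn ℝ ∞ e.symm e.target) : IsCentredChart (φ.trans e) p := by
  refine ⟨trans_mem_maximalAtlas hφ.1 hes het, ⟨hφ.2.1, ?_⟩, ?_⟩
  · change φ p ∈ e.source
    rwa [hφ.2.2]
  · rw [OpenPartialHomeomorph.coe_trans, Function.comp, hφ.2.2, he]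

/-- The transformed error is the given one composed with `e.symm`, which fixes the origin and is of
linear size there, so flatness survives. -/
theorem isFlatBigO_gradInChart_trans (hφ : IsCentredChart φ p)
    {e : OpenPartialHomeomorph (Rn n) (Rn n)} (he0 : 0 ∈ e.source) (he : e 0 = 0)
    (hes : ContDiffOn ℝ ∞ e e.source) (het : ContDiffOn ℝ ∞ e.symm e.target)
    (hflat : IsFlatBigO fun x => fderiv ℝ e x (gradInChart f φ x) - standardForm lam (e x)) :
    IsFlatBigO fun y => gradInChart f (φ.trans e) y - standardForm lam y := by
  have hcen := hφ.trans he0 he hes het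
  have h0t : (0 : Rn n) ∈ e.target := by simpa [he] using e.map_source he0
  have hs0 : e.symm 0 = 0 := by rw [← he, e.left_inv he0, he]
  have hd : DifferentiableAt ℝ e.symm 0 :=
    (het.contDiffAt (e.open_target.mem_nhds h0t)).differentiableAt (by simp)
  have hO : e.symm =O[𝓝 0] fun y : Rn n => ‖y‖ := by
    simpa [hs0] using hd.isBigO_sub.norm_right
  have hten : Tendsto e.symm (𝓝 0) (𝓝 0) := by simpa [hs0] using hd.continuousAt.tendsto
  intro N
  refine (hflat.comp_isBigO hten hO N).congr' ?_ EventuallyEq.rfl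
  filter_upwards [(φ.trans e).open_target.mem_nhds hcen.zero_mem_target] with y hy
  rw [gradInChart_trans hφ.1 hes het hy, e.right_inv hy.1]

variable [IsContMDiffRiemannianBundle 𝓘(ℝ, Rn n) ∞ (Rn n)
      (fun x : X => TangentSpace 𝓘(ℝ, Rn n) x)]

theorem IsCentredChart.contDiffAt_gradInChart_sub (hφ : IsCentredChart φ p)
    (hf : ContMDiff 𝓘(ℝ, Rn n) 𝓘(ℝ, ℝ) ∞ f) (lam : Fin n → ℝ) :
    ContDiffAt ℝ ∞ (fun x => gradInChart f φ x - standardForm lam x) 0 := by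
  simp only [← standardCLM_apply]
  exact ((contDiffOn_gradInChart hf hφ.1).contDiffAt
    (φ.open_target.mem_nhds hφ.zero_mem_target)).sub (standardCLM lam).contDiff.contDiffAt

/-- The difference and its first derivative both vanish at the origin. -/
theorem isBigO_gradInChart_sub (hf : ContMDiff 𝓘(ℝ, Rn n) 𝓘(ℝ, ℝ) ∞ f)
    (hp : IsCritical n f p) (hφ : IsCentredChart φ p)
    (hd : ∀ v, fderiv ℝ (gradInChart f φ) 0 v = standardForm lam v) :
    (fun x => gradInChart f φ x - standardForm lam x) =O[𝓝 0] fun x => ‖x‖ ^ 2 := by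
  have hG := hφ.contDiffAt_gradInChart_sub hf lam
  refine isBigO_norm_pow_of_fderiv (hG.of_le (by simp)) ?_ (N := 1) ?_
  · rw [← standardCLM_apply, map_zero, sub_zero]
    simpa [hφ.2.2] using gradInChart_apply_of_isCritical hφ.1 hφ.2.1 hp
  · have h1 : fderiv ℝ (fun x => gradInChart f φ x - standardForm lam x) 0 = 0 := by
      simp only [← standardCLM_apply]
      rw [fderiv_fun_sub (((contDiffOn_gradInChart hf hφ.1).contDiffAt
        (φ.open_target.mem_nhds hφ.zero_mem_target)).differentiableAt (by simp))
        (standardCLM lam).differentiableAt, (standardCLM lam).fderiv]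
      ext v : 1
      rw [sub_apply, hd, standardCLM_apply, sub_self]
      rfl
    have h2 : DifferentiableAt ℝ (fderiv ℝ fun x => gradInChart f φ x - standardForm lam x) 0 :=
      (hG.fderiv_right (m := 1) (WithTop.coe_le_coe.2 (le_top (a := (2 : ℕ∞))))).differentiableAt (by simp)
    simpa [h1] using h2.isBigO_sub.norm_right

/-- Under the `ℕ`-linearity condition, the gradient is standard up to a flat error in a suitable
chart. -/
theorem exists_flat_chart (hf : ContMDiff 𝓘(ℝ, Rn n) 𝓘(ℝ, ℝ) ∞ f) (hp : IsCritical n f p)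
    (hlam : IsMorseEigenvalues n f p lam) (hN : NLinearity lam) :
    ∃ φ : OpenPartialHomeomorph X (Rn n), IsCentredChart φ p ∧
      IsFlatBigO fun x => gradInChart f φ x - standardForm lam x := by
  obtain ⟨φ, hφ, hd⟩ := exists_isCentredChart_fderiv_gradInChart hf hp hlam
  have hmem := φ.open_target.mem_nhds hφ.zero_mem_target
  -- The formal linearization is stated for globally smooth fields; only the germ at the origin
  -- matters for flatness.
  obtain ⟨W, hW, -, r, hr, -, hWV⟩ :=
    exists_contDiff_hasCompactSupport_eq hmem (contDiffOn_gradInChart hf hφ.1)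
  have hWV' : ∀ᶠ x in 𝓝 (0 : Rn n), W x = gradInChart f φ x :=
    eventually_of_mem (Metric.ball_mem_nhds 0 hr) hWV
  obtain ⟨h, hh, hh0, hhd, hflat⟩ := exists_formal_linearization hN hW
    ((isBigO_gradInChart_sub hf hp hφ hd).congr' (by
      filter_upwards [hWV'] with x hx; rw [hx]) EventuallyEq.rfl)
  obtain ⟨e, he0, -, heh, hes, het⟩ := exists_smooth_local_inverse isOpen_univ (mem_univ (0 : Rn n))
    hh.contDiffOn (ContinuousLinearEquiv.refl ℝ (Rn n)) hhd
  have heh' : (e : Rn n → Rn n) = h := funext heh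
  have he : e 0 = 0 := by rw [heh, hh0]
  refine ⟨φ.trans e, hφ.trans he0 he hes het, isFlatBigO_gradInChart_trans hφ he0 he hes het ?_⟩
  intro N
  refine (hflat N).congr' ?_ EventuallyEq.rfl
  filter_upwards [hWV'] with x hx
  rw [heh', hx]

theorem IsFlatBigO.hasFDerivAt_zero {F : Type*} [NormedAddCommGroup F] [NormedSpace ℝ F]
    {η : Rn n → F} (hη : IsFlatBigO η) : HasFDerivAt η (0 : Rn n →L[ℝ] F) 0 := by
  rw [hasFDerivAt_iff_isLittleO_nhds_zero]
  have h := (hη 2).trans_isLittleO (isLittleO_norm_pow_id one_lt_two)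
  simpa [hη.apply_zero] using h

theorem IsFlatBigO.add {F : Type*} [NormedAddCommGroup F] {G H : Rn n → F} (hG : IsFlatBigO G)
    (hH : IsFlatBigO H) : IsFlatBigO fun x => G x + H x := fun N => (hG N).add (hH N)

/-- Subtracting a flat map from the coordinates keeps the gradient standard up to a flat error. -/
theorem isFlatBigO_fderiv_id_sub (hf : ContMDiff 𝓘(ℝ, Rn n) 𝓘(ℝ, ℝ) ∞ f)
    (hφ : IsCentredChart φ p) (hV : IsFlatBigO fun x => gradInChart f φ x - standardForm lam x)
    {σ : Rn n → Rn n} {δ : ℝ} (hδ : 0 < δ) (hσ : ContDiffOn ℝ ∞ σ (Metric.ball 0 δ))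
    (hσf : IsFlatBigO σ) :
    IsFlatBigO fun x => fderiv ℝ (fun x => x - σ x) x (gradInChart f φ x) -
      standardForm lam (x - σ x) := by
  have hball := Metric.ball_mem_nhds (0 : Rn n) hδ
  have hVc : ContinuousAt (gradInChart f φ) 0 := ((contDiffOn_gradInChart hf hφ.1).contDiffAt
    (φ.open_target.mem_nhds hφ.zero_mem_target)).continuousAt
  have h1 : IsFlatBigO fun x => fderiv ℝ σ x (gradInChart f φ x) := by
    intro N
    have h := (hσf.fderiv (hσ.contDiffAt hball) N).norm_left.mul (hVc.norm.isBigO_one ℝ)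
    simp only [mul_one] at h
    exact (IsBigO.of_norm_le fun x => (fderiv ℝ σ x).le_opNorm _).trans h
  have h2 : IsFlatBigO fun x => standardCLM lam (σ x) := hσf.clm_comp _
  intro N
  refine (((hV N).sub (h1 N)).add (h2 N)).congr' ?_ EventuallyEq.rfl
  filter_upwards [Metric.isOpen_ball.mem_nhds (Metric.mem_ball_self (x := (0 : Rn n)) hδ)]
    with x hx
  rw [fderiv_fun_sub differentiableAt_fun_id
    ((hσ.contDiffAt (Metric.isOpen_ball.mem_nhds hx)).differentiableAt (by simp)), fderiv_fun_id]
  simp only [← standardCLM_apply, map_sub, sub_apply,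
    ContinuousLinearMap.id_apply]
  abel

/-- A chart in which the gradient is standard up to a flat error, and in which the stable and the
unstable manifold are coordinate planes. -/
theorem exists_straight_chart [T2Space X] (hf : ContMDiff 𝓘(ℝ, Rn n) 𝓘(ℝ, ℝ) ∞ f)
    (hp : IsCritical n f p) (hlam : IsMorseEigenvalues n f p lam) (hN : NLinearity lam)
    (hlam0 : ∀ i, lam i ≠ 0) :
    ∃ φ : OpenPartialHomeomorph X (Rn n), IsCentredChart φ p ∧
      (IsFlatBigO fun x => gradInChart f φ x - standardForm lam x) ∧
      ∀ y ∈ φ.target, (φ.symm y ∈ unstableManifold n f p ↔ posPart lam y = 0) ∧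
        (φ.symm y ∈ stableManifold n f p ↔ posPart lam y = y) := by
  obtain ⟨φ, hφ, hV⟩ := exists_flat_chart hf hp hlam hN
  obtain ⟨δs, hδs, ηs, -, hηs, hηsf, hηs0, -, hs⟩ := exists_graph_stableManifold hf hφ hlam0 hV
  obtain ⟨δu, hδu, ηu, -, hηu, hηuf, hηu0, -, hu⟩ := exists_graph_unstableManifold hf hφ hlam0 hV
  set δ := min δs δu
  have hδ : 0 < δ := by positivity
  have hσ : ContDiffOn ℝ ∞ (fun x => ηs x + ηu x) (Metric.ball 0 δ) :=
    (hηs.mono (Metric.ball_subset_ball (min_le_left _ _))).add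
      (hηu.mono (Metric.ball_subset_ball (min_le_right _ _)))
  have hσf := hηsf.add hηuf
  -- One subtraction straightens both manifolds, because the two graph functions take values in
  -- complementary planes.
  have hd : HasFDerivAt (fun x => x - (ηs x + ηu x))
      (ContinuousLinearEquiv.refl ℝ (Rn n) : Rn n →L[ℝ] Rn n) 0 := by
    have := (hasFDerivAt_id (0 : Rn n)).fun_sub hσf.hasFDerivAt_zero
    rw [sub_zero] at this
    exact this
  obtain ⟨e, he0, heU, heh, hes, het⟩ := exists_smooth_local_inverse Metric.isOpen_ball
    (Metric.mem_ball_self (x := (0 : Rn n)) hδ) (contDiffOn_id.sub hσ) _ hd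
  replace heh : ∀ x, e x = x - (ηs x + ηu x) := heh
  have he : e 0 = 0 := by rw [heh, zero_sub, neg_eq_zero, hσf.apply_zero]
  refine ⟨φ.trans e, hφ.trans he0 he hes het, isFlatBigO_gradInChart_trans hφ he0 he hes het ?_,
    fun y hy => ?_⟩
  · rw [show (e : Rn n → Rn n) = fun x => x - (ηs x + ηu x) from funext heh]
    exact isFlatBigO_fderiv_id_sub hf hφ hV hδ hσ hσf
  · have hx := heU (e.map_target hy.1)
    have hxy : y = e.symm y - (ηs (e.symm y) + ηu (e.symm y)) := by
      rw [← heh, e.right_inv hy.1]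
    rw [OpenPartialHomeomorph.coe_trans_symm, Function.comp,
      hu _ (Metric.ball_subset_ball (min_le_right _ _) hx),
      hs _ (Metric.ball_subset_ball (min_le_left _ _) hx)]
    set x := e.symm y
    -- The projection annihilates `ηs` and fixes `ηu`; the complementary component of `y` is
    -- likewise `x - posPart lam x - ηs x`.
    have hPy : posPart lam y = posPart lam x - ηu x := by
      rw [hxy, map_sub, map_add, hηs0, hηu0, zero_add]
    refine ⟨?_, ?_⟩
    · rw [hPy, sub_eq_zero]
    · rw [hPy, hxy, ← sub_eq_zero, ← sub_eq_zero (a := posPart lam x - ηu x), ← neg_eq_zero]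
      have : -(x - posPart lam x - ηs x) = posPart lam x - ηu x - (x - (ηs x + ηu x)) := by abel
      rw [this]

theorem symm_image_inter_target_eq {P : Set (Rn n)} {W : Set X}
    (h : ∀ y ∈ φ.target, (φ.symm y ∈ W ↔ y ∈ P)) : φ.symm '' (P ∩ φ.target) = W ∩ φ.source := by
  ext q
  constructor
  · rintro ⟨y, ⟨hyP, hyt⟩, rfl⟩
    exact ⟨(h y hyt).2 hyP, φ.map_target hyt⟩
  · rintro ⟨hqW, hqs⟩
    refine ⟨φ q, ⟨(h _ (φ.map_source hqs)).1 ?_, φ.map_source hqs⟩, φ.left_inv hqs⟩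
    rwa [φ.left_inv hqs]

theorem IsFlatBigO.exists_bound_on_ball {F : Type*} [NormedAddCommGroup F] {G : Rn n → F}
    (hG : IsFlatBigO G) {R : ℝ} (hc : ContinuousOn G (Metric.closedBall 0 R)) (N : ℕ) :
    ∃ C, ∀ x ∈ Metric.closedBall (0 : Rn n) R, ‖G x‖ ≤ C * ‖x‖ ^ N := by
  obtain ⟨C, hC, r, hr, h⟩ := exists_bound_of_isBigO_norm_pow (hG N)
  obtain ⟨M, hM⟩ := (isCompact_closedBall (0 : Rn n) R).exists_bound_of_continuousOn hc
  -- Within distance `r` flatness gives the bound; farther out `‖x‖ ^ N ≥ r ^ N` and compactness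
  -- suffices.
  refine ⟨max C (M / r ^ N), fun x hx => ?_⟩
  rcases lt_or_ge ‖x‖ r with hxr | hxr
  · exact (h x hxr).trans (by gcongr; exact le_max_left _ _)
  · have hM0 : 0 ≤ M := (norm_nonneg _).trans (hM x hx)
    calc ‖G x‖ ≤ M := hM x hx
      _ = M / r ^ N * r ^ N := by field_simp
      _ ≤ max C (M / r ^ N) * ‖x‖ ^ N := by
        gcongr
        exact le_max_right _ _

/-- Charts can be shrunk to have a ball as their target. -/
theorem exists_isCentredChart_ball (hφ : IsCentredChart φ p) {U : Set X} (hU : IsOpen U)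
    (hpU : p ∈ U) :
    ∃ R > 0, Metric.closedBall 0 R ⊆ φ.target ∧ ∃ ψ : OpenPartialHomeomorph X (Rn n),
      IsCentredChart ψ p ∧ ψ.source ⊆ U ∧ ψ.target = Metric.ball 0 R ∧
      (∀ y, ψ.symm y = φ.symm y) ∧ ∀ f : X → ℝ, gradInChart f ψ = gradInChart f φ := by
  have hopen : IsOpen (φ.target ∩ φ.symm ⁻¹' U) := φ.isOpen_inter_preimage_symm hU
  have h0 : (0 : Rn n) ∈ φ.target ∩ φ.symm ⁻¹' U :=
    ⟨hφ.zero_mem_target, by rwa [mem_preimage, hφ.symm_zero]⟩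
  obtain ⟨R, hR, hRs⟩ := Metric.nhds_basis_closedBall.mem_iff.1 (hopen.mem_nhds h0)
  refine ⟨R, hR, fun y hy => (hRs hy).1,
    φ.trans (OpenPartialHomeomorph.ofSet (Metric.ball 0 R) Metric.isOpen_ball),
    hφ.trans (Metric.mem_ball_self hR) rfl contDiffOn_id contDiffOn_id, ?_, ?_, fun y => rfl, fun f => rfl⟩
  · intro q hq
    have hqs : q ∈ φ.source := hq.1
    have := (hRs (Metric.ball_subset_closedBall hq.2)).2
    rwa [mem_preimage, OpenPartialHomeomorph.symm_symm, φ.left_inv hqs] at this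
  · ext y
    exact ⟨fun h => h.1, fun h => ⟨h, (hRs (Metric.ball_subset_closedBall h)).1⟩⟩

end StraightChart
end MorseGradient

/-! ### Conclusion. -/

theorem mainTheorem5 {n k : ℕ} (hk : k ≤ n)
    {X : Type*} [TopologicalSpace X] [T2Space X] [ChartedSpace (Rn n) X]
    [IsManifold 𝓘(ℝ, Rn n) ∞ X]
    [RiemannianBundle (fun x : X => TangentSpace 𝓘(ℝ, Rn n) x)]
    [IsContMDiffRiemannianBundle 𝓘(ℝ, Rn n) ∞ (Rn n)
      (fun x : X => TangentSpace 𝓘(ℝ, Rn n) x)]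
    (f : X → ℝ) (hf : IsMorse n f)
    (p : X) (hp : IsCritical n f p)
    (lam : Fin n → ℝ) (hlam : IsMorseEigenvalues n f p lam)
    (hneg : ∀ i : Fin n, (i : ℕ) < k → lam i < 0)
    (hpos : ∀ i : Fin n, k ≤ (i : ℕ) → 0 < lam i)
    (hN : NLinearity lam) :
    -- arbitrarily small charts in which the unstable and stable manifolds are the coordinate planes
    (∀ U : Set X, IsOpen U → p ∈ U →
      ∃ φ : OpenPartialHomeomorph X (Rn n),
        IsCentredChart φ p ∧ φ.source ⊆ U ∧
        φ.symm '' (firstPlane n k ∩ φ.target) =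
          unstableManifold n f p ∩ φ.source ∧
        φ.symm '' (lastPlane n k ∩ φ.target) =
          stableManifold n f p ∩ φ.source ∧
        IsFlatAt
          (fun x => gradInChart f φ x - standardForm lam x) 0 ∧
        ∀ N : ℕ, ∃ C : ℝ, ∀ x ∈ φ.target,
          ‖gradInChart f φ x - standardForm lam x‖ ≤ C * ‖x‖ ^ N) ∧
    -- in every centred chart in which the gradient is standard up to a flat error,
    -- the unstable and stable manifolds are near the origin graphs of flat functions
    (∀ φ : OpenPartialHomeomorph X (Rn n),
      IsCentredChart φ p →
      IsFlatAt
        (fun x => gradInChart f φ x - standardForm lam x) 0 →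
      ∃ (A : Set (Rn k)) (B : Set (Rn (n - k)))
        (Y : Rn k → Rn (n - k))
        (Z : Rn (n - k) → Rn k),
        IsOpen A ∧ 0 ∈ A ∧ IsOpen B ∧ 0 ∈ B ∧
        (∀ a ∈ A, ∀ b ∈ B, joinCoords (n := n) a b ∈ φ.target) ∧
        ContDiffOn ℝ ∞ Y A ∧ MapsTo Y A B ∧ ContDiffOn ℝ ∞ Z B ∧ MapsTo Z B A ∧
        (∀ a ∈ A, ∀ b ∈ B,
          φ.symm (joinCoords a b) ∈ unstableManifold n f p ↔ b = Y a) ∧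
        (∀ a ∈ A, ∀ b ∈ B,
          φ.symm (joinCoords a b) ∈ stableManifold n f p ↔ a = Z b) ∧
        IsFlatAt Y 0 ∧ IsFlatAt Z 0) := by
  have hlam0 : ∀ i, lam i ≠ 0 := fun i => (lt_or_ge (i : ℕ) k).elim
    (fun h => (hneg i h).ne) fun h => (hpos i h).ne'
  refine ⟨fun U hU hpU => ?_, fun φ hφ hflat =>
    exists_flat_graphs hk hf.1 hφ hneg hpos hflat.isFlatBigO⟩
  obtain ⟨φ, hφ, hV, hW⟩ := exists_straight_chart hf.1 hp hlam hN hlam0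
  obtain ⟨R, hR, hRt, ψ, hψ, hψU, hψt, hψφ, hψV⟩ := exists_isCentredChart_ball hφ hU hpU
  have hsub : ψ.target ⊆ φ.target := by
    rw [hψt]
    exact Metric.ball_subset_closedBall.trans hRt
  rw [← hψV f] at hV
  refine ⟨ψ, hψ, hψU, symm_image_inter_target_eq fun y hy => ?_,
    symm_image_inter_target_eq fun y hy => ?_,
    hV.isFlatAt (hψ.contDiffAt_gradInChart_sub hf.1 lam), fun N => ?_⟩
  · rw [hψφ, (hW y (hsub hy)).1, posPart_eq_zero_iff_mem_firstPlane hneg hpos]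
  · rw [hψφ, (hW y (hsub hy)).2, posPart_eq_self_iff_mem_lastPlane hneg hpos]
  -- The estimate is uniform on the whole chart because the closed ball still lies in the target of
  -- the larger chart, where the field is continuous.
  · obtain ⟨C, hC⟩ := hV.exists_bound_on_ball (R := R) (by
      rw [hψV]
      simp only [← standardCLM_apply]
      exact ((contDiffOn_gradInChart hf.1 hφ.1).continuousOn.mono hRt).sub
        (standardCLM lam).continuous.continuousOn) N
    refine ⟨C, fun x hx => hC x ?_⟩
    rw [hψt] at hx
    exact Metric.ball_subset_closedBall hx
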